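/- Let $d\in\{2,3\}$, let $\mathcal D\subset\mathbb R^d$ be a bounded open polyhedral domain tessellated by a conformal mesh $\mathcal T_h$ of finitely many simplices $K$ ($\mathcal D$ is the interior of their union), with internal edges (faces, if $d=3$) $E_j$, and let $\mathrm{Re}\ge 0$, $\mathrm{Wi}>0$, $\varepsilon\in(0,1)$. Let $V_h=(\mathbb P_2)^d$ be the space of continuous vector fields on $\overline{\mathcal D}$ that vanish on $\partial\mathcal D$ and whose components are polynomials of degree at most $2$ on each $K$; let $Q_h=\mathbb P_{1,disc}$ be the space of scalar fields that are polynomials of degree at most $1$ on each $K$, without continuity between cells; and let $\Sigma_h=(\mathbb P_0)^{d(d+1)/2}$ be the space of symmetric $d\times d$ tensor fields that are constant on each $K$. Write $(\nabla u)_{ij}=\partial_j u_i$ and $A:B=\sum_{i,j}A_{ij}B_{ij}$. For a time step $\Delta t>0$ put $t^n=n\Delta t$. Given $(u_h^n,\sigma_h^n)\in V_h\times\Sigma_h$, one step of the characteristic scheme consists in finding $(u_h^{n+1},p_h^{n+1},\sigma_h^{n+1})\in V_h\times Q_h\times\Sigma_h$ such that, for all $(v,q,\phi)\in V_h\times Q_h\times\Sigma_h$,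 \[ \begin{aligned} 0=\int_{\mathcal D}\Big[&\mathrm{Re}\Big(\frac{u_h^{n+1}-u_h^n}{\Delta t}+u_h^n\cdot\nabla u_h^{n+1}\Big)\cdot v-p_h^{n+1}\operatorname{div}v+q\operatorname{div}u_h^{n+1}+(1-\varepsilon)\nabla u_h^{n+1}:\nabla v+\frac{\varepsilon}{\mathrm{Wi}}\sigma_h^{n+1}:\nabla v\\ &+\frac{\sigma_h^{n+1}-\sigma_h^n\circ X^n(t^n)}{\Delta t}:\phi-\big((\nabla u_h^{n+1})\sigma_h^{n+1}+\sigma_h^{n+1}(\nabla u_h^{n+1})^T\big):\phi+\frac1{\mathrm{Wi}}(\sigma_h^{n+1}-I):\phi\Big], \end{aligned} \] where $X^n$ is the backward flow in $\mathcal D$: $\frac{d}{dt}X^n(t,x)=u_h^n(X^n(t,x))$ for $t\in[t^n,t^{n+1}]$, $X^n(t^{n+1},x)=x$, for all $x\in\mathcal D$. One step of the discontinuous Galerkin (DG) scheme is the same problem with $\sigma_h^n\circ X^n(t^n)$ replaced by $\sigma_h^n$ and with the term \[ \sum_j\int_{E_j}|u_h^n\cdot n|\,[\![\sigma_h^{n+1}]\!]:\phi^+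 \] added to the right-hand side, where $n$ is a unit normal to $E_j$, $\phi^\pm(x)=\lim_{\delta\to0^\pm}\phi(x+\delta u_h^n(x))$ are the downstream and upstream values, and $[\![\phi]\!]=\phi^+-\phi^-$. Proposition. For each of the two schemes, and for every initial condition $(u_h^0,\sigma_h^0)\in V_h\times\Sigma_h$ with $\sigma_h^0$ symmetric positive definite, there is a constant $c_1>0$, depending only on $(u_h^0,\sigma_h^0)$ (and on the fixed mesh and the parameters $\mathrm{Re},\mathrm{Wi},\varepsilon$), such that for every time step $0<\Delta t<c_1$ the scheme started from $(u_h^0,\sigma_h^0)$ can be continued for all iterations $n\in\mathbb N$: at each iteration $n$ there is one and only one pair $(u_h^{n+1},\sigma_h^{n+1})\in V_h\times\Sigma_h$ with $\sigma_h^{n+1}$ symmetric positive definite that solves the system together with some pressure $p_h^{n+1}\in Q_h$. -/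

import Mathlib

open MeasureTheory

noncomputable section

namespace OldroydB

/-- Euclidean space `ℝ^d`. -/
abbrev Pt (d : ℕ) : Type := EuclideanSpace ℝ (Fin d)

/-- Real `d × d` matrices (rank-two tensors). -/
abbrev Tensor (d : ℕ) : Type := Matrix (Fin d) (Fin d) ℝ

/-- Double contraction `A : B = ∑ i j, A i j * B i j`. -/
def ddot {d : ℕ} (A B : Tensor d) : ℝ := ∑ i, ∑ j, A i j * B i j

/-- Velocity gradient `(∇u) i j = ∂ u_i / ∂ x_j`. -/
def grad {d : ℕ} (u : Pt d → Pt d) (x : Pt d) : Tensor d :=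
  Matrix.of fun i j => fderiv ℝ u x (EuclideanSpace.single j 1) i

/-- Divergence of a vector field. -/
def divergence {d : ℕ} (u : Pt d → Pt d) (x : Pt d) : ℝ := (grad u x).trace

/-- A conformal simplicial mesh in `ℝ^d`. A cell is given by the finite set of its `d + 1`
affinely independent vertices; two cells meet along the simplex spanned by their common
vertices (which may be empty). -/
structure Mesh (d : ℕ) where
  /-- The vertex sets of the cells. -/
  cells : Finset (Finset (Pt d))
  card_eq : ∀ K ∈ cells, K.card = d + 1
  affineIndependent : ∀ K ∈ cells, AffineIndependent ℝ (fun x : K => (x : Pt d))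
  conformal : ∀ K ∈ cells, ∀ L ∈ cells,
    convexHull ℝ (K : Set (Pt d)) ∩ convexHull ℝ (L : Set (Pt d)) =
      convexHull ℝ ((K : Set (Pt d)) ∩ (L : Set (Pt d)))

namespace Mesh

variable {d : ℕ} (M : Mesh d)

/-- The type of cells of the mesh. -/
abbrev Cell : Type := {K : Finset (Pt d) // K ∈ M.cells}

variable {M} in
/-- The closed simplex occupied by a cell. -/
def simplex (K : M.Cell) : Set (Pt d) := convexHull ℝ (K.1 : Set (Pt d))

/-- The open bounded polyhedral domain tessellated by the mesh: the interior of the union of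
the closed cells. -/
def domain : Set (Pt d) := interior (⋃ K : M.Cell, simplex K)

/-- `(ℙ₂)^d` with homogeneous Dirichlet condition: continuous fields whose components are
polynomials of degree at most `2` on each cell and which vanish on the boundary of the domain.
Such a field is represented by its (continuous) extension by zero outside the domain. -/
def velocitySpace : Set (Pt d → Pt d) :=
  {u | Continuous u ∧ (∀ x, x ∉ M.domain → u x = 0) ∧
    ∀ (K : M.Cell) (i : Fin d), ∃ P : MvPolynomial (Fin d) ℝ, P.totalDegree ≤ 2 ∧
      ∀ x ∈ simplex K, u x i = MvPolynomial.eval (fun j => x j) P}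

/-- `ℙ_{1,disc}`: on each cell a polynomial of degree at most `1`, with no continuity
requirement between cells. `p K` is the polynomial function attached to the cell `K`. -/
def pressureSpace : Set (M.Cell → Pt d → ℝ) :=
  {p | ∀ K : M.Cell, ∃ P : MvPolynomial (Fin d) ℝ, P.totalDegree ≤ 1 ∧
    ∀ x, p K x = MvPolynomial.eval (fun j => x j) P}

/-- `(ℙ₀)^{d(d+1)/2}`: symmetric tensor fields that are constant on each cell, given by their
values on the cells. -/
def stressSpace : Set (M.Cell → Tensor d) := {σ | ∀ K : M.Cell, (σ K).IsSymm}

variable {M} in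
/-- The piecewise constant tensor field on `ℝ^d` whose value in the interior of the cell `K`
is `σ K` (and which is zero elsewhere). -/
def toField (σ : M.Cell → Tensor d) (x : Pt d) : Tensor d :=
  ∑ K : M.Cell, (interior (simplex K)).indicator (fun _ => σ K) x

/-- `X` is the backward flow of the velocity field `u` on the time interval `[s, t]`:
for every `x` in the domain, `X τ x` stays in the domain, `d/dτ X τ x = u (X τ x)` on `[s, t]`,
and `X t x = x`. -/
def IsBackwardFlow (u : Pt d → Pt d) (s t : ℝ) (X : ℝ → Pt d → Pt d) : Prop :=
  ∀ x ∈ M.domain, X t x = x ∧ ∀ τ ∈ Set.Icc s t, X τ x ∈ M.domain ∧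
    HasDerivWithinAt (fun r => X r x) (u (X τ x)) (Set.Icc s t) τ

/-- The part of the integrand common to both schemes, at the point `x`:
`Re ((u - u₀)/Δt + u₀·∇u)·v - p div v + q div u + (1-ε) ∇u:∇v + (ε/Wi) S:∇v
  - ((∇u) S + S (∇u)ᵀ):Φ + (1/Wi) (S - I):Φ`,
where `S` and `Φ` are the values at `x` of the stress and of the stress test function. -/
def bulkIntegrand (Re Wi ε Δt : ℝ) (u₀ u v : Pt d → Pt d) (p q : Pt d → ℝ) (S Φ : Tensor d)
    (x : Pt d) : ℝ :=
  Re * inner ℝ ((1 / Δt) • (u x - u₀ x) + fderiv ℝ u x (u₀ x)) (v x)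
    - p x * divergence v x + q x * divergence u x
    + (1 - ε) * ddot (grad u x) (grad v x)
    + ε / Wi * ddot S (grad v x)
    - ddot (grad u x * S + S * (grad u x).transpose) Φ
    + 1 / Wi * ddot (S - 1) Φ

/-- One time step, from `t^n = n Δt` to `t^{n+1} = (n + 1) Δt`, of the scheme with the
characteristic method: given `(u₀, σ₀)` at time `t^n`, the triple `(u, p, σ)` in the finite
element spaces satisfies the discrete variational formulation for all test functions. -/
def IsCharacteristicStep (Re Wi ε Δt : ℝ) (n : ℕ) (u₀ : Pt d → Pt d) (σ₀ : M.Cell → Tensor d)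
    (u : Pt d → Pt d) (p : M.Cell → Pt d → ℝ) (σ : M.Cell → Tensor d) : Prop :=
  u ∈ M.velocitySpace ∧ p ∈ M.pressureSpace ∧ σ ∈ M.stressSpace ∧
  ∃ X : ℝ → Pt d → Pt d, M.IsBackwardFlow u₀ (n * Δt) ((n + 1) * Δt) X ∧
    ∀ v ∈ M.velocitySpace, ∀ q ∈ M.pressureSpace, ∀ φ ∈ M.stressSpace,
      0 = ∑ K : M.Cell, ∫ x in simplex K,
        (bulkIntegrand Re Wi ε Δt u₀ u v (p K) (q K) (σ K) (φ K) x
          + ddot ((1 / Δt) • (σ K - toField σ₀ (X (n * Δt) x))) (φ K))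

open Classical in
variable {M} in
/-- The common vertices of two cells. -/
def commonVertices (K L : M.Cell) : Finset (Pt d) := K.1 ∩ L.1

variable {M} in
/-- Two cells are adjacent if they share an edge (`d = 2`) or face (`d = 3`), i.e. have exactly
`d` common vertices; in particular they are then distinct. -/
def Adjacent (K L : M.Cell) : Prop := (commonVertices K L).card = d

variable {M} in
/-- The closed internal edge (face) shared by two adjacent cells. -/
def face (K L : M.Cell) : Set (Pt d) := convexHull ℝ (commonVertices K L : Set (Pt d))

variable {M} in
/-- The unit normal to the edge (face) shared by the adjacent cells `K` and `L`, oriented from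
`K` to `L`. For adjacent cells the difference of the vertex sums is `b - a`, with `a` and `b` the
vertices of `K` and `L` opposite to the common face; it is projected on the line orthogonal to
the face and normalized. -/
def normal (K L : M.Cell) : Pt d :=
  let w : Pt d := (vectorSpan ℝ (commonVertices K L : Set (Pt d)))ᗮ.starProjection
    (∑ b ∈ L.1, b - ∑ a ∈ K.1, a)
  ‖w‖⁻¹ • w

variable {M} in
/-- The downstream value `φ⁺` at the point `x` of the face between the adjacent cells `K` and
`L`: the value in the cell towards which `u x` points. (Where `u x` is tangent to the face the
value is irrelevant, since it is multiplied by `|u·n|`.) -/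
def downstream (u : Pt d → Pt d) (K L : M.Cell) (φ : M.Cell → Tensor d) (x : Pt d) : Tensor d :=
  if 0 < inner ℝ (u x) (normal K L) then φ L else φ K

variable {M} in
/-- The upstream value `φ⁻` at the point `x` of the face between `K` and `L`. -/
def upstream (u : Pt d → Pt d) (K L : M.Cell) (φ : M.Cell → Tensor d) (x : Pt d) : Tensor d :=
  if 0 < inner ℝ (u x) (normal K L) then φ K else φ L

variable {M} in
/-- The jump `⟦φ⟧ = φ⁺ - φ⁻` over the face between `K` and `L`. -/
def jump (u : Pt d → Pt d) (K L : M.Cell) (φ : M.Cell → Tensor d) (x : Pt d) : Tensor d :=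
  downstream u K L φ x - upstream u K L φ x

variable {M} in
/-- `∫_E |u·n| ⟦σ⟧ : φ⁺` over the face `E` between `K` and `L`, with respect to the
`(d-1)`-dimensional surface measure. -/
def faceIntegral (u : Pt d → Pt d) (σ φ : M.Cell → Tensor d) (K L : M.Cell) : ℝ :=
  ∫ x in face K L,
    |inner ℝ (u x) (normal K L)| * ddot (jump u K L σ x) (downstream u K L φ x)
    ∂(Measure.euclideanHausdorffMeasure (d - 1))

open Classical in
/-- `∑_j ∫_{E_j} |u·n| ⟦σ⟧ : φ⁺`, the sum over all internal edges (faces) `E_j`. The sum over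
ordered pairs of adjacent cells counts each of them twice, whence the factor `1 / 2`. -/
def upwindForm (u : Pt d → Pt d) (σ φ : M.Cell → Tensor d) : ℝ :=
  1 / 2 * ∑ K : M.Cell, ∑ L : M.Cell, if Adjacent K L then faceIntegral u σ φ K L else 0

/-- One time step of the scheme with the discontinuous Galerkin method: given `(u₀, σ₀)` at the
current time, the triple `(u, p, σ)` in the finite element spaces satisfies the discrete
variational formulation for all test functions. -/
def IsDGStep (Re Wi ε Δt : ℝ) (u₀ : Pt d → Pt d) (σ₀ : M.Cell → Tensor d)
    (u : Pt d → Pt d) (p : M.Cell → Pt d → ℝ) (σ : M.Cell → Tensor d) : Prop :=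
  u ∈ M.velocitySpace ∧ p ∈ M.pressureSpace ∧ σ ∈ M.stressSpace ∧
  ∀ v ∈ M.velocitySpace, ∀ q ∈ M.pressureSpace, ∀ φ ∈ M.stressSpace,
    0 = (∑ K : M.Cell, ∫ x in simplex K,
        (bulkIntegrand Re Wi ε Δt u₀ u v (p K) (q K) (σ K) (φ K) x
          + ddot ((1 / Δt) • (σ K - σ₀ K)) (φ K)))
      + M.upwindForm u₀ σ φ

variable {M} in
/-- A piecewise constant tensor field is symmetric positive definite. -/
def IsSPD (σ : M.Cell → Tensor d) : Prop := ∀ K : M.Cell, (σ K).PosDef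

/-- The scheme with steps `step n (u^n, σ^n) (u^{n+1}, p^{n+1}, σ^{n+1})`, started from
`(u₀, σ₀)`, can be continued for all `n`, and at each iteration `n` the pair `(u^{n+1}, σ^{n+1})`
is the unique one with `σ^{n+1}` symmetric positive definite that solves the system (for some
pressure). -/
def UniquelySolvable
    (step : ℕ → (Pt d → Pt d) → (M.Cell → Tensor d) →
      (Pt d → Pt d) → (M.Cell → Pt d → ℝ) → (M.Cell → Tensor d) → Prop)
    (u₀ : Pt d → Pt d) (σ₀ : M.Cell → Tensor d) : Prop :=
  ∃ (U : ℕ → Pt d → Pt d) (S : ℕ → M.Cell → Tensor d), U 0 = u₀ ∧ S 0 = σ₀ ∧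
    ∀ n : ℕ, IsSPD (S (n + 1)) ∧
      (∃ p, step n (U n) (S n) (U (n + 1)) p (S (n + 1))) ∧
      ∀ u p σ, IsSPD σ → step n (U n) (S n) u p σ → u = U (n + 1) ∧ σ = S (n + 1)

end Mesh

end OldroydB

end

section

open scoped Matrix Matrix.Norms.Frobenius Topology

namespace OldroydB

/-! ### Tensor algebra and the free energy density -/

section TensorLemmas

variable {d : ℕ}

/-! The engine is a discrete free energy estimate. Test the momentum equation with the new velocity
and the stress equation with `ε / (2 * Wi)` times `1 - σ⁻¹`. The works of the stress cancel, the
trace of the velocity gradient drops out, and convexity of `tr σ - log det σ - d`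
(`freeEnergy_sub_le_ddot`) gives the right sign to the time difference, the transport, the upwind
jumps and the relaxation. The resulting bound (`IsSol.energy_le`) controls the stress from above,
its smallest eigenvalue from below, and `Δt` times the squared gradient norm of the velocity.

One step is solved by contraction. For a given stress the momentum equation on discretely
divergence-free velocities is linear and coercive, so the velocity can be eliminated, with a
Lipschitz constant that does not depend on `Δt`. What remains is a fixed-point equation: the new
stress is the transported one plus `Δt` times a rate. On a ball of stresses the new velocity
gradient and the upwind weights are only `O(Δt^(-1/2))`, so the increment and the Lipschitz constant
of the fixed-point map are `O(Δt^(1/2))`. For small `Δt` there is one fixed point in the ball. It is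
close to a convex combination of positive definite tensors with a known spectral lower bound, hence
positive definite. Conversely the energy estimate puts every positive definite solution in the ball,
whence uniqueness. The threshold for `Δt` depends only on bounds for the previous state
(`exists_unique_isSol`).

These bounds do not degrade with the iterations. The initial velocity need not be divergence-free,
so the first step may create energy, but for small `Δt` at most by a fixed factor. Every computed
velocity is pointwise divergence-free inside the cells, because the divergence of a `ℙ₂` field is an
admissible pressure. From then on the free energy does not increase, and the dissipation of each
step bounds `Δt` times the squared gradient norm of the next convecting velocity. One threshold
therefore serves all iterations.

Both schemes reduce to the same finite-dimensional problem, with a transfer matrix `m` and upwind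
weights `b`. For the characteristic scheme `m K L` is the volume of the part of `K` that the
backward flow sends into `L`, and `b = 0`; the column sums of `m` are bounded because the flow of a
divergence-free Lipschitz field preserves volume. For the DG scheme `m` is diagonal and `b K L` is
the flow rate from `L` into `K`; the imbalance of `b` at a cell is the integral of the divergence,
by the divergence theorem on a simplex. The pressure is recovered by duality in finite dimension. -/

theorem ddot_eq_trace (A B : Tensor d) : ddot A B = (A * B.transpose).trace := by
  simp [ddot, Matrix.trace, Matrix.mul_apply]

theorem ddot_comm (A B : Tensor d) : ddot A B = ddot B A := by
  simp [ddot, mul_comm]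

theorem ddot_add_left (A B C : Tensor d) : ddot (A + B) C = ddot A C + ddot B C := by
  simp [ddot, add_mul, Finset.sum_add_distrib]

theorem ddot_smul_left (r : ℝ) (A C : Tensor d) : ddot (r • A) C = r * ddot A C := by
  simp [ddot, Finset.mul_sum, mul_assoc]

/-- The double contraction as a bilinear map. -/
noncomputable def ddotL (d : ℕ) : Tensor d →ₗ[ℝ] Tensor d →ₗ[ℝ] ℝ :=
  LinearMap.mk₂ ℝ ddot ddot_add_left ddot_smul_left
    (fun A B C => by rw [ddot_comm, ddot_add_left, ddot_comm B, ddot_comm C])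
    (fun r A C => by rw [ddot_comm, ddot_smul_left, ddot_comm C, smul_eq_mul])

theorem ddotL_apply (A B : Tensor d) : ddotL d A B = ddot A B := rfl

theorem ddot_sub_left (A B C : Tensor d) : ddot (A - B) C = ddot A C - ddot B C := by
  simp [← ddotL_apply]

theorem ddot_add_right (A B C : Tensor d) : ddot A (B + C) = ddot A B + ddot A C := by
  simp [← ddotL_apply]

theorem ddot_smul_right (r : ℝ) (A C : Tensor d) : ddot A (r • C) = r * ddot A C := by
  simp [← ddotL_apply]

theorem ddot_sum_left {ι : Type*} (s : Finset ι) (A : ι → Tensor d) (C : Tensor d) :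
    ddot (∑ i ∈ s, A i) C = ∑ i ∈ s, ddot (A i) C := by
  simp [← ddotL_apply]

theorem ddot_self_eq_norm_sq (A : Tensor d) : ddot A A = ‖A‖ ^ 2 := by
  rw [Matrix.frobenius_norm_def, ← Real.sqrt_eq_rpow, Real.sq_sqrt (by positivity)]
  simp [ddot, sq]

theorem abs_ddot_le (A B : Tensor d) : |ddot A B| ≤ ‖A‖ * ‖B‖ := by
  have h : ddot A B ^ 2 ≤ (‖A‖ * ‖B‖) ^ 2 := by
    rw [mul_pow, ← ddot_self_eq_norm_sq, ← ddot_self_eq_norm_sq]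
    have := Finset.sum_mul_sq_le_sq_mul_sq (Finset.univ : Finset (Fin d × Fin d))
      (fun p => A p.1 p.2) (fun p => B p.1 p.2)
    simpa [ddot, Fintype.sum_prod_type, sq] using this
  exact abs_le_of_sq_le_sq h (by positivity)

theorem abs_apply_le_norm (A : Tensor d) (i j : Fin d) : |A i j| ≤ ‖A‖ := by
  refine abs_le_of_sq_le_sq ?_ (norm_nonneg _)
  rw [← ddot_self_eq_norm_sq, ddot, sq]
  refine (Finset.single_le_sum (f := fun j => A i j * A i j)
    (fun j _ => mul_self_nonneg _) (Finset.mem_univ j)).trans ?_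
  exact Finset.single_le_sum (f := fun i => ∑ j, A i j * A i j)
    (fun i _ => Finset.sum_nonneg fun j _ => mul_self_nonneg _) (Finset.mem_univ i)

/-- A crude entrywise bound: the factor `d` is not sharp, but it is enough to show that positive
definiteness survives a small perturbation. -/
theorem abs_quadratic_le (A : Tensor d) (x : Fin d → ℝ) :
    |x ⬝ᵥ (A *ᵥ x)| ≤ d * ‖A‖ * (x ⬝ᵥ x) := by
  have h1 : x ⬝ᵥ (A *ᵥ x) = ∑ i, ∑ j, x i * (A i j * x j) := by
    simp [dotProduct, Matrix.mulVec, Finset.mul_sum]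
  rw [h1]
  have h2 : ∀ i j, |x i * (A i j * x j)| ≤ ‖A‖ * ((x i * x i + x j * x j) / 2) := by
    intro i j
    have : |x i * (A i j * x j)| = |A i j| * |x i * x j| := by
      rw [← abs_mul]; ring_nf
    rw [this]
    refine mul_le_mul (abs_apply_le_norm A i j) ?_ (abs_nonneg _) (norm_nonneg _)
    rw [abs_le]; constructor <;> nlinarith [sq_nonneg (x i + x j), sq_nonneg (x i - x j)]
  calc |∑ i, ∑ j, x i * (A i j * x j)| ≤ ∑ i, ∑ j, |x i * (A i j * x j)| :=
        (Finset.abs_sum_le_sum_abs _ _).trans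
          (Finset.sum_le_sum fun i _ => Finset.abs_sum_le_sum_abs _ _)
    _ ≤ ∑ i, ∑ j, ‖A‖ * ((x i * x i + x j * x j) / 2) :=
        Finset.sum_le_sum fun i _ => Finset.sum_le_sum fun j _ => h2 i j
    _ = d * ‖A‖ * (x ⬝ᵥ x) := by
        simp only [← Finset.mul_sum, ← Finset.sum_div, Finset.sum_add_distrib, dotProduct]
        simp only [Finset.sum_const, Finset.card_univ, Fintype.card_fin, nsmul_eq_mul,
          Finset.mul_sum, ← Finset.sum_add_distrib, Finset.sum_div]
        exact Finset.sum_congr rfl fun i _ => by ring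

/-- The free energy density `tr A - ln det A - d`. -/
noncomputable def freeEnergy (A : Tensor d) : ℝ := A.trace - Real.log A.det - d

/-- In terms of the eigenvalues this is the sum of the inequalities `log λ ≤ λ - 1`. -/
theorem card_add_log_det_le_trace {A : Tensor d} (hA : A.PosDef) :
    (d : ℝ) + Real.log A.det ≤ A.trace := by
  rw [hA.1.trace_eq_sum_eigenvalues, hA.1.det_eq_prod_eigenvalues]
  have hpos := hA.1.posDef_iff_eigenvalues_pos.1 hA
  simp only [RCLike.ofReal_real_eq_id, id]
  rw [Real.log_prod fun i _ => (hpos i).ne']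
  have : ∀ i, Real.log (hA.1.eigenvalues i) ≤ hA.1.eigenvalues i - 1 := fun i =>
    Real.log_le_sub_one_of_pos (hpos i)
  have := Finset.sum_le_sum fun i (_ : i ∈ Finset.univ) => this i
  simp at this
  linarith

theorem freeEnergy_nonneg {A : Tensor d} (hA : A.PosDef) : 0 ≤ freeEnergy A := by
  have := card_add_log_det_le_trace hA
  unfold freeEnergy; linarith

open scoped MatrixOrder in
theorem exists_eq_conjTranspose_mul_self {A : Tensor d} (hA : A.PosDef) :
    ∃ S : Tensor d, A = Sᴴ * S :=
  CStarAlgebra.nonneg_iff_eq_star_mul_self.mp hA.posSemidef.nonneg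

/-- Convexity of the free energy, whose derivative at `A` is `1 - A⁻¹`. With `A⁻¹ = Sᴴ * S` it is
the trace–log-determinant inequality for the congruent matrix `S * B * Sᴴ`, which has trace `tr (B *
A⁻¹)` and determinant `det B / det A`. -/
theorem freeEnergy_sub_le_ddot {A B : Tensor d} (hA : A.PosDef) (hB : B.PosDef) :
    freeEnergy A - freeEnergy B ≤ ddot (A - B) (1 - A⁻¹) := by
  obtain ⟨S, hS⟩ := exists_eq_conjTranspose_mul_self hA.inv
  have hSu : IsUnit S := by
    have : IsUnit (A⁻¹).det := (Matrix.isUnit_iff_isUnit_det _).1 hA.inv.isUnit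
    rw [hS, Matrix.det_mul] at this
    exact (Matrix.isUnit_iff_isUnit_det _).2 (isUnit_of_mul_isUnit_right this)
  have hC : (S * B * Sᴴ).PosDef :=
    hB.mul_mul_conjTranspose_same (Matrix.vecMul_injective_of_isUnit hSu)
  have h1 := card_add_log_det_le_trace hC
  have hdet : (S * B * Sᴴ).det = B.det * (A⁻¹).det := by
    rw [hS]; simp only [Matrix.det_mul]; ring
  have htr : (S * B * Sᴴ).trace = (B * A⁻¹).trace := by
    rw [hS, Matrix.trace_mul_cycle, ← Matrix.mul_assoc, Matrix.trace_mul_cycle, Matrix.mul_assoc,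
      Matrix.trace_mul_comm, Matrix.mul_assoc]
  rw [hdet, htr, Real.log_mul hB.det_pos.ne' hA.inv.det_pos.ne', Matrix.det_nonsing_inv,
    Ring.inverse_eq_inv', Real.log_inv] at h1
  have h2 : ddot (A - B) (1 - A⁻¹) = A.trace - B.trace - d + (B * A⁻¹).trace := by
    have hAA : A * A⁻¹ = 1 :=
        Matrix.mul_nonsing_inv _ ((Matrix.isUnit_iff_isUnit_det _).1 hA.isUnit)
    have hsym : (A⁻¹).transpose = A⁻¹ := hA.inv.1
    rw [ddot_eq_trace, Matrix.transpose_sub, Matrix.transpose_one, hsym, sub_mul, mul_sub, mul_sub,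
      hAA]
    simp
    ring
  rw [h2]
  unfold freeEnergy
  linarith

/-- The logarithm is absorbed by half of the trace: apply the trace–log-determinant inequality to `A
/ 2`. -/
theorem trace_le_of_freeEnergy_le {A : Tensor d} (hA : A.PosDef) {M : ℝ} (h : freeEnergy A ≤ M) :
    A.trace ≤ 2 * M + 2 * d := by
  have h2 : ((2⁻¹ : ℝ) • A).PosDef := hA.smul (by norm_num)
  have h3 := card_add_log_det_le_trace h2
  rw [Matrix.det_smul, Matrix.trace_smul, Fintype.card_fin, Real.log_mul (by positivity)
    hA.det_pos.ne', Real.log_pow, Real.log_inv, smul_eq_mul] at h3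
  unfold freeEnergy at h
  have := Real.log_two_lt_d9
  have h4 : (d : ℝ) * Real.log 2 ≤ d * 1 :=
    mul_le_mul_of_nonneg_left (by linarith) (Nat.cast_nonneg _)
  linarith

/-- Positivity on the vectors `e_i ± e_j` bounds each entry by the mean of two diagonal entries,
hence by the trace. -/
theorem norm_le_mul_trace {A : Tensor d} (hA : A.PosDef) : ‖A‖ ≤ d * A.trace := by
  have htr : 0 ≤ A.trace := hA.posSemidef.trace_nonneg
  have hdiag : ∀ i, A i i ≤ A.trace := fun i =>
    Finset.single_le_sum (f := fun i => A i i) (fun i _ => hA.posSemidef.diag_nonneg)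
      (Finset.mem_univ i)
  have hent : ∀ i j, |A i j| ≤ A.trace := by
    intro i j
    have hs : A j i = A i j := by simpa using hA.1.apply i j
    have h1 := hA.posSemidef.dotProduct_mulVec_nonneg (Pi.single i 1 + Pi.single j 1)
    have h2 := hA.posSemidef.dotProduct_mulVec_nonneg (Pi.single i 1 - Pi.single j 1)
    simp [Matrix.mulVec_add, Matrix.mulVec_sub, add_dotProduct, sub_dotProduct,
      dotProduct_add, dotProduct_sub, hs] at h1 h2
    have := hdiag i
    have := hdiag j
    rw [abs_le]; constructor <;> linarith
  refine le_of_sq_le_sq ?_ (by positivity)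
  rw [← ddot_self_eq_norm_sq, ddot]
  calc ∑ i, ∑ j, A i j * A i j ≤ ∑ _i : Fin d, ∑ _j : Fin d, A.trace * A.trace := by
        refine Finset.sum_le_sum fun i _ => Finset.sum_le_sum fun j _ => ?_
        rw [← abs_mul_abs_self]
        exact mul_self_le_mul_self (abs_nonneg _) (hent i j)
    _ = (d * A.trace) ^ 2 := by simp; ring

/-- The free energy is a sum of nonnegative terms `λ - log λ - 1`, so each term is at most `M`. This
gives `log λ ≥ -(M + 1)` for every eigenvalue. -/
theorem quadratic_ge_of_freeEnergy_le {A : Tensor d} (hA : A.PosDef) {M : ℝ}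
    (h : freeEnergy A ≤ M) (x : Fin d → ℝ) :
    Real.exp (-(M + 1)) * (x ⬝ᵥ x) ≤ x ⬝ᵥ (A *ᵥ x) := by
  have hpos := hA.1.posDef_iff_eigenvalues_pos.1 hA
  have hev : ∀ i, Real.exp (-(M + 1)) ≤ hA.1.eigenvalues i := by
    intro i
    have hsum : ∑ i, (hA.1.eigenvalues i - Real.log (hA.1.eigenvalues i) - 1) ≤ M := by
      unfold freeEnergy at h
      rw [hA.1.trace_eq_sum_eigenvalues, hA.1.det_eq_prod_eigenvalues] at h
      simp only [RCLike.ofReal_real_eq_id, id] at h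
      rw [Real.log_prod fun i _ => (hpos i).ne'] at h
      simpa [Finset.sum_sub_distrib] using h
    have h1 : hA.1.eigenvalues i - Real.log (hA.1.eigenvalues i) - 1 ≤ M :=
      (Finset.single_le_sum (f := fun i => hA.1.eigenvalues i - Real.log (hA.1.eigenvalues i) - 1)
        (fun i _ => by have := Real.log_le_sub_one_of_pos (hpos i); linarith)
        (Finset.mem_univ i)).trans hsum
    rw [← Real.exp_log (hpos i)]
    exact Real.exp_le_exp.2 (by linarith [hpos i])
  have hps : (A - Real.exp (-(M + 1)) • (1 : Tensor d)).PosSemidef := by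
    have hH : (A - Real.exp (-(M + 1)) • (1 : Tensor d)).IsHermitian :=
      hA.1.sub (by simp [Matrix.IsHermitian])
    rw [Matrix.posSemidef_iff_isHermitian_and_spectrum_nonneg]
    refine ⟨hH, fun r hr => ?_⟩
    have hr' : r + Real.exp (-(M + 1)) ∈ spectrum ℝ A := by
      rw [spectrum.add_mem_iff, Algebra.algebraMap_eq_smul_one, neg_add_eq_sub]
      exact hr
    rw [hA.1.spectrum_real_eq_range_eigenvalues] at hr'
    obtain ⟨i, hi⟩ := hr'
    have := hev i
    simp only [Set.mem_ofPred_eq]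
    linarith
  have := hps.dotProduct_mulVec_nonneg x
  simp only [star_trivial, Matrix.sub_mulVec, Matrix.smul_mulVec, dotProduct_sub,
    Matrix.one_mulVec, dotProduct_smul, smul_eq_mul] at this
  linarith

end TensorLemmas

end OldroydB

/-! ### The abstract time step and its free energy estimate -/

namespace OldroydB

/-- The finite-dimensional structure underlying one time step: cell volumes, the mass and stiffness
forms on the discretely divergence-free velocities, and the cell integrals of the gradient. -/
structure StepForms (ι : Type*) [Fintype ι] (H : Type*) [AddCommGroup H] [Module ℝ H]
    (d : ℕ) where
  vol : ι → ℝ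
  vol_pos : ∀ K, 0 < vol K
  mass : H →ₗ[ℝ] H →ₗ[ℝ] ℝ
  mass_nonneg : ∀ u, 0 ≤ mass u u
  stiff : H →ₗ[ℝ] H →ₗ[ℝ] ℝ
  stiff_pos : ∀ u, u ≠ 0 → 0 < stiff u u
  G : ι → H →ₗ[ℝ] Tensor d
  trace_G : ∀ K u, (G K u).trace = 0
  g : ℝ
  g_nonneg : 0 ≤ g
  norm_G_le : ∀ K u, ‖G K u‖ ≤ g * √(stiff u u)
  Re : ℝ
  Wi : ℝ
  ε : ℝ
  Re_nonneg : 0 ≤ Re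
  Wi_pos : 0 < Wi
  ε_pos : 0 < ε
  ε_lt_one : ε < 1

/-- The data of one time step that depend on the previous state: the load, the convection form,
the transfer matrix `m` of the stresses, the upwind weights `b`, and the previous stresses. -/
structure StepInput {ι : Type*} [Fintype ι] {H : Type*} [AddCommGroup H] [Module ℝ H] {d : ℕ}
    (S : StepForms ι H d) where
  load : H →ₗ[ℝ] ℝ
  -- The mass of the previous velocity; for the concrete load, `load_le` is Young's inequality.
  E : ℝ
  load_le : ∀ v, load v ≤ (S.mass v v + E) / 2
  conv : H →ₗ[ℝ] H →ₗ[ℝ] ℝ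
  -- `κ` limits the energy that convection can create, `β` the net outflow per unit volume. Both can
  -- be zero when the convecting velocity is divergence-free.
  κ : ℝ
  κ_nonneg : 0 ≤ κ
  conv_ge : ∀ v, -(κ * S.mass v v) ≤ conv v v
  m : ι → ι → ℝ
  m_nonneg : ∀ K L, 0 ≤ m K L
  -- Only the row sums matter for a single step. The column sums express volume preservation and
  -- enter in the iteration alone.
  m_sum : ∀ K, ∑ L, m K L = S.vol K
  b : ι → ι → ℝ
  b_nonneg : ∀ K L, 0 ≤ b K L
  β : ℝ
  b_imbalance : ∀ K, ∑ L, b L K - ∑ L, b K L ≤ β * S.vol K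
  σ : ι → Tensor d
  σ_posDef : ∀ K, (σ K).PosDef

namespace StepForms

variable {ι : Type*} [Fintype ι] {H : Type*} [AddCommGroup H] [Module ℝ H] {d : ℕ}
  (S : StepForms ι H d)

theorem stiff_nonneg (u : H) : 0 ≤ S.stiff u u := by
  by_cases h : u = 0
  · simp [h]
  · exact (S.stiff_pos u h).le

theorem exists_vol_lower : ∃ v : ℝ, 0 < v ∧ ∀ K, v ≤ S.vol K := by
  rcases isEmpty_or_nonempty ι with h | h
  · exact ⟨1, one_pos, fun K => h.elim K⟩
  · obtain ⟨K, hK⟩ := Finite.exists_min S.vol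
    exact ⟨S.vol K, S.vol_pos K, hK⟩

/-- The momentum equation tested with divergence-free velocities. -/
def Momentum (I : StepInput S) (Δt : ℝ) (u : H) (σ : ι → Tensor d) : Prop :=
  ∀ v, S.Re / Δt * (S.mass u v - I.load v) + S.Re * I.conv u v + (1 - S.ε) * S.stiff u v
    + S.ε / S.Wi * ∑ K, ddot (σ K) (S.G K v) = 0

/-- The volume-weighted rate of change of the stress in a cell. -/
noncomputable def rate (I : StepInput S) (u : H) (σ : ι → Tensor d) (K : ι) : Tensor d :=
  S.G K u * σ K + σ K * (S.G K u)ᵀ - ∑ L, I.b K L • (σ K - σ L)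
    - (S.vol K / S.Wi) • (σ K - 1)

/-- The pair `(u, σ)` solves one time step. -/
def IsSol (I : StepInput S) (Δt : ℝ) (u : H) (σ : ι → Tensor d) : Prop :=
  S.Momentum I Δt u σ ∧
    ∀ K, (1 / Δt) • (S.vol K • σ K - ∑ L, I.m K L • I.σ L) - S.rate I u σ K = 0

/-- The stress transported from the previous time step, averaged over a cell. -/
noncomputable def transported (I : StepInput S) (K : ι) : Tensor d :=
  (S.vol K)⁻¹ • ∑ L, I.m K L • I.σ L

variable {S}

/-- The fixed-point form of the stress equation on which the contraction argument acts. -/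
theorem IsSol.eq_transported_add {I : StepInput S} {Δt : ℝ} (hΔt : 0 < Δt) {u : H}
    {σ : ι → Tensor d} (K : ι) :
    (1 / Δt) • (S.vol K • σ K - ∑ L, I.m K L • I.σ L) - S.rate I u σ K = 0 ↔
      σ K = S.transported I K + (S.vol K)⁻¹ • (Δt • S.rate I u σ K) := by
  have hv := (S.vol_pos K).ne'
  rw [transported, ← smul_add, eq_inv_smul_iff₀ hv, sub_eq_zero, one_div, inv_smul_eq_iff₀ hΔt.ne',
    sub_eq_iff_eq_add, add_comm]

/-- The factor `A⁻¹` cancels against `A` and leaves only the trace of `G`, which vanishes for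
solenoidal velocities. The remaining work `2 A : G` is the one that the momentum equation balances.
-/
theorem ddot_upper_convected (G A : Tensor d) (hA : A.PosDef) :
    ddot (G * A + A * Gᵀ) (1 - A⁻¹) = 2 * ddot A G - 2 * G.trace := by
  have hAA : A * A⁻¹ = 1 := Matrix.mul_nonsing_inv _ ((Matrix.isUnit_iff_isUnit_det _).1 hA.isUnit)
  have hAA' : A⁻¹ * A = 1 := Matrix.nonsing_inv_mul _ ((Matrix.isUnit_iff_isUnit_det _).1 hA.isUnit)
  have hs : (A⁻¹)ᵀ = A⁻¹ := hA.inv.1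
  have hs' : Aᵀ = A := hA.1
  rw [ddot_eq_trace, ddot_eq_trace, Matrix.transpose_sub, Matrix.transpose_one, hs, mul_sub,
    mul_one, add_mul, Matrix.mul_assoc G, hAA, Matrix.trace_sub, Matrix.trace_add,
    Matrix.trace_add, Matrix.trace_mul_cycle A Gᵀ, hAA', one_mul, mul_one,
    Matrix.trace_transpose, ← Matrix.trace_transpose (G * A), Matrix.transpose_mul, hs']
  ring

/-- Free energy estimate for one time step. -/
theorem IsSol.energy_le {I : StepInput S} {Δt : ℝ} (hΔt : 0 < Δt) {u : H} {σ : ι → Tensor d}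
    (h : S.IsSol I Δt u σ) (hσ : ∀ K, (σ K).PosDef) :
    (1 - 2 * I.κ * Δt) * (S.Re / 2 * S.mass u u)
      + (1 - I.β * Δt) * (S.ε / (2 * S.Wi) * ∑ K, S.vol K * freeEnergy (σ K))
      + Δt * ((1 - S.ε) * S.stiff u u)
      ≤ S.Re / 2 * I.E + S.ε / (2 * S.Wi) * ∑ K, ∑ L, I.m K L * freeEnergy (I.σ L) := by
  have hWi := S.Wi_pos
  have h1 := h.1 u
  have h2 : ∀ K, (S.vol K * freeEnergy (σ K) - ∑ L, I.m K L * freeEnergy (I.σ L))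
      + Δt * (∑ L, I.b K L * (freeEnergy (σ K) - freeEnergy (σ L)))
      - Δt * (2 * ddot (σ K) (S.G K u)) ≤ 0 := by
    intro K
    -- The stress equation of the cell, tested with `1 - (σ K)⁻¹`.
    have hK := congrArg (fun A => Δt * ddot A (1 - (σ K)⁻¹)) (h.2 K)
    simp only [rate] at hK
    have hz : ddot (0 : Tensor d) (1 - (σ K)⁻¹) = 0 := by simp [ddot]
    rw [hz, mul_zero, ddot_sub_left, ddot_smul_left] at hK
    generalize hX : S.vol K • σ K - ∑ L, I.m K L • I.σ L = X at hK
    simp only [ddot_sub_left, ddot_upper_convected _ _ (hσ K), S.trace_G, ddot_smul_left,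
      ddot_sum_left] at hK
    simp only [← ddot_sub_left] at hK
    have e1 : S.vol K * freeEnergy (σ K) - ∑ L, I.m K L * freeEnergy (I.σ L) ≤
        ddot X (1 - (σ K)⁻¹) := by
      rw [← hX, ← I.m_sum K, Finset.sum_smul, Finset.sum_mul, ← Finset.sum_sub_distrib,
        ← Finset.sum_sub_distrib, ddot_sum_left]
      refine Finset.sum_le_sum fun L _ => ?_
      rw [← smul_sub, ddot_smul_left, ← mul_sub]
      exact mul_le_mul_of_nonneg_left (freeEnergy_sub_le_ddot (hσ K) (I.σ_posDef L))
        (I.m_nonneg K L)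
    have e2 : ∑ L, I.b K L * (freeEnergy (σ K) - freeEnergy (σ L)) ≤
        ∑ L, I.b K L * ddot (σ K - σ L) (1 - (σ K)⁻¹) :=
      Finset.sum_le_sum fun L _ => mul_le_mul_of_nonneg_left
        (freeEnergy_sub_le_ddot (hσ K) (hσ L)) (I.b_nonneg K L)
    -- Relaxation dissipates: convexity between `σ K` and the minimizer `1`, whose free energy is
    -- zero.
    have e3 : 0 ≤ ddot (σ K - 1) (1 - (σ K)⁻¹) := by
      have := freeEnergy_sub_le_ddot (hσ K) (Matrix.PosDef.one (R := ℝ) (n := Fin d))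
      have h0 : freeEnergy (1 : Tensor d) = 0 := by simp [freeEnergy]
      have := freeEnergy_nonneg (hσ K)
      linarith
    have e3' : 0 ≤ Δt * (S.vol K / S.Wi * ddot (σ K - 1) (1 - (σ K)⁻¹)) :=
      mul_nonneg hΔt.le (mul_nonneg (div_nonneg (S.vol_pos K).le hWi.le) e3)
    have e2' := mul_le_mul_of_nonneg_left e2 hΔt.le
    have e4 : Δt * (1 / Δt * ddot X (1 - (σ K)⁻¹)) = ddot X (1 - (σ K)⁻¹) := by field_simp
    linarith
  have h3 := Finset.sum_le_sum fun K (_ : K ∈ Finset.univ) => h2 K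
  simp only [Finset.sum_sub_distrib, Finset.sum_add_distrib, ← Finset.mul_sum,
    Finset.sum_const_zero] at h3
  -- Summation by parts turns the differences of free energies into the imbalance of the upwind
  -- weights at each cell.
  have h4 : -(I.β * ∑ K, S.vol K * freeEnergy (σ K)) ≤
      ∑ K, ∑ L, I.b K L * (freeEnergy (σ K) - freeEnergy (σ L)) := by
    have e : ∑ K, ∑ L, I.b K L * (freeEnergy (σ K) - freeEnergy (σ L)) =
        ∑ K, (∑ L, I.b K L - ∑ L, I.b L K) * freeEnergy (σ K) := by
      simp only [mul_sub, sub_mul, Finset.sum_sub_distrib, Finset.sum_mul]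
      rw [Finset.sum_comm (f := fun K L => I.b K L * freeEnergy (σ L))]
    rw [e, Finset.mul_sum, ← Finset.sum_neg_distrib]
    refine Finset.sum_le_sum fun K _ => ?_
    have := mul_le_mul_of_nonneg_right (I.b_imbalance K) (freeEnergy_nonneg (hσ K))
    linarith
  have h5 := I.load_le u
  have h6 := I.conv_ge u
  have hc : 0 ≤ S.ε / (2 * S.Wi) := div_nonneg S.ε_pos.le (by positivity)
  have h7 : S.Re / 2 * S.mass u u - S.Re / 2 * I.E - Δt * (S.Re * (I.κ * S.mass u u))
      + Δt * ((1 - S.ε) * S.stiff u u)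
      + Δt * (S.ε / S.Wi * ∑ K, ddot (σ K) (S.G K u)) ≤ 0 := by
    have e1 : Δt * (S.Re / Δt * (S.mass u u - I.load u)) = S.Re * (S.mass u u - I.load u) := by
      field_simp
    have e2 := congrArg (Δt * ·) h1
    simp only [mul_add, mul_zero] at e2
    have e3 := mul_le_mul_of_nonneg_left h5 S.Re_nonneg
    have e4 := mul_le_mul_of_nonneg_left (mul_le_mul_of_nonneg_left h6 S.Re_nonneg) hΔt.le
    linarith
  have h8 := mul_le_mul_of_nonneg_left h3 hc
  have h9 := mul_le_mul_of_nonneg_left (mul_le_mul_of_nonneg_left h4 hΔt.le) hc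
  -- This is why the elastic energy carries the weight `ε / (2 * Wi)`: its work term now cancels
  -- that of the momentum equation.
  have e5 : S.ε / S.Wi * ∑ K, ddot (σ K) (S.G K u) =
      S.ε / (2 * S.Wi) * (2 * ∑ K, ddot (σ K) (S.G K u)) := by field_simp
  rw [e5] at h7
  linarith

end StepForms

end OldroydB

/-! ### Elimination of the velocity and bounds for the stress rate -/

namespace OldroydB

namespace StepForms

variable {ι : Type*} [Fintype ι] {H : Type*} [AddCommGroup H] [Module ℝ H] {d : ℕ}
  {S : StepForms ι H d}

/-- The mass term divided by `Δt` absorbs the part of the convection that may be negative. -/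
theorem coercive {I : StepInput S} {Δt : ℝ} (hΔt : 0 < Δt) (hκ : I.κ * Δt ≤ 1) (u : H) :
    (1 - S.ε) * S.stiff u u ≤
      S.Re / Δt * S.mass u u + S.Re * I.conv u u + (1 - S.ε) * S.stiff u u := by
  have h1 : S.Re / Δt * S.mass u u = S.Re * (S.mass u u / Δt) := by ring
  have h2 : I.κ * S.mass u u ≤ S.mass u u / Δt := by
    rw [le_div_iff₀ hΔt]
    nlinarith [S.mass_nonneg u]
  have h3 := I.conv_ge u
  have : 0 ≤ S.Re * (S.mass u u / Δt + I.conv u u) :=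
    mul_nonneg S.Re_nonneg (by linarith)
  rw [h1]
  linarith

/-- Lax–Milgram in finite dimension: coercivity makes the form injective into the dual, hence
surjective. -/
theorem exists_momentum [FiniteDimensional ℝ H] {I : StepInput S} {Δt : ℝ} (hΔt : 0 < Δt)
    (hκ : I.κ * Δt ≤ 1) (σ : ι → Tensor d) : ∃ u, S.Momentum I Δt u σ := by
  let B : H →ₗ[ℝ] Module.Dual ℝ H :=
    (S.Re / Δt) • S.mass + S.Re • I.conv + (1 - S.ε) • S.stiff
  have hB : ∀ u v, B u v = S.Re / Δt * S.mass u v + S.Re * I.conv u v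
      + (1 - S.ε) * S.stiff u v := fun u v => by simp [B]
  have hinj : Function.Injective B := by
    rw [injective_iff_map_eq_zero]
    intro u hu
    by_contra hne
    have h1 := coercive hΔt hκ u
    rw [← hB, hu] at h1
    have := mul_pos (sub_pos.2 S.ε_lt_one) (S.stiff_pos u hne)
    simp at h1
    linarith
  have hsurj := (LinearMap.injective_iff_surjective_of_finrank_eq_finrank
    (Subspace.dual_finrank_eq (K := ℝ) (V := H)).symm).1 hinj
  obtain ⟨u, hu⟩ := hsurj ((S.Re / Δt) • I.load
    - (S.ε / S.Wi) • ∑ K, (ddotL d (σ K)) ∘ₗ S.G K)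
  refine ⟨u, fun v => ?_⟩
  have := congrArg (fun f => f v) hu
  simp only [hB] at this
  simp [ddotL_apply] at this
  linarith

theorem abs_sum_ddot_G_le (σ : ι → Tensor d) {R : ℝ} (hσ : ∀ K, ‖σ K‖ ≤ R) (v : H) :
    |∑ K, ddot (σ K) (S.G K v)| ≤ Fintype.card ι * S.g * R * √(S.stiff v v) := by
  have : ∀ K, |ddot (σ K) (S.G K v)| ≤ R * (S.g * √(S.stiff v v)) := fun K =>
    (abs_ddot_le _ _).trans (mul_le_mul (hσ K) (S.norm_G_le K v) (norm_nonneg _)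
      ((norm_nonneg _).trans (hσ K)))
  calc |∑ K, ddot (σ K) (S.G K v)| ≤ ∑ K, |ddot (σ K) (S.G K v)| := Finset.abs_sum_le_sum_abs _ _
    _ ≤ ∑ _K : ι, R * (S.g * √(S.stiff v v)) := Finset.sum_le_sum fun K _ => this K
    _ = _ := by simp; ring

variable (S) in
/-- Stability constant of the velocity for the stress. -/
noncomputable def stressConst : ℝ := S.ε / S.Wi * (Fintype.card ι * S.g) / (1 - S.ε)

theorem stressConst_nonneg : 0 ≤ S.stressConst := by
  have := S.ε_pos; have := S.Wi_pos; have := S.g_nonneg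
  have := sub_pos.2 S.ε_lt_one
  unfold stressConst; positivity

/-- Subtract the two equations and test with the difference of the velocities: the load cancels and
coercivity leaves a constant independent of `Δt`. -/
theorem Momentum.sqrt_stiff_sub_le {I : StepInput S} {Δt : ℝ} (hΔt : 0 < Δt) (hκ : I.κ * Δt ≤ 1)
    {u u' : H} {σ σ' : ι → Tensor d} (h : S.Momentum I Δt u σ) (h' : S.Momentum I Δt u' σ') :
    √(S.stiff (u - u') (u - u')) ≤ S.stressConst * ‖σ - σ'‖ := by
  have h1 := h (u - u')
  have h2 := h' (u - u')
  have h3 := coercive hΔt hκ (u - u')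
  have h4 := abs_sum_ddot_G_le (S := S) (σ - σ') (fun K => norm_le_pi_norm (σ - σ') K) (u - u')
  set w := u - u' with hw
  have e : ∀ f : H →ₗ[ℝ] H →ₗ[ℝ] ℝ, f w w = f u w - f u' w := fun f => by
    rw [← LinearMap.sub_apply, ← map_sub]
  simp only [Pi.sub_apply, ddot_sub_left, Finset.sum_sub_distrib] at h4
  have hε := sub_pos.2 S.ε_lt_one
  have hc : 0 ≤ S.ε / S.Wi := div_nonneg S.ε_pos.le S.Wi_pos.le
  have h5 : (1 - S.ε) * S.stiff w w ≤
      S.ε / S.Wi * (Fintype.card ι * S.g * ‖σ - σ'‖ * √(S.stiff w w)) := by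
    have := mul_le_mul_of_nonneg_left (neg_le_of_abs_le h4) hc
    rw [mul_sub] at this
    have h6 : S.Re / Δt * S.mass w w + S.Re * I.conv w w + (1 - S.ε) * S.stiff w w =
      S.ε / S.Wi * ∑ K, ddot (σ' K) (S.G K w) - S.ε / S.Wi * ∑ K, ddot (σ K) (S.G K w) := by
      rw [e, e, e]; linarith
    linarith
  have hsq := Real.mul_self_sqrt (S.stiff_nonneg w)
  rcases eq_or_lt_of_le (Real.sqrt_nonneg (S.stiff w w)) with h0 | h0
  · rw [← h0]; exact mul_nonneg stressConst_nonneg (norm_nonneg _)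
  · rw [stressConst, div_mul_eq_mul_div, le_div_iff₀ hε]
    refine le_of_mul_le_mul_right ?_ h0
    calc √(S.stiff w w) * (1 - S.ε) * √(S.stiff w w)
        = (1 - S.ε) * (√(S.stiff w w) * √(S.stiff w w)) := by ring
      _ = (1 - S.ε) * S.stiff w w := by rw [hsq]
      _ ≤ _ := h5
      _ = _ := by ring

/-- The gradient norm of the velocity is `O(Δt^(-1/2))` for every stress of a ball. Positive
definiteness is not required, so the bound holds along the whole fixed-point iteration. -/
theorem Momentum.mul_stiff_le {I : StepInput S} {Δt : ℝ} (hΔt : 0 < Δt) (hΔt1 : Δt ≤ 1)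
    (hκ : 4 * I.κ * Δt ≤ 1) {u : H} {σ : ι → Tensor d} (h : S.Momentum I Δt u σ)
    {R e : ℝ} (hR : ∀ K, ‖σ K‖ ≤ R) (he : S.Re * I.E ≤ e) :
    Δt * S.stiff u u ≤ |e| / (1 - S.ε) + (S.stressConst * R) ^ 2 := by
  have hε := sub_pos.2 S.ε_lt_one
  have h1 := h u
  have h2 := abs_sum_ddot_G_le (S := S) σ hR u
  have hc : 0 ≤ S.ε / S.Wi := div_nonneg S.ε_pos.le S.Wi_pos.le
  have h3 := mul_le_mul_of_nonneg_left (neg_le_of_abs_le h2) hc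
  have h4 : S.ε / S.Wi * (Fintype.card ι * S.g * R * √(S.stiff u u)) =
      (1 - S.ε) * ((S.stressConst * R) * √(S.stiff u u)) := by
    unfold stressConst; field_simp
  have hm := S.mass_nonneg u
  have h5 : -(S.Re * I.E / (2 * Δt)) ≤
      S.Re / Δt * (S.mass u u - I.load u) + S.Re * I.conv u u := by
    have e1 : S.Re / Δt * (S.mass u u - I.load u) + S.Re * I.conv u u + S.Re * I.E / (2 * Δt) =
      S.Re / Δt * (S.mass u u - I.load u + Δt * I.conv u u + I.E / 2) := by field_simp
    -- The load takes at most half of the mass term, up to `E / 2`, and the convection at most a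
    -- quarter.
    have e2 : 0 ≤ S.mass u u - I.load u + Δt * I.conv u u + I.E / 2 := by
      have := I.load_le u
      have := mul_le_mul_of_nonneg_left (I.conv_ge u) hΔt.le
      have : 4 * I.κ * Δt * S.mass u u ≤ 1 * S.mass u u := mul_le_mul_of_nonneg_right hκ hm
      linarith
    have := mul_nonneg (div_nonneg S.Re_nonneg hΔt.le) e2
    linarith
  set s := √(S.stiff u u) with hs
  have hsq : s ^ 2 = S.stiff u u := Real.sq_sqrt (S.stiff_nonneg u)
  set P := S.stressConst * R with hP
  have h6 : (1 - S.ε) * S.stiff u u ≤ |e| / (2 * Δt) + (1 - S.ε) * (P * s) := by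
    have : S.Re * I.E / (2 * Δt) ≤ |e| / (2 * Δt) := by
      have := he.trans (le_abs_self e)
      gcongr
    rw [mul_neg, h4] at h3
    linarith
  have h7 : P * s ≤ P ^ 2 / 2 + S.stiff u u / 2 := by
    rw [← hsq]; nlinarith [sq_nonneg (P - s)]
  have h8 : (1 - S.ε) * (P * s) ≤ (1 - S.ε) * (P ^ 2 / 2 + S.stiff u u / 2) :=
    mul_le_mul_of_nonneg_left h7 hε.le
  have h9 : (1 - S.ε) * (Δt * S.stiff u u) ≤ |e| + (1 - S.ε) * (Δt * P ^ 2) := by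
    have : Δt * (|e| / (2 * Δt)) = |e| / 2 := by field_simp
    have := mul_le_mul_of_nonneg_left (h6.trans (add_le_add_right h8 _)) hΔt.le
    nlinarith
  have h10 : Δt * P ^ 2 ≤ P ^ 2 := by nlinarith [sq_nonneg P]
  have h11 : (1 - S.ε) * (|e| / (1 - S.ε) + P ^ 2) = |e| + (1 - S.ε) * P ^ 2 := by
    field_simp
  refine le_of_mul_le_mul_left ?_ hε
  rw [h11]
  nlinarith

/-- The transported stress of a cell is a convex combination of the previous stresses, because the
weights `m K L` are nonnegative with sum `vol K`. The same reason gives the lower bound for its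
quadratic form. -/
theorem norm_transported_le {I : StepInput S} {R : ℝ} (hR : ∀ L, ‖I.σ L‖ ≤ R) (K : ι) :
    ‖S.transported I K‖ ≤ R := by
  have hv := S.vol_pos K
  rw [transported, norm_smul, Real.norm_eq_abs, abs_of_pos (inv_pos.2 hv), inv_mul_le_iff₀ hv,
    ← I.m_sum K, Finset.sum_mul]
  refine (norm_sum_le _ _).trans (Finset.sum_le_sum fun L _ => ?_)
  rw [norm_smul, Real.norm_eq_abs, abs_of_nonneg (I.m_nonneg K L)]
  exact mul_le_mul_of_nonneg_left (hR L) (I.m_nonneg K L)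

theorem quadratic_transported_ge {I : StepInput S} {α : ℝ} (x : Fin d → ℝ)
    (hα : ∀ L, α * (x ⬝ᵥ x) ≤ x ⬝ᵥ (I.σ L *ᵥ x)) (K : ι) :
    α * (x ⬝ᵥ x) ≤ x ⬝ᵥ (S.transported I K *ᵥ x) := by
  have hv := S.vol_pos K
  rw [transported, Matrix.smul_mulVec, dotProduct_smul, smul_eq_mul, Matrix.sum_mulVec,
    dotProduct_sum, ← div_eq_inv_mul, le_div_iff₀ hv, mul_comm, ← I.m_sum K, Finset.sum_mul]
  refine Finset.sum_le_sum fun L _ => ?_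
  rw [Matrix.smul_mulVec, dotProduct_smul, smul_eq_mul]
  exact mul_le_mul_of_nonneg_left (hα L) (I.m_nonneg K L)

theorem isSymm_transported (I : StepInput S) (K : ι) : (S.transported I K).IsSymm := by
  rw [transported, Matrix.IsSymm, Matrix.transpose_smul, Matrix.transpose_sum]
  congr 1
  refine Finset.sum_congr rfl fun L _ => ?_
  have : (I.σ L)ᵀ = I.σ L := (I.σ_posDef L).1
  rw [Matrix.transpose_smul, this]

theorem isSymm_rate (I : StepInput S) (u : H) {σ : ι → Tensor d} (hσ : ∀ K, (σ K).IsSymm) (K : ι) :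
    (S.rate I u σ K).IsSymm := by
  have hσ' : ∀ K, (σ K)ᵀ = σ K := hσ
  rw [rate, Matrix.IsSymm]
  simp only [Matrix.transpose_sub, Matrix.transpose_add, Matrix.transpose_mul,
    Matrix.transpose_transpose, Matrix.transpose_sum, Matrix.transpose_smul, hσ',
    Matrix.transpose_one]
  rw [add_comm]

/-- What matters is that the bound is affine in `s` and `b`. Both will be of order `Δt^(-1/2)`, so
that `Δt` times the rate is of order `Δt^(1/2)`. -/
theorem norm_rate_le {I : StepInput S} {u : H} {σ : ι → Tensor d} {R s b V : ℝ}
    (hσ : ∀ K, ‖σ K‖ ≤ R) (hs : √(S.stiff u u) ≤ s) (hb : ∀ K L, I.b K L ≤ b)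
    (hV : ∀ K, S.vol K ≤ V) (K : ι) :
    ‖S.rate I u σ K‖ ≤ 2 * (S.g * s * R) + Fintype.card ι * b * (2 * R)
      + V / S.Wi * (R + ‖(1 : Tensor d)‖) := by
  have hR : 0 ≤ R := (norm_nonneg _).trans (hσ K)
  have hG : ‖S.G K u‖ ≤ S.g * s :=
    (S.norm_G_le K u).trans (mul_le_mul_of_nonneg_left hs S.g_nonneg)
  have hgs : 0 ≤ S.g * s := (norm_nonneg _).trans hG
  have h1 : ‖S.G K u * σ K‖ ≤ S.g * s * R :=
    (Matrix.frobenius_norm_mul _ _).trans (mul_le_mul hG (hσ K) (norm_nonneg _) hgs)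
  have h2 : ‖σ K * (S.G K u)ᵀ‖ ≤ S.g * s * R := by
    refine (Matrix.frobenius_norm_mul _ _).trans ?_
    rw [Matrix.frobenius_norm_transpose, mul_comm]
    exact mul_le_mul hG (hσ K) (norm_nonneg _) hgs
  have h3 : ‖∑ L, I.b K L • (σ K - σ L)‖ ≤ Fintype.card ι * b * (2 * R) := by
    calc _ ≤ ∑ L, ‖I.b K L • (σ K - σ L)‖ := norm_sum_le _ _
      _ ≤ ∑ _L : ι, b * (2 * R) := by
        refine Finset.sum_le_sum fun L _ => ?_
        rw [norm_smul, Real.norm_eq_abs, abs_of_nonneg (I.b_nonneg K L)]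
        refine mul_le_mul (hb K L) ?_ (norm_nonneg _) ((I.b_nonneg K L).trans (hb K L))
        exact (norm_sub_le _ _).trans (by linarith [hσ K, hσ L])
      _ = _ := by simp; ring
  have h4 : ‖(S.vol K / S.Wi) • (σ K - 1)‖ ≤ V / S.Wi * (R + ‖(1 : Tensor d)‖) := by
    rw [norm_smul, Real.norm_eq_abs, abs_of_nonneg (div_nonneg (S.vol_pos K).le S.Wi_pos.le)]
    refine mul_le_mul ?_ ((norm_sub_le _ _).trans (by linarith [hσ K])) (norm_nonneg _)
      (div_nonneg ((S.vol_pos K).le.trans (hV K)) S.Wi_pos.le)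
    exact div_le_div_of_nonneg_right (hV K) S.Wi_pos.le
  rw [rate]
  calc _ ≤ ‖S.G K u * σ K + σ K * (S.G K u)ᵀ - ∑ L, I.b K L • (σ K - σ L)‖
        + ‖(S.vol K / S.Wi) • (σ K - 1)‖ := norm_sub_le _ _
    _ ≤ ‖S.G K u * σ K + σ K * (S.G K u)ᵀ‖ + ‖∑ L, I.b K L • (σ K - σ L)‖
        + ‖(S.vol K / S.Wi) • (σ K - 1)‖ := by gcongr; exact norm_sub_le _ _
    _ ≤ ‖S.G K u * σ K‖ + ‖σ K * (S.G K u)ᵀ‖ + ‖∑ L, I.b K L • (σ K - σ L)‖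
        + ‖(S.vol K / S.Wi) • (σ K - 1)‖ := by gcongr; exact norm_add_le _ _
    _ ≤ _ := by linarith

/-- Each product is split so that the velocity difference meets `σ`, bounded by `R`, while the
stress difference meets only `u'`. -/
theorem norm_rate_sub_le {I : StepInput S} {u u' : H} {σ σ' : ι → Tensor d} {R s b V Q : ℝ}
    (hσ : ∀ K, ‖σ K‖ ≤ R) (hs : √(S.stiff u' u') ≤ s) (hb : ∀ K L, I.b K L ≤ b)
    (hV : ∀ K, S.vol K ≤ V) (hQ : √(S.stiff (u - u') (u - u')) ≤ Q * ‖σ - σ'‖) (K : ι) :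
    ‖S.rate I u σ K - S.rate I u' σ' K‖ ≤
      (2 * (S.g * (Q * R + s)) + Fintype.card ι * b * 2 + V / S.Wi) * ‖σ - σ'‖ := by
  have hR : 0 ≤ R := (norm_nonneg _).trans (hσ K)
  set ρ := ‖σ - σ'‖ with hρ
  have hρ0 : 0 ≤ ρ := norm_nonneg _
  have hd : ∀ K, ‖σ K - σ' K‖ ≤ ρ := fun K => norm_le_pi_norm (σ - σ') K
  have hG : ‖S.G K (u - u')‖ ≤ S.g * (Q * ρ) :=
    (S.norm_G_le K _).trans (mul_le_mul_of_nonneg_left hQ S.g_nonneg)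
  have hG' : ‖S.G K u'‖ ≤ S.g * s :=
    (S.norm_G_le K u').trans (mul_le_mul_of_nonneg_left hs S.g_nonneg)
  have e : S.rate I u σ K - S.rate I u' σ' K =
      (S.G K (u - u') * σ K + S.G K u' * (σ K - σ' K))
      + (σ K * (S.G K (u - u'))ᵀ + (σ K - σ' K) * (S.G K u')ᵀ)
      - ∑ L, I.b K L • ((σ K - σ' K) - (σ L - σ' L)) - (S.vol K / S.Wi) • (σ K - σ' K) := by
    have h1 : ∑ L, I.b K L • ((σ K - σ' K) - (σ L - σ' L)) =
        ∑ L, I.b K L • (σ K - σ L) - ∑ L, I.b K L • (σ' K - σ' L) := by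
      rw [← Finset.sum_sub_distrib]
      refine Finset.sum_congr rfl fun L _ => ?_
      rw [← smul_sub]; congr 1; abel
    rw [h1, rate, rate, map_sub, Matrix.transpose_sub]
    simp only [sub_mul, mul_sub, smul_sub]
    abel
  have h1 : ‖S.G K (u - u') * σ K + S.G K u' * (σ K - σ' K)‖ ≤ S.g * (Q * R + s) * ρ := by
    refine (norm_add_le _ _).trans ?_
    have a1 := (Matrix.frobenius_norm_mul (S.G K (u - u')) (σ K)).trans
      (mul_le_mul hG (hσ K) (norm_nonneg _) ((norm_nonneg _).trans hG))
    have a2 := (Matrix.frobenius_norm_mul (S.G K u') (σ K - σ' K)).trans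
      (mul_le_mul hG' (hd K) (norm_nonneg _) ((norm_nonneg _).trans hG'))
    linarith
  have h2 : ‖σ K * (S.G K (u - u'))ᵀ + (σ K - σ' K) * (S.G K u')ᵀ‖ ≤ S.g * (Q * R + s) * ρ := by
    refine (norm_add_le _ _).trans ?_
    have a1 := (Matrix.frobenius_norm_mul (σ K) (S.G K (u - u'))ᵀ)
    have a2 := (Matrix.frobenius_norm_mul (σ K - σ' K) (S.G K u')ᵀ)
    rw [Matrix.frobenius_norm_transpose, mul_comm] at a1 a2
    have a1' := a1.trans
      (mul_le_mul hG (hσ K) (norm_nonneg _) ((norm_nonneg _).trans hG))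
    have a2' := a2.trans
      (mul_le_mul hG' (hd K) (norm_nonneg _) ((norm_nonneg _).trans hG'))
    linarith
  have h3 : ‖∑ L, I.b K L • ((σ K - σ' K) - (σ L - σ' L))‖ ≤ Fintype.card ι * b * 2 * ρ := by
    calc _ ≤ ∑ L, ‖I.b K L • ((σ K - σ' K) - (σ L - σ' L))‖ := norm_sum_le _ _
      _ ≤ ∑ _L : ι, b * (2 * ρ) := by
        refine Finset.sum_le_sum fun L _ => ?_
        rw [norm_smul, Real.norm_eq_abs, abs_of_nonneg (I.b_nonneg K L)]
        refine mul_le_mul (hb K L) ?_ (norm_nonneg _) ((I.b_nonneg K L).trans (hb K L))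
        exact (norm_sub_le _ _).trans (by linarith [hd K, hd L])
      _ = _ := by simp; ring
  have h4 : ‖(S.vol K / S.Wi) • (σ K - σ' K)‖ ≤ V / S.Wi * ρ := by
    rw [norm_smul, Real.norm_eq_abs, abs_of_nonneg (div_nonneg (S.vol_pos K).le S.Wi_pos.le)]
    refine mul_le_mul ?_ (hd K) (norm_nonneg _)
      (div_nonneg ((S.vol_pos K).le.trans (hV K)) S.Wi_pos.le)
    exact div_le_div_of_nonneg_right (hV K) S.Wi_pos.le
  rw [e]
  refine (norm_sub_le _ _).trans ((add_le_add_left (norm_sub_le _ _) _).trans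
    ((add_le_add_left (add_le_add_left (norm_add_le _ _) _) _).trans ?_))
  linarith

end StepForms

end OldroydB

/-! ### Unique solvability of one abstract step -/

namespace OldroydB

namespace StepForms

variable {ι : Type*} [Fintype ι] {H : Type*} [AddCommGroup H] [Module ℝ H] {d : ℕ}

/-- Uniform a priori bound on the free energy density of positive definite solutions. -/
theorem IsSol.freeEnergy_le {S : StepForms ι H d} {I : StepInput S} {Δt : ℝ} (hΔt : 0 < Δt)
    {u : H} {σ : ι → Tensor d} (h : S.IsSol I Δt u σ) (hσ : ∀ K, (σ K).PosDef) {e M v V : ℝ}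
    (hv : 0 < v) (hvol : ∀ K, v ≤ S.vol K) (hV : ∑ K, S.vol K ≤ V)
    (hκ : 4 * I.κ * Δt ≤ 1) (hβ : 2 * I.β * Δt ≤ 1) (he : S.Re * I.E ≤ e)
    (hM : ∀ L, freeEnergy (I.σ L) ≤ M) (hM0 : 0 ≤ M) (K : ι) :
    freeEnergy (σ K) ≤ (2 * S.Wi / S.ε * |e| + 2 * (V * M)) / v := by
  have hE := h.energy_le hΔt hσ
  have hWi := S.Wi_pos
  have hε := S.ε_pos
  have hc : 0 < S.ε / (2 * S.Wi) := div_pos hε (by positivity)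
  have h1 : v * freeEnergy (σ K) ≤ ∑ K, S.vol K * freeEnergy (σ K) :=
    (mul_le_mul_of_nonneg_right (hvol K) (freeEnergy_nonneg (hσ K))).trans
      (Finset.single_le_sum (f := fun K => S.vol K * freeEnergy (σ K))
        (fun K _ => mul_nonneg (S.vol_pos K).le (freeEnergy_nonneg (hσ K))) (Finset.mem_univ K))
  have h2 : ∑ K, ∑ L, I.m K L * freeEnergy (I.σ L) ≤ V * M := by
    refine le_trans ?_ (mul_le_mul_of_nonneg_right hV hM0)
    rw [Finset.sum_mul]
    refine Finset.sum_le_sum fun K _ => ?_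
    rw [← I.m_sum K, Finset.sum_mul]
    exact Finset.sum_le_sum fun L _ => mul_le_mul_of_nonneg_left (hM L) (I.m_nonneg K L)
  set X := ∑ K, S.vol K * freeEnergy (σ K) with hX
  have hX0 : 0 ≤ X := Finset.sum_nonneg fun K _ =>
    mul_nonneg (S.vol_pos K).le (freeEnergy_nonneg (hσ K))
  -- The condition on `β * Δt` leaves at least half of the elastic energy on the left-hand side.
  have h3 : 1 / 2 * (S.ε / (2 * S.Wi) * X) ≤ |e| / 2 + S.ε / (2 * S.Wi) * (V * M) := by
    have a1 : 0 ≤ (1 - 2 * I.κ * Δt) * (S.Re / 2 * S.mass u u) :=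
      mul_nonneg (by linarith) (mul_nonneg (div_nonneg S.Re_nonneg zero_le_two) (S.mass_nonneg u))
    have a2 : 0 ≤ Δt * ((1 - S.ε) * S.stiff u u) :=
      mul_nonneg hΔt.le (mul_nonneg (sub_pos.2 S.ε_lt_one).le (S.stiff_nonneg u))
    have a3 : 1 / 2 * (S.ε / (2 * S.Wi) * X) ≤ (1 - I.β * Δt) * (S.ε / (2 * S.Wi) * X) :=
      mul_le_mul_of_nonneg_right (by linarith) (mul_nonneg hc.le hX0)
    have a4 := mul_le_mul_of_nonneg_left h2 hc.le
    have a5 := he.trans (le_abs_self e)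
    linarith
  rw [le_div_iff₀ hv, mul_comm]
  refine h1.trans ?_
  refine le_of_mul_le_mul_left ?_ (mul_pos (one_half_pos (α := ℝ)) hc)
  calc 1 / 2 * (S.ε / (2 * S.Wi)) * X = 1 / 2 * (S.ε / (2 * S.Wi) * X) := by ring
    _ ≤ _ := h3
    _ = _ := by field_simp

/-- The implicit stress equation in a ball, given the bounds that make it a contraction. -/
theorem exists_unique_isSol_of_contracting [FiniteDimensional ℝ H] {S : StepForms ι H d}
    {I : StepInput S} {Δt R δ : ℝ} (hΔt : 0 < Δt) (hκ1 : I.κ * Δt ≤ 1) (hR0 : 0 ≤ R)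
    (hδ : δ ≤ 1) (htr : ∀ K, ‖S.transported I K‖ ≤ R - 1)
    (hrate : ∀ {u σ}, S.Momentum I Δt u σ → (∀ K, ‖σ K‖ ≤ R) → ∀ K,
      ‖(S.vol K)⁻¹ • (Δt • S.rate I u σ K)‖ ≤ δ)
    (hcontr : ∀ {u σ u' σ'}, S.Momentum I Δt u σ → S.Momentum I Δt u' σ' →
      (∀ K, ‖σ K‖ ≤ R) → (∀ K, ‖σ' K‖ ≤ R) → ∀ K,
      ‖(S.vol K)⁻¹ • (Δt • S.rate I u σ K) - (S.vol K)⁻¹ • (Δt • S.rate I u' σ' K)‖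
        ≤ 1 / 2 * ‖σ - σ'‖) :
    ∃ u σ, (∀ K, (σ K).IsSymm) ∧ S.IsSol I Δt u σ ∧
      (∀ K, ‖σ K - S.transported I K‖ ≤ δ) ∧
      ∀ u' σ', (∀ K, ‖σ' K‖ ≤ R) → S.IsSol I Δt u' σ' → u' = u ∧ σ' = σ := by
  have huniq : ∀ {u σ u' σ'}, S.IsSol I Δt u σ → S.IsSol I Δt u' σ' →
      (∀ K, ‖σ K‖ ≤ R) → (∀ K, ‖σ' K‖ ≤ R) → u = u' ∧ σ = σ' := fun {u σ u' σ'} hu hu' hσ hσ' => by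
    have h1 : ‖σ - σ'‖ ≤ 1 / 2 * ‖σ - σ'‖ := by
      refine (pi_norm_le_iff_of_nonneg (by positivity)).2 fun K => ?_
      have e1 := (IsSol.eq_transported_add hΔt K).1 (hu.2 K)
      have e2 := (IsSol.eq_transported_add hΔt K).1 (hu'.2 K)
      have e3 : (σ - σ') K = (S.vol K)⁻¹ • (Δt • S.rate I u σ K)
          - (S.vol K)⁻¹ • (Δt • S.rate I u' σ' K) := by
        rw [Pi.sub_apply]
        conv_lhs => rw [e1, e2]
        abel
      rw [e3]
      exact hcontr hu.1 hu'.1 hσ hσ' K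
    have h2 : ‖σ - σ'‖ = 0 := by linarith [norm_nonneg (σ - σ')]
    have h3 := hu.1.sqrt_stiff_sub_le hΔt hκ1 hu'.1
    rw [h2, mul_zero] at h3
    refine ⟨?_, sub_eq_zero.1 (norm_eq_zero.1 h2)⟩
    by_contra hne
    exact absurd h3 (not_le.2 (Real.sqrt_pos.2 (S.stiff_pos _ (sub_ne_zero.2 hne))))
  -- The velocity is eliminated; the fixed-point problem concerns the stress alone, in the closed
  -- ball of symmetric tensors.
  choose U hU using fun σ : ι → Tensor d => exists_momentum (S := S) (I := I) hΔt hκ1 σ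
  let T : (ι → Tensor d) → ι → Tensor d := fun σ K =>
    S.transported I K + (S.vol K)⁻¹ • (Δt • S.rate I (U σ) σ K)
  let s : Set (ι → Tensor d) := {σ | (∀ K, (σ K).IsSymm) ∧ ∀ K, ‖σ K‖ ≤ R}
  have hs : IsClosed s := by
    have h1 : IsClosed {σ : ι → Tensor d | ∀ K, (σ K).IsSymm} := by
      simp only [Set.ofPred_forall, Matrix.IsSymm]
      refine isClosed_iInter fun K => isClosed_eq ?_ ?_
      · exact Continuous.matrix_transpose (continuous_apply K)
      · exact continuous_apply K
    have h2 : IsClosed {σ : ι → Tensor d | ∀ K, ‖σ K‖ ≤ R} := by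
      simp only [Set.ofPred_forall]
      exact isClosed_iInter fun K => isClosed_le (continuous_apply K).norm continuous_const
    exact h1.inter h2
  have hcomplete : CompleteSpace (ι → Tensor d) := FiniteDimensional.complete ℝ _
  have hmaps : Set.MapsTo T s s := fun σ hσ => by
    refine ⟨fun K => ?_, fun K => ?_⟩
    · exact (isSymm_transported I K).add (((isSymm_rate I _ hσ.1 K).smul _).smul _)
    -- The transported part has norm at most `R - 1` and the increment at most `δ ≤ 1`.
    · have a1 := norm_add_le (S.transported I K) ((S.vol K)⁻¹ • (Δt • S.rate I (U σ) σ K))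
      have a2 := hrate (hU σ) hσ.2 K
      have a3 := htr K
      show ‖S.transported I K + _‖ ≤ R
      linarith
  have hlip : ContractingWith (1 / 2 : NNReal) (hmaps.restrict T s s) := by
    refine ⟨by norm_num, LipschitzWith.of_dist_le_mul fun σ σ' => ?_⟩
    rw [Subtype.dist_eq, Subtype.dist_eq, dist_eq_norm, dist_eq_norm]
    refine (pi_norm_le_iff_of_nonneg (by positivity)).2 fun K => ?_
    have := hcontr (hU σ) (hU σ') σ.2.2 σ'.2.2 K
    have e : (↑(hmaps.restrict T s s σ) - ↑(hmaps.restrict T s s σ') : ι → Tensor d) K =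
        (S.vol K)⁻¹ • (Δt • S.rate I (U σ) σ K) - (S.vol K)⁻¹ • (Δt • S.rate I (U σ') σ' K) := by
      simp only [Set.MapsTo.val_restrict_apply, Pi.sub_apply, T]
      abel
    rw [e]
    simpa using this
  have h0s : (0 : ι → Tensor d) ∈ s :=
    ⟨fun K => Matrix.isSymm_zero, fun K => by simpa using hR0⟩
  obtain ⟨σ, hσs, hfix, -⟩ := hlip.exists_fixedPoint' hs.isComplete hmaps h0s (edist_ne_top _ _)
  have hfixK : ∀ K, σ K = S.transported I K + (S.vol K)⁻¹ • (Δt • S.rate I (U σ) σ K) := fun K =>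
    (congrFun hfix K).symm
  have hsol : S.IsSol I Δt (U σ) σ :=
    ⟨hU σ, fun K => (IsSol.eq_transported_add hΔt K).2 (hfixK K)⟩
  refine ⟨U σ, σ, hσs.1, hsol, fun K => ?_, fun u' σ' hσ' hu' => huniq hu' hsol hσ' hσs.2⟩
  conv_lhs => rw [hfixK K]
  rw [add_sub_cancel_left]
  exact hrate (hU σ) hσs.2 K

set_option maxHeartbeats 800000 in
/-- One step is uniquely solvable for small time steps, uniformly in the data as long as the
energy, the free energy densities and the weights are bounded. -/
theorem exists_unique_isSol [FiniteDimensional ℝ H] (S : StepForms ι H d) (e M B : ℝ) :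
    ∃ c : ℝ, 0 < c ∧ ∀ (I : StepInput S) (Δt : ℝ), 0 < Δt → Δt < c →
      S.Re * I.E ≤ e → (∀ L, freeEnergy (I.σ L) ≤ M) → (∀ K L, Δt * I.b K L ^ 2 ≤ B) →
      4 * I.κ * Δt ≤ 1 → 2 * I.β * Δt ≤ 1 →
      ∃ u σ, (∀ K, (σ K).PosDef) ∧ S.IsSol I Δt u σ ∧
        ∀ u' σ', (∀ K, (σ' K).PosDef) → S.IsSol I Δt u' σ' → u' = u ∧ σ' = σ := by
  obtain ⟨v, hv, hvol⟩ := S.exists_vol_lower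
  set V := ∑ K, S.vol K with hV
  have hV0 : 0 ≤ V := Finset.sum_nonneg fun K _ => (S.vol_pos K).le
  have hVK : ∀ K, S.vol K ≤ V := fun K =>
    Finset.single_le_sum (f := S.vol) (fun K _ => (S.vol_pos K).le) (Finset.mem_univ K)
  have hWi := S.Wi_pos
  have hε := S.ε_pos
  have hg := S.g_nonneg
  -- `M'` bounds the free energy densities of the previous stresses and, by `IsSol.freeEnergy_le`,
  -- of every positive definite solution. Tensors of such energy have norm at most `R - 1`; the
  -- spare `1` leaves room for the increment.
  set M' := |M| + (2 * S.Wi / S.ε * |e| + 2 * (V * |M|)) / v with hM'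
  have hM'0 : |M| ≤ M' := le_add_of_nonneg_right (by positivity)
  set R := d * (2 * M' + 2 * d) + 1 with hR
  have hM'nn : 0 ≤ M' := (abs_nonneg M).trans hM'0
  have hR0 : 0 ≤ R := by positivity
  have hnorm : ∀ A : Tensor d, A.PosDef → freeEnergy A ≤ M' → ‖A‖ ≤ R - 1 := by
    intro A hA hf
    have := mul_le_mul_of_nonneg_left (trace_le_of_freeEnergy_le hA hf) (Nat.cast_nonneg d)
    have := norm_le_mul_trace hA
    linarith
  set α := Real.exp (-(|M| + 1)) with hα
  have hα0 : 0 < α := Real.exp_pos _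
  -- The bound of `Momentum.mul_stiff_le` for `Δt` times the stiffness.
  set A := |e| / (1 - S.ε) + (S.stressConst * R) ^ 2 with hA
  have hA0 : 0 ≤ A := by have := sub_pos.2 S.ε_lt_one; positivity
  set Q := S.stressConst with hQ
  have hQ0 : 0 ≤ Q := stressConst_nonneg
  set N := (Fintype.card ι : ℝ) with hN
  -- With `η = √Δt`, gradients and upwind weights are `O(1 / η)`. Then `Δt` times the rate is at
  -- most `η * C1`, and `Δt` times its Lipschitz constant at most `η * C2`.
  set C1 := 2 * (S.g * √A * R) + N * √|B| * (2 * R) + V / S.Wi * (R + ‖(1 : Tensor d)‖) with hC1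
  set C2 := 2 * (S.g * (Q * R + √A)) + N * √|B| * 2 + V / S.Wi with hC2
  have hC10 : 0 ≤ C1 := by positivity
  have hC20 : 0 ≤ C2 := by positivity
  -- The first bound keeps the iterates in the ball. The second keeps the perturbation of the
  -- quadratic form below half of the spectral lower bound `α`, given the factor `d` of
  -- `abs_quadratic_le`.
  set δ := min 1 (α / (2 * (d + 1))) with hδ
  have hδ0 : 0 < δ := by positivity
  set η₀ := min 1 (min (v * δ / (C1 + 1)) (v / (2 * (C2 + 1)))) with hη₀
  have hη₀0 : 0 < η₀ := by positivity
  -- A square, because the smallness conditions bear on `√Δt`.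
  refine ⟨η₀ ^ 2, by positivity, ?_⟩
  intro I Δt hΔt hΔtc he hM hB hκ hβ
  set η := √Δt with hη
  have hη0 : 0 < η := Real.sqrt_pos.2 hΔt
  have hηsq : η * η = Δt := Real.mul_self_sqrt hΔt.le
  have hηlt : η ≤ η₀ := Real.sqrt_le_iff.2 ⟨hη₀0.le, hΔtc.le⟩
  have hη1 : η ≤ 1 := hηlt.trans (min_le_left _ _)
  have hηη : η * η ≤ η := mul_le_of_le_one_left hη0.le hη1
  have hΔt1 : Δt ≤ 1 := by rw [← hηsq]; exact hηη.trans hη1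
  have hηC1 : η * C1 ≤ v * δ := by
    have : η ≤ v * δ / (C1 + 1) := hηlt.trans ((min_le_right _ _).trans (min_le_left _ _))
    rw [le_div_iff₀ (by positivity)] at this
    linarith
  have hηC2 : η * C2 ≤ v / 2 := by
    have : η ≤ v / (2 * (C2 + 1)) := hηlt.trans ((min_le_right _ _).trans (min_le_right _ _))
    rw [le_div_iff₀ (by positivity)] at this
    linarith
  have hκ1 : I.κ * Δt ≤ 1 := by
    have := mul_nonneg I.κ_nonneg hΔt.le; linarith
  have hM'' : ∀ L, freeEnergy (I.σ L) ≤ |M| := fun L => (hM L).trans (le_abs_self M)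
  have hσI : ∀ L, ‖I.σ L‖ ≤ R - 1 := fun L =>
    hnorm _ (I.σ_posDef L) ((hM'' L).trans hM'0)
  have htr := norm_transported_le hσI
  have hb : ∀ K L, I.b K L ≤ √|B| / η := fun K L => by
    rw [le_div_iff₀ hη0]
    refine Real.le_sqrt_of_sq_le ?_
    calc (I.b K L * η) ^ 2 = (η * η) * I.b K L ^ 2 := by ring
      _ = Δt * I.b K L ^ 2 := by rw [hηsq]
      _ ≤ |B| := (hB K L).trans (le_abs_self B)
  have hstiff : ∀ {u σ}, S.Momentum I Δt u σ → (∀ K, ‖σ K‖ ≤ R) →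
      √(S.stiff u u) ≤ √A / η := fun {u σ} hu hσ => by
    rw [le_div_iff₀ hη0]
    refine Real.le_sqrt_of_sq_le ?_
    rw [mul_pow, Real.sq_sqrt (S.stiff_nonneg u)]
    calc S.stiff u u * η ^ 2 = (η * η) * S.stiff u u := by ring
      _ = Δt * S.stiff u u := by rw [hηsq]
      _ ≤ A := hu.mul_stiff_le hΔt hΔt1 hκ hσ he
  have hscale : ∀ x : ℝ, Δt * (x / η) = η * x := fun x => by
    rw [← hηsq]; field_simp
  have hrate : ∀ {u σ}, S.Momentum I Δt u σ → (∀ K, ‖σ K‖ ≤ R) → ∀ K,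
      ‖(S.vol K)⁻¹ • (Δt • S.rate I u σ K)‖ ≤ δ := fun {u σ} hu hσ K => by
    have h1 := norm_rate_le hσ (hstiff hu hσ) hb hVK K
    have h2 : Δt * ‖S.rate I u σ K‖ ≤ η * C1 := by
      have a1 := mul_le_mul_of_nonneg_left h1 hΔt.le
      have a2 : Δt * (2 * (S.g * (√A / η) * R) + N * (√|B| / η) * (2 * R)
          + V / S.Wi * (R + ‖(1 : Tensor d)‖)) =
        2 * S.g * R * (Δt * (√A / η)) + N * (2 * R) * (Δt * (√|B| / η))
          + (η * η) * (V / S.Wi * (R + ‖(1 : Tensor d)‖)) := by rw [hηsq]; ring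
      have a3 : (η * η) * (V / S.Wi * (R + ‖(1 : Tensor d)‖)) ≤
          η * (V / S.Wi * (R + ‖(1 : Tensor d)‖)) :=
        mul_le_mul_of_nonneg_right hηη (by positivity)
      rw [a2, hscale, hscale] at a1
      refine a1.trans ?_
      rw [hC1]
      linarith
    rw [norm_smul, norm_smul, Real.norm_eq_abs, Real.norm_eq_abs, abs_of_pos hΔt,
      abs_of_pos (inv_pos.2 (S.vol_pos K)), inv_mul_le_iff₀ (S.vol_pos K)]
    exact (h2.trans hηC1).trans (mul_le_mul_of_nonneg_right (hvol K) hδ0.le)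
  have hcontr : ∀ {u σ u' σ'}, S.Momentum I Δt u σ → S.Momentum I Δt u' σ' →
      (∀ K, ‖σ K‖ ≤ R) → (∀ K, ‖σ' K‖ ≤ R) → ∀ K,
      ‖(S.vol K)⁻¹ • (Δt • S.rate I u σ K) - (S.vol K)⁻¹ • (Δt • S.rate I u' σ' K)‖
        ≤ 1 / 2 * ‖σ - σ'‖ := fun {u σ u' σ'} hu hu' hσ hσ' K => by
    have h1 := norm_rate_sub_le hσ (hstiff hu' hσ') hb hVK
      (hu.sqrt_stiff_sub_le hΔt hκ1 hu') K
    have h2 : Δt * ‖S.rate I u σ K - S.rate I u' σ' K‖ ≤ η * C2 * ‖σ - σ'‖ := by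
      have a1 := mul_le_mul_of_nonneg_left h1 hΔt.le
      have a2 : Δt * ((2 * (S.g * (Q * R + √A / η)) + N * (√|B| / η) * 2 + V / S.Wi) * ‖σ - σ'‖) =
        ((η * η) * (2 * S.g * Q * R + V / S.Wi) + 2 * S.g * (Δt * (√A / η))
          + N * 2 * (Δt * (√|B| / η))) * ‖σ - σ'‖ := by rw [hηsq]; ring
      rw [a2, hscale, hscale] at a1
      refine a1.trans (mul_le_mul_of_nonneg_right ?_ (norm_nonneg _))
      have a3 : (η * η) * (2 * S.g * Q * R + V / S.Wi) ≤ η * (2 * S.g * Q * R + V / S.Wi) :=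
        mul_le_mul_of_nonneg_right hηη (by positivity)
      rw [hC2]
      linarith
    rw [← smul_sub, ← smul_sub, norm_smul, norm_smul, Real.norm_eq_abs, Real.norm_eq_abs,
      abs_of_pos hΔt, abs_of_pos (inv_pos.2 (S.vol_pos K)), inv_mul_le_iff₀ (S.vol_pos K)]
    have h3 := mul_le_mul_of_nonneg_right (hηC2.trans
      (div_le_div_of_nonneg_right (hvol K) zero_le_two)) (norm_nonneg (σ - σ'))
    linarith
  obtain ⟨u, σ, hsymm, hsol, hclose, huniq⟩ := exists_unique_isSol_of_contracting hΔt hκ1 hR0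
    (min_le_left _ _) htr hrate hcontr
  refine ⟨u, σ, fun K => ?_, hsol, fun u' σ' hσ' hu' => huniq u' σ' (fun K => ?_) hu'⟩
  · refine Matrix.PosDef.of_dotProduct_mulVec_pos (hsymm K) fun x hx => ?_
    rw [star_trivial]
    have hxx : 0 < x ⬝ᵥ x := by
      refine lt_of_le_of_ne (Finset.sum_nonneg fun i _ => mul_self_nonneg _) ?_
      intro h
      exact hx (dotProduct_self_eq_zero.1 h.symm)
    have a1 := quadratic_transported_ge (S := S) (I := I) (α := α) x
      (fun L => quadratic_ge_of_freeEnergy_le (I.σ_posDef L) (hM'' L) x) K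
    have a2 := abs_quadratic_le (σ K - S.transported I K) x
    have a4 : d * ‖σ K - S.transported I K‖ ≤ α / 2 := by
      have h1 : ‖σ K - S.transported I K‖ ≤ α / (2 * (d + 1)) :=
        (hclose K).trans (min_le_right _ _)
      have h2 := mul_le_mul_of_nonneg_left h1 (Nat.cast_nonneg (α := ℝ) d)
      refine h2.trans ?_
      rw [mul_div_assoc', div_le_div_iff₀ (by positivity) two_pos]
      have hd : (0 : ℝ) ≤ d := Nat.cast_nonneg d
      have := mul_nonneg hd hα0.le
      linarith
    have a5 := mul_le_mul_of_nonneg_right a4 hxx.le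
    have a6 := neg_le_of_abs_le (a2.trans a5)
    rw [Matrix.sub_mulVec, dotProduct_sub] at a6
    have a7 := mul_pos hα0 hxx
    linarith
  -- A positive definite competitor lies in the ball by the energy estimate, so uniqueness in the
  -- ball applies to it.
  · have hf := hu'.freeEnergy_le hΔt hσ' hv hvol le_rfl hκ hβ he hM'' (abs_nonneg M) K
    have := hnorm _ (hσ' K) (hf.trans (le_add_of_nonneg_left (abs_nonneg M)))
    linarith

end StepForms

end OldroydB

/-! ### Polynomials and gluing of Lipschitz functions -/

namespace OldroydB

section Polynomials

variable {d : ℕ}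

/-- A polynomial as a function on Euclidean space. -/
noncomputable def evalPt (P : MvPolynomial (Fin d) ℝ) (x : Pt d) : ℝ :=
  MvPolynomial.eval (fun j => x j) P

theorem contDiff_evalPt (P : MvPolynomial (Fin d) ℝ) : ContDiff ℝ 1 (evalPt P) := by
  induction P using MvPolynomial.induction_on with
  | C a =>
    have : evalPt (MvPolynomial.C a) = fun _ : Pt d => a := by ext x; simp [evalPt]
    rw [this]; exact contDiff_const
  | add p q hp hq =>
    have : evalPt (p + q) = fun x => evalPt p x + evalPt q x := by ext x; simp [evalPt]
    rw [this]; exact hp.add hq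
  | mul_X p i hp =>
    have : evalPt (p * MvPolynomial.X i) = fun x => evalPt p x * x i := by ext x; simp [evalPt]
    rw [this]
    exact hp.mul (EuclideanSpace.proj (𝕜 := ℝ) i).contDiff

theorem fderiv_evalPt (P : MvPolynomial (Fin d) ℝ) (x : Pt d) (j : Fin d) :
    fderiv ℝ (evalPt P) x (EuclideanSpace.single j 1) = evalPt (MvPolynomial.pderiv j P) x := by
  induction P using MvPolynomial.induction_on with
  | C a =>
    have : evalPt (MvPolynomial.C a) = fun _ : Pt d => a := by ext x; simp [evalPt]
    rw [this]; simp [evalPt]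
  | add p q hp hq =>
    have : evalPt (p + q) = fun x => evalPt p x + evalPt q x := by ext x; simp [evalPt]
    rw [this, fderiv_fun_add ((contDiff_evalPt p).differentiable one_ne_zero x)
      ((contDiff_evalPt q).differentiable one_ne_zero x)]
    simp [hp, hq, evalPt]
  | mul_X p i hp =>
    have : evalPt (p * MvPolynomial.X i) =
      fun x => evalPt p x * EuclideanSpace.proj (𝕜 := ℝ) i x := by ext x; simp [evalPt]
    rw [this, fderiv_fun_mul ((contDiff_evalPt p).differentiable one_ne_zero x)
      (EuclideanSpace.proj (𝕜 := ℝ) i).differentiableAt, ContinuousLinearMap.fderiv]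
    have hproj : ∀ y : Pt d, EuclideanSpace.proj (𝕜 := ℝ) i y = y i := fun _ => rfl
    simp only [_root_.add_apply, _root_.smul_apply, hp, smul_eq_mul]
    simp only [evalPt, Derivation.leibniz, MvPolynomial.pderiv_X, smul_eq_mul, map_add, map_mul,
      MvPolynomial.eval_X, hproj, PiLp.single_apply]
    by_cases h : i = j
    · subst h; simp
    · simp [h]

theorem totalDegree_pderiv_le (P : MvPolynomial (Fin d) ℝ) (j : Fin d) {n : ℕ}
    (h : P.totalDegree ≤ n + 1) : (MvPolynomial.pderiv j P).totalDegree ≤ n := by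
  rw [P.as_sum, map_sum]
  refine (MvPolynomial.totalDegree_finsetSum _ _).trans (Finset.sup_le fun s hs => ?_)
  rw [MvPolynomial.pderiv_monomial]
  by_cases hj : s j = 0
  · simp [hj]
  refine (MvPolynomial.totalDegree_monomial_le _ _).trans ?_
  have h1 : s.sum (fun _ e => e) ≤ n + 1 := (MvPolynomial.le_totalDegree hs).trans h
  have h2 : s = (s - Finsupp.single j 1) + Finsupp.single j 1 :=
    (tsub_add_cancel_of_le (Finsupp.single_le_iff.2 (Nat.one_le_iff_ne_zero.2 hj))).symm
  rw [h2, Finsupp.sum_add_index' (by simp) (by simp)] at h1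
  simp at h1
  simpa [Finsupp.sum] using h1

end Polynomials

/-- A continuous function that is Lipschitz on finitely many closed sets and vanishes outside of
their union is Lipschitz. -/
theorem lipschitzWith_of_closed_cover {E F ι : Type*} [NormedAddCommGroup E] [NormedSpace ℝ E]
    [NormedAddCommGroup F] [Finite ι] {C : ι → Set E} (hC : ∀ i, IsClosed (C i)) {u : E → F}
    (hu : Continuous u) {L : NNReal} (hL : ∀ i, LipschitzOnWith L u (C i))
    (h0 : ∀ x, (∀ i, x ∉ C i) → u x = 0) : LipschitzWith L u := by
  refine LipschitzWith.of_dist_le_mul fun x y => ?_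
  set γ : ℝ → E := fun t => y + t • (x - y) with hγ
  have hγc : Continuous γ := by fun_prop
  have hγd : ∀ s t : ℝ, dist (γ s) (γ t) = |s - t| * dist x y := fun s t => by
    rw [dist_eq_norm, hγ, add_sub_add_left_eq_sub, ← sub_smul, norm_smul, Real.norm_eq_abs,
      ← dist_eq_norm]
  set f : ℝ → ℝ := fun t => dist (u (γ t)) (u (γ 0)) with hf
  have hfc : Continuous f := (hu.comp hγc).dist continuous_const
  -- A mean value inequality on the segment from `y` to `x`: it is enough that, at every time,
  -- slopes at arbitrarily close later times satisfy the bound.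
  have key := image_le_of_liminf_slope_right_le_deriv_boundary (f := f) (a := 0) (b := 1)
    (B := fun t => L * dist x y * t) (B' := fun _ => L * dist x y) hfc.continuousOn (by simp [hf])
    (by fun_prop) (fun t _ =>
        by simpa using ((hasDerivAt_id t).const_mul (L * dist x y)).hasDerivWithinAt)
    (fun t _ r hr => ?_) (Set.right_mem_Icc.2 zero_le_one)
  · simpa [hf, hγ] using key
  have hslope : ∀ z, t < z → dist (u (γ z)) (u (γ t)) ≤ L * dist x y * (z - t) →
      slope f t z < r := fun z hz h => by
    refine lt_of_le_of_lt ?_ hr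
    rw [slope_def_field, div_le_iff₀ (sub_pos.2 hz)]
    have := dist_triangle (u (γ z)) (u (γ t)) (u (γ 0))
    simp only [hf]
    linarith
  -- Either some set `C i` is met at times arbitrarily close to the right of `t`, and then it
  -- contains `γ t` because it is closed; or all sets are left at once, and `u` vanishes along the
  -- path just after `t` and, by continuity, at `t`.
  by_cases hfreq : ∃ i, ∃ᶠ z in 𝓝[>] t, γ z ∈ C i
  · obtain ⟨i, hi⟩ := hfreq
    have ht : γ t ∈ C i := by
      have hten : Filter.Tendsto γ (𝓝[>] t) (𝓝 (γ t)) :=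
          hγc.continuousAt.tendsto.mono_left inf_le_left
      exact (hC i).mem_of_frequently_of_tendsto hi hten
    refine (hi.and_eventually self_mem_nhdsWithin).mono fun z hz => hslope z hz.2 ?_
    refine ((hL i).dist_le_mul _ hz.1 _ ht).trans ?_
    rw [hγd, abs_of_pos (sub_pos.2 hz.2)]
    exact le_of_eq (by ring)
  · simp only [not_exists, Filter.not_frequently] at hfreq
    have hev : ∀ᶠ z in 𝓝[>] t, u (γ z) = 0 :=
      (Filter.eventually_all.2 hfreq).mono fun z hz => h0 _ hz
    have ht : u (γ t) = 0 := by
      refine tendsto_nhds_unique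
        ((hu.comp hγc).continuousAt.tendsto.mono_left inf_le_left : Filter.Tendsto _ (𝓝[>] t) _) ?_
      exact tendsto_const_nhds.congr' (hev.mono fun z hz => hz.symm)
    refine ((hev.and self_mem_nhdsWithin).mono fun z hz => hslope z hz.2 ?_).frequently
    rw [hz.1, ht, dist_self]
    have : t < z := hz.2
    have := sub_nonneg.2 this.le
    positivity

/-! ### Geometry of the cells -/

namespace Mesh

variable {d : ℕ} {M : Mesh d}

/-- The vertices of a cell as an affine basis. -/
noncomputable def cellBasis (K : M.Cell) : AffineBasis K.1 ℝ (Pt d) where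
  toFun := fun x => x
  ind' := M.affineIndependent K.1 K.2
  tot' := by
    rw [(M.affineIndependent K.1 K.2).affineSpan_eq_top_iff_card_eq_finrank_add_one]
    simp [M.card_eq K.1 K.2]

@[simp]
theorem cellBasis_apply (K : M.Cell) (a : K.1) : cellBasis K a = a := rfl

theorem range_cellBasis (K : M.Cell) : Set.range (cellBasis K) = (K.1 : Set (Pt d)) :=
  Subtype.range_coe

theorem simplex_eq (K : M.Cell) : simplex K = {x | ∀ a, 0 ≤ (cellBasis K).coord a x} := by
  rw [simplex, ← range_cellBasis, AffineBasis.convexHull_eq_nonneg_coord]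

theorem interior_simplex (K : M.Cell) :
    interior (simplex K) = {x | ∀ a, 0 < (cellBasis K).coord a x} := by
  rw [simplex, ← range_cellBasis, AffineBasis.interior_convexHull]

theorem isCompact_simplex (K : M.Cell) : IsCompact (simplex K) :=
  Set.Finite.isCompact_convexHull (𝕜 := ℝ) K.1.finite_toSet

theorem convex_simplex (K : M.Cell) : Convex ℝ (simplex K) := convex_convexHull _ _

theorem interior_simplex_nonempty (K : M.Cell) : (interior (simplex K)).Nonempty := by
  have := (cellBasis K).centroid_mem_interior_convexHull
  rw [range_cellBasis] at this
  exact ⟨_, this⟩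

theorem simplex_subset_closure_interior (K : M.Cell) :
    simplex K ⊆ closure (interior (simplex K)) := by
  rw [(convex_simplex K).closure_interior_eq_closure_of_nonempty_interior
    (interior_simplex_nonempty K)]
  exact subset_closure

theorem interior_ae_eq_simplex (K : M.Cell) :
    interior (simplex K) =ᵐ[volume] simplex K :=
  interior_ae_eq_of_null_frontier ((convex_simplex K).addHaar_frontier _)

theorem interior_simplex_subset_domain (K : M.Cell) : interior (simplex K) ⊆ M.domain :=
  interior_mono (Set.subset_iUnion _ K)

theorem domain_subset : M.domain ⊆ ⋃ K : M.Cell, simplex K := interior_subset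

variable (M) in
theorem isCompact_union : IsCompact (⋃ K : M.Cell, simplex K) :=
  isCompact_iUnion fun K => isCompact_simplex K

/-- If the interiors met, conformity would give the hull of the common vertices a nonempty interior.
Then there would be `d + 1` common vertices, and the cells would coincide. -/
theorem disjoint_interior {K L : M.Cell} (h : K ≠ L) :
    Disjoint (interior (simplex K)) (interior (simplex L)) := by
  rw [Set.disjoint_iff_inter_eq_empty, ← interior_inter, simplex, simplex,
    M.conformal K.1 K.2 L.1 L.2]
  by_contra hne
  have hne := Set.nonempty_iff_ne_empty.2 hne
  have h1 : affineSpan ℝ ((K.1 : Set (Pt d)) ∩ L.1) = ⊤ :=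
      affineSpan_eq_top_of_nonempty_interior hne
  classical
  rw [← Finset.coe_inter] at h1
  have h2 : AffineIndependent ℝ (fun x : (K.1 ∩ L.1 : Finset (Pt d)) => (x : Pt d)) :=
    (M.affineIndependent K.1 K.2).mono (by simp)
  have h3 := h2.affineSpan_eq_top_iff_card_eq_finrank_add_one.1
    ((congrArg _ Subtype.range_coe).trans h1)
  simp only [Fintype.card_coe, finrank_euclideanSpace, Fintype.card_fin] at h3
  have h4 : K.1 ∩ L.1 = K.1 := Finset.eq_of_subset_of_card_le Finset.inter_subset_left
    (by rw [h3, M.card_eq K.1 K.2])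
  have h5 : K.1 ∩ L.1 = L.1 := Finset.eq_of_subset_of_card_le Finset.inter_subset_right
    (by rw [h3, M.card_eq L.1 L.2])
  exact h (Subtype.ext (h4.symm.trans h5))

end Mesh

end OldroydB

/-! ### Discrete velocities and integration by parts -/

namespace OldroydB

namespace Mesh

variable {d : ℕ} {M : Mesh d}

/-- A function that is continuous on the interior of a cell, up to the boundary. -/
def CellContinuous (K : M.Cell) (g : Pt d → ℝ) : Prop :=
  ∃ g' : Pt d → ℝ, Continuous g' ∧ ∀ x ∈ interior (simplex K), g x = g' x

namespace CellContinuous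

variable {K : M.Cell} {f g : Pt d → ℝ}

theorem of_continuous (h : Continuous g) : CellContinuous K g := ⟨g, h, fun _ _ => rfl⟩

theorem mul (hf : CellContinuous K f) (hg : CellContinuous K g) :
    CellContinuous K (fun x => f x * g x) := by
  obtain ⟨f', hf', hf⟩ := hf
  obtain ⟨g', hg', hg⟩ := hg
  exact ⟨fun x => f' x * g' x, hf'.mul hg', fun x hx => by simp only [hf x hx, hg x hx]⟩

theorem sum {ι : Type*} (s : Finset ι) {f : ι → Pt d → ℝ} (h : ∀ i, CellContinuous K (f i)) :
    CellContinuous K (fun x => ∑ i ∈ s, f i x) := by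
  choose f' hf' hf using h
  exact ⟨fun x => ∑ i ∈ s, f' i x, continuous_finsetSum s fun i _ => hf' i,
    fun x hx => Finset.sum_congr rfl fun i _ => hf i x hx⟩

theorem congr (hf : CellContinuous K f) (h : ∀ x ∈ interior (simplex K), g x = f x) :
    CellContinuous K g := by
  obtain ⟨f', hf', hf⟩ := hf
  exact ⟨f', hf', fun x hx => (h x hx).trans (hf x hx)⟩

theorem const_mul (c : ℝ) (hf : CellContinuous K f) : CellContinuous K (fun x => c * f x) :=
  (of_continuous continuous_const).mul hf

theorem neg (hf : CellContinuous K f) : CellContinuous K (fun x => -f x) :=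
  (hf.const_mul (-1)).congr fun x _ => by ring

theorem integrableOn (hf : CellContinuous K f) : IntegrableOn f (simplex K) := by
  obtain ⟨f', hf', hf⟩ := hf
  have h1 : IntegrableOn f' (interior (simplex K)) :=
    (hf'.continuousOn.integrableOn_compact (isCompact_simplex K)).mono_set interior_subset
  have h2 : IntegrableOn f (interior (simplex K)) :=
    h1.congr_fun (fun x hx => (hf x hx).symm) isOpen_interior.measurableSet
  exact h2.congr_set_ae (interior_ae_eq_simplex K).symm

theorem eq_zero_of_integral_eq_zero (hf : CellContinuous K f)
    (h0 : ∀ x ∈ interior (simplex K), 0 ≤ f x) (h : ∫ x in simplex K, f x = 0) :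
    ∀ x ∈ interior (simplex K), f x = 0 := by
  have hint := hf.integrableOn
  obtain ⟨f', hf', hf⟩ := hf
  rw [← setIntegral_congr_set (interior_ae_eq_simplex K)] at h
  have hint' := hint.mono_set (interior_subset (s := simplex K))
  rw [setIntegral_eq_zero_iff_of_nonneg_ae
    (ae_restrict_of_forall_mem isOpen_interior.measurableSet h0) hint'] at h
  have h1 : f' =ᵐ[volume.restrict (interior (simplex K))] fun _ => 0 := by
    filter_upwards [h, ae_restrict_mem isOpen_interior.measurableSet] with x hx hxK
    rw [← hf x hxK]; exact hx
  have h2 := Measure.eqOn_open_of_ae_eq h1 isOpen_interior hf'.continuousOn continuousOn_const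
  intro x hx
  rw [hf x hx]; exact h2 hx

end CellContinuous

/-- Boundaries of cells are null sets. This disposes of the faces, where the gradient of a piecewise
polynomial field need not exist. -/
theorem setIntegral_simplex_congr {K : M.Cell} {F : Type*} [NormedAddCommGroup F] [NormedSpace ℝ F]
    {f g : Pt d → F} (h : ∀ x ∈ interior (simplex K), f x = g x) :
    ∫ x in simplex K, f x = ∫ x in simplex K, g x := by
  rw [← setIntegral_congr_set (interior_ae_eq_simplex K),
    ← setIntegral_congr_set (interior_ae_eq_simplex K)]
  exact setIntegral_congr_fun isOpen_interior.measurableSet h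

theorem integral_eq_sum_simplex {g : Pt d → ℝ} (h0 : ∀ x, x ∉ ⋃ K : M.Cell, simplex K → g x = 0)
    (hg : ∀ K : M.Cell, IntegrableOn g (simplex K)) :
    ∫ x, g x = ∑ K : M.Cell, ∫ x in simplex K, g x := by
  rw [← setIntegral_eq_integral_of_forall_compl_eq_zero h0, integral_iUnion_ae]
  · rw [tsum_fintype]
  · exact fun K => (isCompact_simplex K).isClosed.measurableSet.nullMeasurableSet
  · intro K L hKL
    have h1 : AEDisjoint volume (interior (simplex K)) (interior (simplex L)) :=
      (disjoint_interior hKL).aedisjoint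
    exact h1.congr (interior_ae_eq_simplex K).symm (interior_ae_eq_simplex L).symm
  · exact (integrableOn_finite_iUnion).2 hg

variable (M) in
/-- The velocity space as a vector space. -/
def velocity : Submodule ℝ (Pt d → Pt d) where
  carrier := M.velocitySpace
  zero_mem' := ⟨continuous_const, fun _ _ => rfl, fun K i => ⟨0, by simp, fun x _ => by simp⟩⟩
  add_mem' := by
    rintro u v ⟨hu, hu0, huP⟩ ⟨hv, hv0, hvP⟩
    refine ⟨hu.add hv, fun x hx => by simp [hu0 x hx, hv0 x hx], fun K i => ?_⟩
    obtain ⟨P, hP, hP'⟩ := huP K i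
    obtain ⟨Q, hQ, hQ'⟩ := hvP K i
    exact ⟨P + Q, (MvPolynomial.totalDegree_add _ _).trans (max_le hP hQ),
      fun x hx => by simp [hP' x hx, hQ' x hx]⟩
  smul_mem' := by
    rintro c u ⟨hu, hu0, huP⟩
    refine ⟨hu.const_smul c, fun x hx => by simp [hu0 x hx], fun K i => ?_⟩
    obtain ⟨P, hP, hP'⟩ := huP K i
    exact ⟨c • P, (MvPolynomial.totalDegree_smul_le _ _).trans hP,
      fun x hx => by simp [hP' x hx, MvPolynomial.smul_eval]⟩

section Velocity

variable {u v w : Pt d → Pt d}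

theorem eq_zero_of_notMem_domain (hu : u ∈ M.velocity) {x : Pt d} (hx : x ∉ M.domain) : u x = 0 :=
  hu.2.1 x hx

theorem eq_zero_of_notMem_union (hu : u ∈ M.velocity) {x : Pt d}
    (hx : x ∉ ⋃ K : M.Cell, simplex K) : u x = 0 :=
  hu.2.1 x fun h => hx (domain_subset h)

/-- The vector field with polynomial components `P`. -/
noncomputable def polyField (P : Fin d → MvPolynomial (Fin d) ℝ) (x : Pt d) : Pt d :=
  WithLp.toLp 2 fun i => evalPt (P i) x

theorem contDiff_polyField (P : Fin d → MvPolynomial (Fin d) ℝ) : ContDiff ℝ 1 (polyField P) :=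
  contDiff_euclidean.2 fun i => contDiff_evalPt (P i)

theorem exists_eqOn_polyField (hu : u ∈ M.velocity) (K : M.Cell) :
    ∃ P : Fin d → MvPolynomial (Fin d) ℝ, (∀ i, (P i).totalDegree ≤ 2) ∧
      Set.EqOn u (polyField P) (simplex K) := by
  choose P hP hP' using hu.2.2 K
  exact ⟨P, hP, fun x hx => by ext i; exact hP' i x hx⟩

theorem grad_polyField (P : Fin d → MvPolynomial (Fin d) ℝ) (x : Pt d) (i j : Fin d) :
    grad (polyField P) x i j = evalPt (MvPolynomial.pderiv j (P i)) x := by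
  rw [← fderiv_evalPt, grad, Matrix.of_apply]
  have h1 : evalPt (P i) = fun y => EuclideanSpace.proj (𝕜 := ℝ) i (polyField P y) := rfl
  rw [h1, fderiv_fun_comp (g := EuclideanSpace.proj (𝕜 := ℝ) i) _
    (EuclideanSpace.proj (𝕜 := ℝ) i).differentiableAt
    ((contDiff_polyField P).differentiable one_ne_zero x), ContinuousLinearMap.fderiv]
  rfl

theorem eventuallyEq_polyField {P : Fin d → MvPolynomial (Fin d) ℝ} {K : M.Cell}
    (h : Set.EqOn u (polyField P) (simplex K)) {x : Pt d} (hx : x ∈ interior (simplex K)) :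
    u =ᶠ[𝓝 x] polyField P := by
  filter_upwards [isOpen_interior.mem_nhds hx] with y hy using h (interior_subset hy)

theorem differentiableAt_velocity (hu : u ∈ M.velocity) {K : M.Cell} {x : Pt d}
    (hx : x ∈ interior (simplex K)) : DifferentiableAt ℝ u x := by
  obtain ⟨P, -, hP⟩ := exists_eqOn_polyField hu K
  exact (eventuallyEq_polyField hP hx).differentiableAt_iff.2
    ((contDiff_polyField P).differentiable one_ne_zero x)

theorem grad_eq_of_eqOn {P : Fin d → MvPolynomial (Fin d) ℝ} {K : M.Cell}
    (h : Set.EqOn u (polyField P) (simplex K)) {x : Pt d} (hx : x ∈ interior (simplex K))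
    (i j : Fin d) : grad u x i j = evalPt (MvPolynomial.pderiv j (P i)) x := by
  rw [← grad_polyField, grad, grad, (eventuallyEq_polyField h hx).fderiv_eq]

theorem cellContinuous_apply (hu : u ∈ M.velocity) (K : M.Cell) (i : Fin d) :
    CellContinuous K (fun x => u x i) :=
  .of_continuous ((EuclideanSpace.proj (𝕜 := ℝ) i).continuous.comp hu.1)

theorem cellContinuous_grad (hu : u ∈ M.velocity) (K : M.Cell) (i j : Fin d) :
    CellContinuous K (fun x => grad u x i j) := by
  obtain ⟨P, -, hP⟩ := exists_eqOn_polyField hu K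
  exact ⟨_, (contDiff_evalPt _).continuous, fun x hx => grad_eq_of_eqOn hP hx i j⟩

theorem cellContinuous_divergence (hu : u ∈ M.velocity) (K : M.Cell) :
    CellContinuous K (divergence u) :=
  CellContinuous.sum Finset.univ fun i => cellContinuous_grad hu K i i

/-- Differentiation lowers the degree by one, so the divergence of a velocity is, cell by cell, an
element of the pressure space. -/
theorem exists_divergence_eq (hu : u ∈ M.velocity) (K : M.Cell) :
    ∃ P : MvPolynomial (Fin d) ℝ, P.totalDegree ≤ 1 ∧
      ∀ x ∈ interior (simplex K), divergence u x = evalPt P x := by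
  obtain ⟨P, hP, hPu⟩ := exists_eqOn_polyField hu K
  refine ⟨∑ i, MvPolynomial.pderiv i (P i), ?_, fun x hx => ?_⟩
  · exact (MvPolynomial.totalDegree_finsetSum _ _).trans
      (Finset.sup_le fun i _ => totalDegree_pderiv_le _ _ (hP i))
  · simp only [divergence, Matrix.trace, Matrix.diag, grad_eq_of_eqOn hPu hx, evalPt, map_sum]

theorem grad_add (hu : u ∈ M.velocity) (hv : v ∈ M.velocity) {K : M.Cell} {x : Pt d}
    (hx : x ∈ interior (simplex K)) : grad (u + v) x = grad u x + grad v x := by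
  ext i j
  simp [grad, fderiv_add (differentiableAt_velocity hu hx) (differentiableAt_velocity hv hx)]

theorem grad_smul (u : Pt d → Pt d) (c : ℝ) (x : Pt d) : grad (c • u) x = c • grad u x := by
  ext i j
  simp [grad, fderiv_const_smul_field]

theorem eq_sum_smul_single (y : Pt d) : y = ∑ j, y j • EuclideanSpace.single j (1 : ℝ) := by
  ext k; simp [Pi.single_apply]

theorem fderiv_apply_eq (u : Pt d → Pt d) (x y : Pt d) (i : Fin d) :
    fderiv ℝ u x y i = ∑ j, grad u x i j * y j := by
  conv_lhs => rw [eq_sum_smul_single y]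
  simp [grad, mul_comm]

/-- Global Lipschitz continuity is the regularity used for the flow and for integration by parts
across faces. -/
theorem exists_lipschitzWith (hu : u ∈ M.velocity) : ∃ L, LipschitzWith L u := by
  have h : ∀ K : M.Cell, ∃ L, LipschitzOnWith L u (simplex K) := fun K => by
    obtain ⟨P, -, hP⟩ := exists_eqOn_polyField hu K
    obtain ⟨L, hL⟩ := ((contDiff_polyField P).locallyLipschitz.locallyLipschitzOn
      (s := simplex K)).exists_lipschitzOnWith_of_compact (isCompact_simplex K)
    exact ⟨L, fun x hx y hy => by rw [hP hx, hP hy]; exact hL hx hy⟩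
  choose L hL using h
  exact ⟨∑ K, L K, lipschitzWith_of_closed_cover (fun K => (isCompact_simplex K).isClosed) hu.1
    (fun K => (hL K).weaken (Finset.single_le_sum (fun _ _ => zero_le) (Finset.mem_univ K)))
    fun x hx => eq_zero_of_notMem_union hu (by simpa using hx)⟩

theorem hasCompactSupport_velocity (hu : u ∈ M.velocity) : HasCompactSupport u :=
  HasCompactSupport.intro (isCompact_union M) fun _ hx => eq_zero_of_notMem_union hu hx

theorem exists_norm_le (hu : u ∈ M.velocity) : ∃ C, 0 ≤ C ∧ ∀ x, ‖u x‖ ≤ C := by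
  obtain ⟨C, hC⟩ := (hasCompactSupport_velocity hu).exists_bound_of_continuous hu.1
  exact ⟨C, (norm_nonneg _).trans (hC 0), hC⟩

/-- The field has Lipschitz constant zero on each cell, hence globally. It vanishes at some point,
since a compact mesh cannot cover a space of positive dimension. -/
theorem eq_zero_of_grad_eq_zero [NeZero d] (hu : u ∈ M.velocity)
    (h : ∀ K : M.Cell, ∀ x ∈ interior (simplex K), grad u x = 0) : u = 0 := by
  have h1 : ∀ K : M.Cell, LipschitzOnWith 0 u (simplex K) := fun K => by
    have h2 : LipschitzOnWith 0 u (interior (simplex K)) := by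
      refine (convex_simplex K).interior.lipschitzOnWith_of_nnnorm_fderiv_le
        (fun x hx => differentiableAt_velocity hu hx) fun x hx => ?_
      have : fderiv ℝ u x = 0 := by
        ext y i
        rw [fderiv_apply_eq, h K x hx]
        simp
      simp [this]
    exact (h2.closure hu.1.continuousOn).mono (simplex_subset_closure_interior K)
  have h2 : LipschitzWith 0 u :=
    lipschitzWith_of_closed_cover (fun K => (isCompact_simplex K).isClosed) hu.1 h1
      fun x hx => eq_zero_of_notMem_union hu (by simpa using hx)
  obtain ⟨y, hy⟩ : ∃ y, y ∉ ⋃ K : M.Cell, simplex K := by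
    by_contra hcon
    push Not at hcon
    exact noncompact_univ (Pt d) ((Set.eq_univ_of_forall hcon) ▸ isCompact_union M)
  funext x
  have := h2.dist_le_mul x y
  rw [NNReal.coe_zero, zero_mul, eq_zero_of_notMem_union hu hy] at this
  exact dist_le_zero.1 this

/-- Integration by parts of a Lipschitz function against a discrete velocity. -/
theorem integral_fderiv_apply_velocity (hw : w ∈ M.velocity) {f : Pt d → ℝ} {C : NNReal}
    (hf : LipschitzWith C f) :
    ∫ x, fderiv ℝ f x (w x) = -∑ K : M.Cell, ∫ x in simplex K, f x * divergence w x := by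
  obtain ⟨L, hL⟩ := exists_lipschitzWith hw
  have hLj : ∀ j, LipschitzWith L (fun x => w x j) := fun j => by
    refine LipschitzWith.of_dist_le_mul fun x y => ?_
    refine le_trans ?_ (hL.dist_le_mul x y)
    rw [dist_eq_norm, dist_eq_norm, ← PiLp.sub_apply]
    exact PiLp.norm_apply_le _ j
  have hcj : ∀ j, HasCompactSupport (fun x => w x j) := fun j =>
    HasCompactSupport.intro (isCompact_union M) fun x hx => by
      rw [eq_zero_of_notMem_union hw hx]; rfl
  have hint : ∀ j : Fin d, Integrable (fun x =>
      lineDeriv ℝ f x (EuclideanSpace.single j 1) * w x j) :=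
    fun j => by
      have h1 : Integrable (fun x => w x j) :=
        (hLj j).continuous.integrable_of_hasCompactSupport (hcj j)
      refine h1.bdd_mul (c := C * ‖EuclideanSpace.single j (1 : ℝ)‖)
        (measurable_lineDeriv hf.continuous).aestronglyMeasurable ?_
      exact Filter.Eventually.of_forall fun x => norm_lineDeriv_le_of_lipschitz ℝ hf
  have h1 : ∫ x, fderiv ℝ f x (w x) =
      ∑ j, ∫ x, lineDeriv ℝ f x (EuclideanSpace.single j 1) * w x j := by
    rw [← integral_finsetSum _ fun j _ => hint j]
    refine integral_congr_ae ?_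
    filter_upwards [hf.ae_differentiableAt] with x hx
    conv_lhs => rw [eq_sum_smul_single (w x)]
    simp [hx.lineDeriv_eq_fderiv, mul_comm]
  have h2 : ∀ j : Fin d, ∫ x, lineDeriv ℝ f x (EuclideanSpace.single j 1) * w x j =
      -∑ K : M.Cell, ∫ x in simplex K, f x * grad w x j j := fun j => by
    rw [hf.integral_lineDeriv_mul_eq (hLj j) (hcj j)]
    have hcell : ∀ K : M.Cell, ∀ x ∈ interior (simplex K),
        lineDeriv ℝ (fun x => w x j) x (-EuclideanSpace.single j 1) * f x =
          -(f x * grad w x j j) := fun K x hx => by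
      have hd := differentiableAt_velocity hw hx
      have hd' : HasFDerivAt (fun x => w x j)
          ((EuclideanSpace.proj (𝕜 := ℝ) j).comp (fderiv ℝ w x)) x :=
        (EuclideanSpace.proj (𝕜 := ℝ) j).hasFDerivAt.comp x hd.hasFDerivAt
      rw [hd'.differentiableAt.lineDeriv_eq_fderiv, hd'.fderiv]
      simp [grad, mul_comm]
    have hcc : ∀ K : M.Cell, CellContinuous K (fun x => f x * grad w x j j) := fun K =>
      (CellContinuous.of_continuous hf.continuous).mul (cellContinuous_grad hw K j j)
    rw [integral_eq_sum_simplex (M := M), ← Finset.sum_neg_distrib]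
    · refine Finset.sum_congr rfl fun K _ => ?_
      rw [setIntegral_simplex_congr (hcell K), integral_neg]
    · intro x hx
      have : (fun x => w x j) =ᶠ[𝓝 x] fun _ => 0 := by
        filter_upwards [(isCompact_union M).isClosed.isOpen_compl.mem_nhds hx] with y hy
        rw [eq_zero_of_notMem_union hw hy]; rfl
      rw [this.lineDeriv_eq]
      simp [lineDeriv]
    · intro K
      exact ((hcc K).neg.congr (hcell K)).integrableOn
  rw [h1, Finset.sum_congr rfl fun j _ => h2 j, Finset.sum_neg_distrib, Finset.sum_comm]
  congr 1
  refine Finset.sum_congr rfl fun K _ => ?_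
  rw [← integral_finsetSum]
  · simp only [divergence, Matrix.trace, Matrix.diag, Finset.mul_sum]
  · exact fun j _ => ((CellContinuous.of_continuous hf.continuous).mul
      (cellContinuous_grad hw K j j)).integrableOn

theorem lipschitzWith_half_norm_sq (hu : u ∈ M.velocity) :
    ∃ C, LipschitzWith C (fun x => 1 / 2 * ‖u x‖ ^ 2) := by
  obtain ⟨L, hL⟩ := exists_lipschitzWith hu
  obtain ⟨B, hB0, hB⟩ := exists_norm_le hu
  lift B to NNReal using hB0
  refine ⟨B * L, LipschitzWith.of_dist_le_mul fun x y => ?_⟩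
  have h1 := hL.dist_le_mul x y
  rw [dist_eq_norm] at h1
  have h2 : |‖u x‖ - ‖u y‖| ≤ L * dist x y := (abs_norm_sub_norm_le _ _).trans h1
  rw [Real.dist_eq, ← mul_sub, sq_sub_sq, abs_mul, abs_mul, NNReal.coe_mul, mul_assoc]
  have h3 : |‖u x‖ + ‖u y‖| ≤ 2 * B := by
    rw [abs_of_nonneg (by positivity)]; linarith [hB x, hB y]
  calc |1 / 2| * (|‖u x‖ + ‖u y‖| * |‖u x‖ - ‖u y‖|)
      ≤ 1 / 2 * ((2 * B) * (L * dist x y)) := by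
        rw [abs_of_pos (by norm_num : (0 : ℝ) < 1 / 2)]
        gcongr
    _ = _ := by ring

theorem cellContinuous_inner_fderiv (hu : u ∈ M.velocity) (hv : v ∈ M.velocity)
    (hw : w ∈ M.velocity) (K : M.Cell) :
    CellContinuous K (fun x => inner ℝ (fderiv ℝ u x (w x)) (v x)) := by
  have : (fun x => inner ℝ (fderiv ℝ u x (w x)) (v x)) =
      fun x => ∑ i, (∑ j, grad u x i j * w x j) * v x i := by
    funext x
    simp only [PiLp.inner_apply, fderiv_apply_eq]
    simp [mul_comm]
  rw [this]
  exact .sum _ fun i => (CellContinuous.sum _ fun j =>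
    (cellContinuous_grad hu K i j).mul (cellContinuous_apply hw K j)).mul
    (cellContinuous_apply hv K i)

/-- The convection form is antisymmetric up to the divergence of the convecting field. -/
theorem sum_integral_convection (hu : u ∈ M.velocity) (hw : w ∈ M.velocity) :
    ∑ K : M.Cell, ∫ x in simplex K, inner ℝ (fderiv ℝ u x (w x)) (u x) =
      -∑ K : M.Cell, ∫ x in simplex K, 1 / 2 * ‖u x‖ ^ 2 * divergence w x := by
  obtain ⟨C, hC⟩ := lipschitzWith_half_norm_sq hu
  rw [← integral_fderiv_apply_velocity hw hC]
  -- The convection form on the diagonal is the transport of `½ ‖u‖²`, which is Lipschitz and can be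
  -- integrated by parts.
  have hcell : ∀ K : M.Cell, ∀ x ∈ interior (simplex K),
      fderiv ℝ (fun x => 1 / 2 * ‖u x‖ ^ 2) x (w x) = inner ℝ (fderiv ℝ u x (w x)) (u x) :=
    fun K x hx => by
      have hd := (differentiableAt_velocity hu hx).hasFDerivAt
      have h1 := (hd.norm_sq).const_mul (1 / 2 : ℝ)
      rw [h1.fderiv, real_inner_comm]
      simp
  rw [integral_eq_sum_simplex (M := M)]
  · exact Finset.sum_congr rfl fun K _ => (setIntegral_simplex_congr (hcell K)).symm
  · intro x hx
    rw [eq_zero_of_notMem_union hw hx, map_zero]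
  · intro K
    exact ((cellContinuous_inner_fderiv hu hu hw K).congr (hcell K)).integrableOn

end Velocity

end Mesh

end OldroydB

/-! ### Bilinear forms, divergence-free velocities and the pressure -/

namespace OldroydB

/-- Linear maps on a finite-dimensional space are bounded with respect to any positive definite
symmetric bilinear form. -/
theorem exists_norm_le_sqrt_of_posDef {H W : Type*} [AddCommGroup H] [Module ℝ H]
    [FiniteDimensional ℝ H] [NormedAddCommGroup W] [NormedSpace ℝ W] (a : H →ₗ[ℝ] H →ₗ[ℝ] ℝ)
    (hsymm : ∀ u v, a u v = a v u) (hpos : ∀ u, u ≠ 0 → 0 < a u u) (f : H →ₗ[ℝ] W) :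
    ∃ C, 0 ≤ C ∧ ∀ u, ‖f u‖ ≤ C * √(a u u) := by
  have hnn : ∀ u, 0 ≤ a u u := fun u => by
    by_cases h : u = 0
    · simp [h]
    · exact (hpos u h).le
  have hfun : ∀ c : H →ₗ[ℝ] ℝ, ∃ C, 0 ≤ C ∧ ∀ u, |c u| ≤ C * √(a u u) := fun c => by
    have hinj : Function.Injective (a : H →ₗ[ℝ] Module.Dual ℝ H) := by
      rw [injective_iff_map_eq_zero]
      intro u hu
      by_contra hne
      have := hpos u hne
      rw [hu] at this
      simp at this
    obtain ⟨w, hw⟩ := (LinearMap.injective_iff_surjective_of_finrank_eq_finrank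
      (Subspace.dual_finrank_eq (K := ℝ) (V := H)).symm).1 hinj c
    -- `w` represents `c` with respect to the form `a`, and Cauchy–Schwarz gives the constant.
    refine ⟨√(a w w), Real.sqrt_nonneg _, fun u => ?_⟩
    rw [← Real.sqrt_mul (hnn w)]
    refine Real.abs_le_sqrt ?_
    rw [← hw]
    exact LinearMap.BilinForm.apply_sq_le_of_symm a hnn ⟨fun x y => hsymm x y⟩ w u
  let b := Module.finBasis ℝ H
  choose C hC0 hC using fun i => hfun (b.coord i)
  refine ⟨∑ i, C i * ‖f (b i)‖, Finset.sum_nonneg fun i _ => mul_nonneg (hC0 i) (norm_nonneg _),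
    fun u => ?_⟩
  conv_lhs => rw [← b.sum_repr u, map_sum]
  rw [Finset.sum_mul]
  refine (norm_sum_le _ _).trans (Finset.sum_le_sum fun i _ => ?_)
  rw [map_smul, norm_smul, mul_right_comm]
  exact mul_le_mul_of_nonneg_right (hC i u) (norm_nonneg _)

namespace Mesh

variable {d : ℕ} {M : Mesh d}

/-- A velocity is determined by its restrictions to the cells, and these lie in the image of a
finite-dimensional space of polynomials. -/
instance finiteDimensional_velocity : FiniteDimensional ℝ M.velocity := by
  let W := (K : M.Cell) → simplex K → Fin d → ℝ
  let Ψ : (M.Cell → Fin d → MvPolynomial.restrictTotalDegree (Fin d) ℝ 2) →ₗ[ℝ] W :=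
    { toFun := fun P K x i => evalPt (P K i).1 x.1
      map_add' := fun P Q => by
        funext K x i; exact map_add (MvPolynomial.eval fun j => x.1 j) _ _
      map_smul' := fun c P => by
        funext K x i; exact MvPolynomial.smul_eval _ _ _ }
  let R : M.velocity →ₗ[ℝ] W :=
    { toFun := fun u K x i => u.1 x.1 i
      map_add' := fun u v => rfl
      map_smul' := fun c u => rfl }
  have hR : ∀ u, R u ∈ LinearMap.range Ψ := fun u => by
    choose P hP hP' using u.2.2.2
    exact ⟨fun K i => ⟨P K i, (MvPolynomial.mem_restrictTotalDegree _ _ _).2 (hP K i)⟩, by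
      ext K x i; exact (hP' K i x.1 x.2).symm⟩
  refine FiniteDimensional.of_injective (R.codRestrict (LinearMap.range Ψ) hR) ?_
  rw [injective_iff_map_eq_zero]
  intro u hu
  have hu' : R u = 0 := congrArg Subtype.val hu
  ext x i
  by_cases hx : x ∈ ⋃ K : M.Cell, simplex K
  · obtain ⟨K, hK⟩ := Set.mem_iUnion.1 hx
    exact congrFun (congrFun (congrFun hu' K) ⟨x, hK⟩) i
  · rw [eq_zero_of_notMem_union u.2 hx]; rfl

/-- A family of integrands that is bilinear and integrable on the cells. -/
structure IsCellBilin (M : Mesh d) (F : (Pt d → Pt d) → (Pt d → Pt d) → Pt d → ℝ) : Prop where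
  cc : ∀ u ∈ M.velocity, ∀ v ∈ M.velocity, ∀ K : M.Cell, CellContinuous K (F u v)
  add_left : ∀ u ∈ M.velocity, ∀ u' ∈ M.velocity, ∀ v ∈ M.velocity, ∀ K : M.Cell,
    ∀ x ∈ interior (simplex K), F (u + u') v x = F u v x + F u' v x
  smul_left : ∀ (c : ℝ), ∀ u ∈ M.velocity, ∀ v ∈ M.velocity, ∀ K : M.Cell,
    ∀ x ∈ interior (simplex K), F (c • u) v x = c * F u v x
  add_right : ∀ u ∈ M.velocity, ∀ v ∈ M.velocity, ∀ v' ∈ M.velocity, ∀ K : M.Cell,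
    ∀ x ∈ interior (simplex K), F u (v + v') x = F u v x + F u v' x
  smul_right : ∀ (c : ℝ), ∀ u ∈ M.velocity, ∀ v ∈ M.velocity, ∀ K : M.Cell,
    ∀ x ∈ interior (simplex K), F u (c • v) x = c * F u v x

/-- The bilinear form obtained by summing the integrals over the cells. -/
noncomputable def cellBilin {F : (Pt d → Pt d) → (Pt d → Pt d) → Pt d → ℝ}
    (h : IsCellBilin M F) : M.velocity →ₗ[ℝ] M.velocity →ₗ[ℝ] ℝ :=
  LinearMap.mk₂ ℝ (fun u v => ∑ K : M.Cell, ∫ x in simplex K, F u v x)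
    (fun u u' v => by
      rw [← Finset.sum_add_distrib]
      refine Finset.sum_congr rfl fun K _ => ?_
      rw [← integral_add (h.cc _ u.2 _ v.2 K).integrableOn (h.cc _ u'.2 _ v.2 K).integrableOn]
      exact setIntegral_simplex_congr (h.add_left _ u.2 _ u'.2 _ v.2 K))
    (fun c u v => by
      rw [smul_eq_mul, Finset.mul_sum]
      refine Finset.sum_congr rfl fun K _ => ?_
      rw [← integral_const_mul]
      exact setIntegral_simplex_congr (h.smul_left c _ u.2 _ v.2 K))
    (fun u v v' => by
      rw [← Finset.sum_add_distrib]
      refine Finset.sum_congr rfl fun K _ => ?_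
      rw [← integral_add (h.cc _ u.2 _ v.2 K).integrableOn (h.cc _ u.2 _ v'.2 K).integrableOn]
      exact setIntegral_simplex_congr (h.add_right _ u.2 _ v.2 _ v'.2 K))
    (fun c u v => by
      rw [smul_eq_mul, Finset.mul_sum]
      refine Finset.sum_congr rfl fun K _ => ?_
      rw [← integral_const_mul]
      exact setIntegral_simplex_congr (h.smul_right c _ u.2 _ v.2 K))

theorem cellContinuous_inner {u v : Pt d → Pt d} (hu : u ∈ M.velocity) (hv : v ∈ M.velocity)
    (K : M.Cell) : CellContinuous K (fun x => inner ℝ (u x) (v x)) :=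
  .of_continuous (hu.1.inner hv.1)

theorem cellContinuous_ddot_grad {u v : Pt d → Pt d} (hu : u ∈ M.velocity) (hv : v ∈ M.velocity)
    (K : M.Cell) : CellContinuous K (fun x => ddot (grad u x) (grad v x)) :=
  .sum _ fun i => .sum _ fun j => (cellContinuous_grad hu K i j).mul (cellContinuous_grad hv K i j)

theorem isCellBilin_inner : IsCellBilin M (fun u v x => inner ℝ (u x) (v x)) where
  cc := fun u hu v hv K => cellContinuous_inner hu hv K
  add_left := fun u _ u' _ v _ K x _ => by simp [inner_add_left]
  smul_left := fun c u _ v _ K x _ => by simp [real_inner_smul_left]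
  add_right := fun u _ v _ v' _ K x _ => by simp [inner_add_right]
  smul_right := fun c u _ v _ K x _ => by simp [real_inner_smul_right]

theorem isCellBilin_ddot_grad : IsCellBilin M (fun u v x => ddot (grad u x) (grad v x)) where
  cc := fun u hu v hv K => cellContinuous_ddot_grad hu hv K
  add_left := fun u hu u' hu' v _ K x hx => by rw [grad_add hu hu' hx, ddot_add_left]
  smul_left := fun c u _ v _ K x _ => by rw [grad_smul, ddot_smul_left]
  add_right := fun u _ v hv v' hv' K x hx => by rw [grad_add hv hv' hx, ddot_add_right]
  smul_right := fun c u _ v _ K x _ => by rw [grad_smul, ddot_smul_right]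

theorem isCellBilin_convection {w : Pt d → Pt d} (hw : w ∈ M.velocity) :
    IsCellBilin M (fun u v x => inner ℝ (fderiv ℝ u x (w x)) (v x)) where
  cc := fun u hu v hv K => cellContinuous_inner_fderiv hu hv hw K
  add_left := fun u hu u' hu' v _ K x hx => by
    rw [fderiv_add (differentiableAt_velocity hu hx) (differentiableAt_velocity hu' hx)]
    simp [inner_add_left]
  smul_left := fun c u _ v _ K x _ => by
    rw [fderiv_const_smul_field]; simp [real_inner_smul_left]
  add_right := fun u _ v _ v' _ K x _ => by simp [inner_add_right]
  smul_right := fun c u _ v _ K x _ => by simp [real_inner_smul_right]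

variable (M) in
/-- The mass form on the velocity space. -/
noncomputable def massForm : M.velocity →ₗ[ℝ] M.velocity →ₗ[ℝ] ℝ :=
  cellBilin isCellBilin_inner

variable (M) in
/-- The stiffness form on the velocity space. -/
noncomputable def stiffForm : M.velocity →ₗ[ℝ] M.velocity →ₗ[ℝ] ℝ :=
  cellBilin isCellBilin_ddot_grad

/-- The convection form on the velocity space. -/
noncomputable def convForm (w : M.velocity) : M.velocity →ₗ[ℝ] M.velocity →ₗ[ℝ] ℝ :=
  cellBilin (isCellBilin_convection w.2)

theorem massForm_apply (u v : M.velocity) :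
    M.massForm u v = ∑ K : M.Cell, ∫ x in simplex K, inner ℝ (u.1 x) (v.1 x) := rfl

theorem stiffForm_apply (u v : M.velocity) :
    M.stiffForm u v = ∑ K : M.Cell, ∫ x in simplex K, ddot (grad u x) (grad v x) := rfl

theorem convForm_apply (w u v : M.velocity) :
    convForm w u v = ∑ K : M.Cell, ∫ x in simplex K, inner ℝ (fderiv ℝ u x (w.1 x)) (v.1 x) := rfl

theorem massForm_self (u : M.velocity) :
    M.massForm u u = ∑ K : M.Cell, ∫ x in simplex K, ‖u.1 x‖ ^ 2 := by
  simp only [massForm_apply, real_inner_self_eq_norm_sq]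

theorem massForm_nonneg (u : M.velocity) : 0 ≤ M.massForm u u := by
  rw [massForm_self]
  exact Finset.sum_nonneg fun K _ => integral_nonneg fun x => by positivity

theorem massForm_comm (u v : M.velocity) : M.massForm u v = M.massForm v u := by
  simp only [massForm_apply, real_inner_comm]

theorem massForm_le (u v : M.velocity) :
    M.massForm u v ≤ (M.massForm v v + M.massForm u u) / 2 := by
  have h := massForm_nonneg (u - v)
  simp only [map_sub, LinearMap.sub_apply, massForm_comm v u] at h
  linarith

theorem ddot_self_nonneg (A : Tensor d) : 0 ≤ ddot A A := by
  rw [ddot_self_eq_norm_sq]; positivity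

theorem stiffForm_comm (u v : M.velocity) : M.stiffForm u v = M.stiffForm v u := by
  simp only [stiffForm_apply, ddot_comm]

theorem stiffForm_pos [NeZero d] (u : M.velocity) (hu : u ≠ 0) : 0 < M.stiffForm u u := by
  have hnn : ∀ K ∈ Finset.univ, 0 ≤ ∫ x in simplex (M := M) K, ddot (grad u.1 x) (grad u.1 x) :=
    fun K _ => integral_nonneg fun x => ddot_self_nonneg _
  refine lt_of_le_of_ne (Finset.sum_nonneg hnn) fun h => hu ?_
  have h1 := (Finset.sum_eq_zero_iff_of_nonneg hnn).1 h.symm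
  refine Subtype.ext (eq_zero_of_grad_eq_zero u.2 fun K x hx => ?_)
  have h2 := (cellContinuous_ddot_grad u.2 u.2 K).eq_zero_of_integral_eq_zero
    (fun x _ => ddot_self_nonneg _) (h1 K (Finset.mem_univ K)) x hx
  rw [ddot_self_eq_norm_sq] at h2
  exact norm_eq_zero.1 (pow_eq_zero_iff two_ne_zero |>.1 h2)

/-- The integral of the velocity gradient over a cell. -/
noncomputable def gradIntegral (K : M.Cell) : M.velocity →ₗ[ℝ] Tensor d where
  toFun u := Matrix.of fun i j => ∫ x in simplex K, grad u x i j
  map_add' u v := by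
    ext i j
    simp only [Matrix.of_apply, Matrix.add_apply]
    rw [← integral_add (cellContinuous_grad u.2 K i j).integrableOn
      (cellContinuous_grad v.2 K i j).integrableOn]
    refine setIntegral_simplex_congr fun x hx => ?_
    rw [Submodule.coe_add, grad_add u.2 v.2 hx, Matrix.add_apply]
  map_smul' c u := by
    ext i j
    simp only [Matrix.of_apply, Matrix.smul_apply, RingHom.id_apply, smul_eq_mul]
    rw [← integral_const_mul]
    refine setIntegral_simplex_congr fun x hx => ?_
    rw [Submodule.coe_smul, grad_smul, Matrix.smul_apply, smul_eq_mul]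

theorem trace_gradIntegral (K : M.Cell) (u : M.velocity) :
    (gradIntegral K u).trace = ∫ x in simplex K, divergence u.1 x := by
  simp only [divergence, Matrix.trace, Matrix.diag]
  rw [integral_finsetSum _ fun i _ => (cellContinuous_grad u.2 K i i).integrableOn]
  rfl

variable (M) in
/-- The pressure space as a vector space. -/
def pressure : Submodule ℝ (M.Cell → Pt d → ℝ) where
  carrier := M.pressureSpace
  zero_mem' := fun K => ⟨0, by simp, fun x => by simp⟩
  add_mem' := by
    rintro p q hp hq K
    obtain ⟨P, hP, hP'⟩ := hp K
    obtain ⟨Q, hQ, hQ'⟩ := hq K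
    exact ⟨P + Q, (MvPolynomial.totalDegree_add _ _).trans (max_le hP hQ),
      fun x => by simp [hP' x, hQ' x]⟩
  smul_mem' := by
    rintro c p hp K
    obtain ⟨P, hP, hP'⟩ := hp K
    exact ⟨c • P, (MvPolynomial.totalDegree_smul_le _ _).trans hP,
      fun x => by simp [hP' x, MvPolynomial.smul_eval]⟩

theorem continuous_pressure {p : M.Cell → Pt d → ℝ} (hp : p ∈ M.pressure) (K : M.Cell) :
    Continuous (p K) := by
  obtain ⟨P, -, hP⟩ := hp K
  have : p K = evalPt P := funext hP
  rw [this]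
  exact (contDiff_evalPt P).continuous

theorem cellContinuous_pressure_mul {p : M.Cell → Pt d → ℝ} (hp : p ∈ M.pressure)
    {u : Pt d → Pt d} (hu : u ∈ M.velocity) (K : M.Cell) :
    CellContinuous K (fun x => p K x * divergence u x) :=
  (CellContinuous.of_continuous (continuous_pressure hp K)).mul (cellContinuous_divergence hu K)

theorem divergence_add {u v : Pt d → Pt d} (hu : u ∈ M.velocity) (hv : v ∈ M.velocity) {K : M.Cell}
    {x : Pt d} (hx : x ∈ interior (simplex K)) :
    divergence (u + v) x = divergence u x + divergence v x := by
  rw [divergence, grad_add hu hv hx, Matrix.trace_add]; rfl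

theorem divergence_smul (u : Pt d → Pt d) (c : ℝ) (x : Pt d) :
    divergence (c • u) x = c * divergence u x := by
  rw [divergence, grad_smul, Matrix.trace_smul]; rfl

variable (M) in
/-- The pairing of the divergence of a velocity with a pressure. -/
noncomputable def divForm : M.velocity →ₗ[ℝ] M.pressure →ₗ[ℝ] ℝ :=
  LinearMap.mk₂ ℝ (fun u p => ∑ K : M.Cell, ∫ x in simplex K, p.1 K x * divergence u.1 x)
    (fun u v p => by
      rw [← Finset.sum_add_distrib]
      refine Finset.sum_congr rfl fun K _ => ?_
      rw [← integral_add (cellContinuous_pressure_mul p.2 u.2 K).integrableOn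
        (cellContinuous_pressure_mul p.2 v.2 K).integrableOn]
      refine setIntegral_simplex_congr fun x hx => ?_
      rw [Submodule.coe_add, divergence_add u.2 v.2 hx, mul_add])
    (fun c u p => by
      rw [smul_eq_mul, Finset.mul_sum]
      refine Finset.sum_congr rfl fun K _ => ?_
      rw [← integral_const_mul]
      refine setIntegral_simplex_congr fun x hx => ?_
      rw [Submodule.coe_smul, divergence_smul]; ring)
    (fun u p q => by
      rw [← Finset.sum_add_distrib]
      refine Finset.sum_congr rfl fun K _ => ?_
      rw [← integral_add (cellContinuous_pressure_mul p.2 u.2 K).integrableOn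
        (cellContinuous_pressure_mul q.2 u.2 K).integrableOn]
      refine setIntegral_simplex_congr fun x hx => ?_
      rw [Submodule.coe_add, Pi.add_apply, Pi.add_apply, add_mul])
    (fun c u p => by
      rw [smul_eq_mul, Finset.mul_sum]
      refine Finset.sum_congr rfl fun K _ => ?_
      rw [← integral_const_mul]
      refine setIntegral_simplex_congr fun x hx => ?_
      rw [Submodule.coe_smul, Pi.smul_apply, Pi.smul_apply, smul_eq_mul]; ring)

theorem divForm_apply (u : M.velocity) (p : M.pressure) :
    M.divForm u p = ∑ K : M.Cell, ∫ x in simplex K, p.1 K x * divergence u.1 x := rfl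

variable (M) in
/-- The discretely divergence-free velocities. -/
noncomputable def solenoidal : Submodule ℝ M.velocity := LinearMap.ker M.divForm

/-- The divergence is itself an admissible pressure test function. Testing with it makes its square
integral vanish on every cell. -/
theorem divergence_eq_zero_of_mem_solenoidal {u : M.velocity} (hu : u ∈ M.solenoidal)
    (K : M.Cell) : ∀ x ∈ interior (simplex K), divergence u.1 x = 0 := by
  choose P hP hP' using fun K : M.Cell => exists_divergence_eq u.2 K
  let p : M.pressure := ⟨fun K => evalPt (P K), fun K => ⟨P K, hP K, fun _ => rfl⟩⟩
  have h1 : M.divForm u p = 0 := by rw [LinearMap.mem_ker.1 hu]; rfl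
  rw [divForm_apply] at h1
  have hsq : ∀ K : M.Cell, ∫ x in simplex K, p.1 K x * divergence u.1 x =
      ∫ x in simplex K, divergence u.1 x * divergence u.1 x := fun K =>
    setIntegral_simplex_congr fun x hx => by
      rw [show p.1 K x = divergence u.1 x from (hP' K x hx).symm]
  simp only [hsq] at h1
  have hnn : ∀ K ∈ Finset.univ, 0 ≤ ∫ x in simplex (M := M) K,
      divergence u.1 x * divergence u.1 x := fun K _ => integral_nonneg fun x => mul_self_nonneg _
  have h2 := (Finset.sum_eq_zero_iff_of_nonneg hnn).1 h1 K (Finset.mem_univ K)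
  intro x hx
  exact mul_self_eq_zero.1 (((cellContinuous_divergence u.2 K).mul
    (cellContinuous_divergence u.2 K)).eq_zero_of_integral_eq_zero
    (fun x _ => mul_self_nonneg _) h2 x hx)

/-- A functional on the velocities that vanishes on the divergence-free ones is represented by a
pressure. -/
theorem exists_pressure (ℓ : M.velocity →ₗ[ℝ] ℝ) (h : ∀ v ∈ M.solenoidal, ℓ v = 0) :
    ∃ p : M.pressure, ∀ v, ℓ v = M.divForm v p := by
  let D : M.pressure →ₗ[ℝ] Module.Dual ℝ M.velocity := M.divForm.flip
  -- The solenoidal space is the coannihilator of the functionals induced by pressures, and in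
  -- finite dimension a subspace of the dual equals its double annihilator. No inf-sup condition is
  -- needed, since no bound or uniqueness is claimed for the pressure.
  have h1 : ℓ ∈ (LinearMap.range D).dualCoannihilator.dualAnnihilator := by
    rw [Submodule.mem_dualAnnihilator]
    intro v hv
    refine h v (LinearMap.mem_ker.2 (LinearMap.ext fun p => ?_))
    exact (Submodule.mem_dualCoannihilator _).1 hv (D p) ⟨p, rfl⟩
  have : FiniteDimensional ℝ (LinearMap.range D) :=
    FiniteDimensional.finiteDimensional_submodule (LinearMap.range D)
  rw [Subspace.dualCoannihilator_dualAnnihilator_eq] at h1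
  obtain ⟨p, hp⟩ := h1
  exact ⟨p, fun v => by rw [← hp]; rfl⟩

/-- The supremum of a velocity is bounded by its stiffness norm. -/
theorem exists_norm_le_sqrt_stiffForm [NeZero d] :
    ∃ C, 0 ≤ C ∧ ∀ (u : M.velocity) (x : Pt d), ‖u.1 x‖ ≤ C * √(M.stiffForm u u) := by
  choose B hB using fun u : M.velocity =>
      (hasCompactSupport_velocity u.2).exists_bound_of_continuous u.2.1
  let f : M.velocity →ₗ[ℝ] BoundedContinuousFunction (Pt d) (Pt d) :=
    { toFun := fun u => BoundedContinuousFunction.ofNormedAddCommGroup u.1 u.2.1 (B u) (hB u)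
      map_add' := fun u v => rfl
      map_smul' := fun c u => rfl }
  obtain ⟨C, hC0, hC⟩ := exists_norm_le_sqrt_of_posDef M.stiffForm stiffForm_comm stiffForm_pos f
  exact ⟨C, hC0, fun u x => ((f u).norm_coe_le_norm x).trans (hC u)⟩

theorem exists_norm_gradIntegral_le [NeZero d] :
    ∃ C, 0 ≤ C ∧ ∀ (K : M.Cell) (u : M.velocity),
      ‖gradIntegral K u‖ ≤ C * √(M.stiffForm u u) := by
  choose C hC0 hC using fun K : M.Cell =>
    exists_norm_le_sqrt_of_posDef M.stiffForm stiffForm_comm stiffForm_pos (gradIntegral K)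
  refine ⟨∑ K, C K, Finset.sum_nonneg fun K _ => hC0 K, fun K u => (hC K u).trans ?_⟩
  exact mul_le_mul_of_nonneg_right
    (Finset.single_le_sum (fun K _ => hC0 K) (Finset.mem_univ K)) (Real.sqrt_nonneg _)

theorem volume_simplex_pos (K : M.Cell) : 0 < volume.real (simplex K) := by
  refine ENNReal.toReal_pos ?_ (isCompact_simplex K).measure_lt_top.ne
  exact ((isOpen_interior.measure_pos volume (interior_simplex_nonempty K)).trans_le
    (measure_mono interior_subset)).ne'

/-- The finite-dimensional structure of the schemes on the divergence-free velocities. -/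
noncomputable def stepForms (M : Mesh d) [NeZero d] {Re Wi ε : ℝ} (hRe : 0 ≤ Re) (hWi : 0 < Wi)
    (hε₀ : 0 < ε) (hε₁ : ε < 1) : StepForms M.Cell M.solenoidal d where
  vol := fun K => volume.real (simplex K)
  vol_pos := volume_simplex_pos
  mass := M.massForm.domRestrict₁₂ M.solenoidal M.solenoidal
  mass_nonneg := fun u => massForm_nonneg u.1
  stiff := M.stiffForm.domRestrict₁₂ M.solenoidal M.solenoidal
  stiff_pos := fun u hu => stiffForm_pos u.1 fun h => hu (Subtype.ext h)
  G := fun K => (gradIntegral K).domRestrict M.solenoidal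
  trace_G := fun K u => by
    rw [LinearMap.domRestrict_apply, trace_gradIntegral,
      setIntegral_simplex_congr (divergence_eq_zero_of_mem_solenoidal u.2 K), integral_zero]
  g := (exists_norm_gradIntegral_le (M := M)).choose
  g_nonneg := (exists_norm_gradIntegral_le (M := M)).choose_spec.1
  norm_G_le := fun K u => (exists_norm_gradIntegral_le (M := M)).choose_spec.2 K u.1
  Re := Re
  Wi := Wi
  ε := ε
  Re_nonneg := hRe
  Wi_pos := hWi
  ε_pos := hε₀
  ε_lt_one := hε₁

end Mesh

end OldroydB

/-! ### Equivalence of the variational formulation and the abstract step -/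

namespace OldroydB

namespace Mesh

variable {d : ℕ} {M : Mesh d}

/-- A linear functional commutes with the entrywise integral over a set. -/
theorem integral_linear_tensor {s : Set (Pt d)} {f : Pt d → Tensor d}
    (hf : ∀ i j, IntegrableOn (fun x => f x i j) s) (ℓ : Tensor d →ₗ[ℝ] ℝ) :
    IntegrableOn (fun x => ℓ (f x)) s ∧
      ∫ x in s, ℓ (f x) = ℓ (Matrix.of fun i j => ∫ x in s, f x i j) := by
  have h : ∀ A : Tensor d, ℓ A = ∑ i, ∑ j, A i j * ℓ (Matrix.single i j 1) := fun A => by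
    conv_lhs => rw [Matrix.matrix_eq_sum_single A]
    simp only [map_sum]
    refine Finset.sum_congr rfl fun i _ => Finset.sum_congr rfl fun j _ => ?_
    rw [← smul_eq_mul, ← map_smul, Matrix.smul_single, smul_eq_mul, mul_one]
  have hi : ∀ i j, IntegrableOn (fun x => f x i j * ℓ (Matrix.single i j 1)) s := fun i j =>
    (hf i j).mul_const _
  constructor
  · simp only [fun x => h (f x)]
    exact integrable_finsetSum _ fun i _ => integrable_finsetSum _ fun j _ => hi i j
  · rw [h (Matrix.of _)]
    simp only [fun x => h (f x)]
    rw [integral_finsetSum _ fun i _ => integrable_finsetSum _ fun j _ => hi i j]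
    refine Finset.sum_congr rfl fun i _ => ?_
    rw [integral_finsetSum _ fun j _ => hi i j]
    refine Finset.sum_congr rfl fun j _ => ?_
    rw [integral_mul_const, Matrix.of_apply]

/-- Since `A` and `Φ` are constant on the cell, the stress terms see the velocities only through the
cell integrals of their gradients, and the transported stress only through its own integral. -/
theorem integral_bulk (Re Wi ε Δt : ℝ) (u₀ u v : M.velocity) (p q : M.pressure) (K : M.Cell)
    (A Φ : Tensor d) {s : Pt d → Tensor d} (hs : ∀ i j, IntegrableOn (fun x => s x i j)
        (simplex K)) :
    ∫ x in simplex K, (bulkIntegrand Re Wi ε Δt u₀ u v (p.1 K) (q.1 K) A Φ x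
        + ddot ((1 / Δt) • (A - s x)) Φ) =
      Re / Δt * ((∫ x in simplex K, inner ℝ (u.1 x) (v.1 x))
        - ∫ x in simplex K, inner ℝ (u₀.1 x) (v.1 x))
      + Re * (∫ x in simplex K, inner ℝ (fderiv ℝ u.1 x (u₀.1 x)) (v.1 x))
      - (∫ x in simplex K, p.1 K x * divergence v.1 x)
      + (∫ x in simplex K, q.1 K x * divergence u.1 x)
      + (1 - ε) * (∫ x in simplex K, ddot (grad u.1 x) (grad v.1 x))
      + ε / Wi * ddot A (gradIntegral K v)
      + ddot ((1 / Δt) • (volume.real (simplex K) • A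
          - Matrix.of fun i j => ∫ x in simplex K, s x i j)
        - (gradIntegral K u * A + A * (gradIntegral K u)ᵀ
          - (volume.real (simplex K) / Wi) • (A - 1))) Φ := by
  have i1 := (cellContinuous_inner u.2 v.2 K).integrableOn.const_mul (Re / Δt)
  have i2 := (cellContinuous_inner u₀.2 v.2 K).integrableOn.const_mul (-(Re / Δt))
  have i3 := (cellContinuous_inner_fderiv u.2 v.2 u₀.2 K).integrableOn.const_mul Re
  have i4 := (cellContinuous_pressure_mul p.2 v.2 K).integrableOn.const_mul (-1)
  have i5 := (cellContinuous_pressure_mul q.2 u.2 K).integrableOn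
  have i6 := (cellContinuous_ddot_grad u.2 v.2 K).integrableOn.const_mul (1 - ε)
  have i7 := integral_linear_tensor (f := grad v.1)
    (fun i j => (cellContinuous_grad v.2 K i j).integrableOn) (ddotL d A)
  let ℓ : Tensor d →ₗ[ℝ] ℝ := (ddotL d).flip Φ ∘ₗ
    (LinearMap.mulRight ℝ A + LinearMap.mulLeft ℝ A ∘ₗ (Matrix.transposeLinearEquiv _ _ ℝ ℝ).toLinearMap)
  have hℓ : ∀ B, ℓ B = ddot (B * A + A * Bᵀ) Φ := fun B => rfl
  have i8 := integral_linear_tensor (f := grad u.1)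
    (fun i j => (cellContinuous_grad u.2 K i j).integrableOn) ℓ
  have i9 := integral_linear_tensor hs ((ddotL d).flip Φ)
  have hfin : IsFiniteMeasure (volume.restrict (simplex K)) :=
    isFiniteMeasure_restrict.2 (isCompact_simplex K).measure_lt_top.ne
  have i10 : IntegrableOn (fun _ : Pt d => 1 / Wi * ddot (A - 1) Φ + 1 / Δt * ddot A Φ)
    (simplex K) := integrable_const _
  simp only [ddotL_apply, hℓ, LinearMap.flip_apply] at i7 i8 i9
  have i7' := i7.1.const_mul (ε / Wi)
  have i8' := i8.1.const_mul (-1)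
  have i9' := i9.1.const_mul (-(1 / Δt))
  have e : ∀ x, bulkIntegrand Re Wi ε Δt u₀ u v (p.1 K) (q.1 K) A Φ x
        + ddot ((1 / Δt) • (A - s x)) Φ =
      Re / Δt * inner ℝ (u.1 x) (v.1 x) + -(Re / Δt) * inner ℝ (u₀.1 x) (v.1 x)
      + Re * inner ℝ (fderiv ℝ u.1 x (u₀.1 x)) (v.1 x)
      + -1 * (p.1 K x * divergence v.1 x) + q.1 K x * divergence u.1 x
      + (1 - ε) * ddot (grad u.1 x) (grad v.1 x) + ε / Wi * ddot A (grad v.1 x)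
      + -1 * ddot (grad u.1 x * A + A * (grad u.1 x)ᵀ) Φ
      + -(1 / Δt) * ddot (s x) Φ + (1 / Wi * ddot (A - 1) Φ + 1 / Δt * ddot A Φ) := fun x => by
    simp only [bulkIntegrand, inner_add_left, real_inner_smul_left, inner_sub_left,
      ddot_smul_left, ddot_sub_left, ddot_add_left]
    ring
  have j2 := i1.fun_add i2
  have j3 := j2.fun_add i3
  have j4 := j3.fun_add i4
  have j5 := j4.fun_add i5
  have j6 := j5.fun_add i6
  have j7 := j6.fun_add i7'
  have j8 := j7.fun_add i8'
  have j9 := j8.fun_add i9'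
  simp only [e]
  rw [integral_add j9 i10, integral_add j8 i9', integral_add j7 i8', integral_add j6 i7',
    integral_add j5 i6, integral_add j4 i5, integral_add j3 i4, integral_add j2 i3,
    integral_add i1 i2]
  simp only [integral_const_mul, i7.2, i8.2, i9.2, setIntegral_const, smul_eq_mul]
  have g1 : (Matrix.of fun i j => ∫ x in simplex K, grad v.1 x i j) = gradIntegral K v := rfl
  have g2 : (Matrix.of fun i j => ∫ x in simplex K, grad u.1 x i j) = gradIntegral K u := rfl
  rw [g1, g2]
  simp only [ddot_smul_left, ddot_sub_left, ddot_add_left]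
  ring

/-- The common form of the discrete variational formulations: `s K` is the transported stress in
the cell `K` and `b` are the upwind weights. -/
def StepEq (Re Wi ε Δt : ℝ) (u₀ : Pt d → Pt d) (s : M.Cell → Pt d → Tensor d)
    (b : M.Cell → M.Cell → ℝ) (u : Pt d → Pt d) (p : M.Cell → Pt d → ℝ)
    (σ : M.Cell → Tensor d) : Prop :=
  ∀ v ∈ M.velocitySpace, ∀ q ∈ M.pressureSpace, ∀ φ ∈ M.stressSpace,
    0 = (∑ K : M.Cell, ∫ x in simplex K,
        (bulkIntegrand Re Wi ε Δt u₀ u v (p K) (q K) (σ K) (φ K) x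
          + ddot ((1 / Δt) • (σ K - s K x)) (φ K)))
      + ∑ K, ∑ L, b K L * ddot (σ K - σ L) (φ K)

/-- On the diagonal the convection form only sees the divergence of `w`, which is bounded on each
cell; the factor `1 / 2` is given away. -/
theorem exists_conv_lower (w : M.velocity) :
    ∃ κ : ℝ, 0 ≤ κ ∧ ∀ u, -(κ * M.massForm u u) ≤ convForm w u u := by
  have h : ∀ K : M.Cell, ∃ B, 0 ≤ B ∧ ∀ x ∈ interior (simplex K), divergence w.1 x ≤ B := fun K =>
      by
    obtain ⟨g, hg, hg'⟩ := cellContinuous_divergence w.2 K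
    obtain ⟨B, hB⟩ := (isCompact_simplex K).exists_bound_of_continuousOn hg.continuousOn
    refine ⟨|B|, abs_nonneg B, fun x hx => ?_⟩
    rw [hg' x hx]
    exact (le_abs_self _).trans ((hB x (interior_subset hx)).trans (le_abs_self B))
  choose B hB0 hB using h
  have hsum : ∀ K, B K ≤ ∑ K, B K := fun K =>
    Finset.single_le_sum (fun K _ => hB0 K) (Finset.mem_univ K)
  refine ⟨∑ K, B K, Finset.sum_nonneg fun K _ => hB0 K, fun u => ?_⟩
  rw [convForm_apply, sum_integral_convection u.2 w.2, neg_le_neg_iff, massForm_self,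
      Finset.mul_sum]
  refine Finset.sum_le_sum fun K _ => ?_
  have h1 : CellContinuous K (fun x => 1 / 2 * ‖u.1 x‖ ^ 2) :=
    .of_continuous (by have := u.2.1; fun_prop)
  have h2 : CellContinuous K (fun x => ‖u.1 x‖ ^ 2) :=
    .of_continuous (by have := u.2.1; fun_prop)
  rw [← integral_const_mul, ← setIntegral_congr_set (interior_ae_eq_simplex K),
    ← setIntegral_congr_set (interior_ae_eq_simplex K)]
  refine setIntegral_mono_on
    ((h1.mul (cellContinuous_divergence w.2 K)).integrableOn.mono_set interior_subset)
    ((h2.const_mul _).integrableOn.mono_set interior_subset) isOpen_interior.measurableSet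
    fun x hx => ?_
  have h3 := (hB K x hx).trans (hsum K)
  have h4 : 0 ≤ ‖u.1 x‖ ^ 2 := by positivity
  have h5 := mul_le_mul_of_nonneg_left h3 h4
  have h6 := mul_nonneg ((hB0 K).trans (hsum K)) h4
  linarith

theorem convForm_self_of_solenoidal {w : M.velocity} (hw : w ∈ M.solenoidal) (u : M.velocity) :
    convForm w u u = 0 := by
  rw [convForm_apply, sum_integral_convection u.2 w.2, neg_eq_zero]
  refine Finset.sum_eq_zero fun K _ => ?_
  rw [setIntegral_simplex_congr (g := fun _ => (0 : ℝ)) fun x hx => by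
    rw [divergence_eq_zero_of_mem_solenoidal hw K x hx, mul_zero], integral_zero]

section Step

variable [NeZero d] {Re Wi ε : ℝ} {hRe : 0 ≤ Re} {hWi : 0 < Wi} {hε₀ : 0 < ε} {hε₁ : ε < 1}

/-- The transport data of a step are realized by the transported stress `s`. -/
structure Realizes (I : StepInput (M.stepForms hRe hWi hε₀ hε₁)) (u₀ : M.velocity)
    (s : M.Cell → Pt d → Tensor d) : Prop where
  load_eq : ∀ v, I.load v = M.massForm u₀ v.1
  conv_eq : ∀ u v, I.conv u v = convForm u₀ u.1 v.1
  integrable : ∀ K i j, IntegrableOn (fun x => s K x i j) (simplex K)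
  integral_eq : ∀ K, (Matrix.of fun i j => ∫ x in simplex K, s K x i j) = ∑ L, I.m K L • I.σ L

/-- The residual of the momentum equation as a functional on all discrete velocities. -/
noncomputable def momentumResidual (Re Wi ε Δt : ℝ) (u₀ u : M.velocity) (σ : M.Cell → Tensor d) :
    M.velocity →ₗ[ℝ] ℝ :=
  (Re / Δt) • (M.massForm u - M.massForm u₀) + Re • convForm u₀ u + (1 - ε) • M.stiffForm u
    + (ε / Wi) • ∑ K, ddotL d (σ K) ∘ₗ gradIntegral K

variable {I : StepInput (M.stepForms hRe hWi hε₀ hε₁)} {u₀ : M.velocity}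
  {s : M.Cell → Pt d → Tensor d}

/-- The formulation splits into a momentum residual, two pressure pairings and a stress residual in
each cell, so that the three test functions can be varied separately. -/
theorem sum_integral_bulk_eq (hI : Realizes I u₀ s) (Δt : ℝ) (u v : M.velocity) (p q : M.pressure)
    (σ φ : M.Cell → Tensor d) :
    (∑ K : M.Cell, ∫ x in simplex K,
        (bulkIntegrand Re Wi ε Δt u₀ u v (p.1 K) (q.1 K) (σ K) (φ K) x
          + ddot ((1 / Δt) • (σ K - s K x)) (φ K)))
      + ∑ K, ∑ L, I.b K L * ddot (σ K - σ L) (φ K) =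
    momentumResidual Re Wi ε Δt u₀ u σ v - M.divForm v p + M.divForm u q
      + ∑ K, ddot ((1 / Δt) • (volume.real (simplex K) • σ K - ∑ L, I.m K L • I.σ L)
        - (gradIntegral K u * σ K + σ K * (gradIntegral K u)ᵀ - ∑ L, I.b K L • (σ K - σ L)
          - (volume.real (simplex K) / Wi) • (σ K - 1))) (φ K) := by
  have h : ∀ K, ddot ((1 / Δt) • (volume.real (simplex K) • σ K - ∑ L, I.m K L • I.σ L)
        - (gradIntegral K u * σ K + σ K * (gradIntegral K u)ᵀ - ∑ L, I.b K L • (σ K - σ L)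
          - (volume.real (simplex K) / Wi) • (σ K - 1))) (φ K) =
      ddot ((1 / Δt) • (volume.real (simplex K) • σ K - ∑ L, I.m K L • I.σ L)
        - (gradIntegral K u * σ K + σ K * (gradIntegral K u)ᵀ
          - (volume.real (simplex K) / Wi) • (σ K - 1))) (φ K)
        + ∑ L, I.b K L * ddot (σ K - σ L) (φ K) := fun K => by
    have e : ∑ L, I.b K L * ddot (σ K - σ L) (φ K) =
        ddot (∑ L, I.b K L • (σ K - σ L)) (φ K) := by
      rw [ddot_sum_left]; simp only [ddot_smul_left]
    rw [e, ← ddot_add_left]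
    congr 1
    abel
  simp only [h, fun K => integral_bulk Re Wi ε Δt u₀ u v p q K (σ K) (φ K) (hI.integrable K),
    hI.integral_eq]
  simp only [Finset.sum_add_distrib, Finset.sum_sub_distrib, ← Finset.mul_sum]
  simp only [momentumResidual, LinearMap.add_apply, LinearMap.smul_apply, LinearMap.sub_apply,
    LinearMap.sum_apply, LinearMap.comp_apply, ddotL_apply, massForm_apply, convForm_apply,
    stiffForm_apply, divForm_apply, smul_eq_mul]
  ring

/-- Varying `q` alone gives the divergence constraint, and a solenoidal `v` removes the pressure.
The stress residual is symmetric, so it may be its own test function; its squared norm is then zero.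
-/
theorem StepEq.mem_solenoidal_and_isSol (hI : Realizes I u₀ s) {Δt : ℝ}
    {u : M.velocity} {p : M.pressure} {σ : M.Cell → Tensor d} (hσ : σ ∈ M.stressSpace)
    (h : StepEq Re Wi ε Δt u₀ s I.b u p.1 σ) :
    ∃ hu : u ∈ M.solenoidal, (M.stepForms hRe hWi hε₀ hε₁).IsSol I Δt ⟨u, hu⟩ σ := by
  have key : ∀ (v : M.velocity) (q : M.pressure), ∀ φ ∈ M.stressSpace,
      momentumResidual Re Wi ε Δt u₀ u σ v - M.divForm v p + M.divForm u q
      + ∑ K, ddot ((1 / Δt) • (volume.real (simplex K) • σ K - ∑ L, I.m K L • I.σ L)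
        - (gradIntegral K u * σ K + σ K * (gradIntegral K u)ᵀ - ∑ L, I.b K L • (σ K - σ L)
          - (volume.real (simplex K) / Wi) • (σ K - 1))) (φ K) = 0 :=
    fun v q φ hφ => (sum_integral_bulk_eq hI Δt u v p q σ φ).symm.trans
      (h v.1 v.2 q.1 q.2 φ hφ).symm
  have h0 : (0 : M.Cell → Tensor d) ∈ M.stressSpace := fun K => Matrix.isSymm_zero
  have hz : ∀ A : Tensor d, ddot A 0 = 0 := fun A => (ddotL d A).map_zero
  have hu : u ∈ M.solenoidal := LinearMap.mem_ker.2 (LinearMap.ext fun q => by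
    have := key 0 q 0 h0
    simpa [hz] using this)
  refine ⟨hu, fun v => ?_, fun K => ?_⟩
  · have := key v.1 0 0 h0
    have hv : M.divForm v.1 p = 0 := by rw [LinearMap.mem_ker.1 v.2]; rfl
    simp only [Pi.zero_apply, hz, Finset.sum_const_zero, hv, map_zero] at this
    simp only [momentumResidual, LinearMap.add_apply, LinearMap.smul_apply, LinearMap.sub_apply,
      LinearMap.sum_apply, LinearMap.comp_apply, ddotL_apply, smul_eq_mul] at this
    rw [hI.load_eq, hI.conv_eq]
    change Re / Δt * (M.massForm u v.1 - M.massForm u₀ v.1) + Re * convForm u₀ u v.1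
      + (1 - ε) * M.stiffForm u v.1 + ε / Wi * ∑ K, ddot (σ K) (gradIntegral K v.1) = 0
    linarith
  · let S := M.stepForms hRe hWi hε₀ hε₁
    let R : M.Cell → Tensor d := fun K =>
      (1 / Δt) • (S.vol K • σ K - ∑ L, I.m K L • I.σ L) - S.rate I ⟨u, hu⟩ σ K
    have hRs : R ∈ M.stressSpace := fun K => by
      have h1 : (∑ L, I.m K L • I.σ L).IsSymm := by
        rw [Matrix.IsSymm, Matrix.transpose_sum]
        refine Finset.sum_congr rfl fun L _ => ?_
        have : (I.σ L)ᵀ = I.σ L := (I.σ_posDef L).1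
        rw [Matrix.transpose_smul, this]
      exact ((((hσ K).smul _).sub h1).smul _).sub (StepForms.isSymm_rate I _ hσ K)
    have h1 := key 0 0 R hRs
    simp only [map_zero, LinearMap.zero_apply, sub_zero, zero_add] at h1
    change ∑ K, ddot (R K) (R K) = 0 at h1
    have h2 := (Finset.sum_eq_zero_iff_of_nonneg fun K _ => ddot_self_nonneg (R K)).1 h1 K
      (Finset.mem_univ K)
    rw [ddot_self_eq_norm_sq] at h2
    exact norm_eq_zero.1 (pow_eq_zero_iff two_ne_zero |>.1 h2)

theorem exists_pressure_stepEq (hI : Realizes I u₀ s) {Δt : ℝ} {u : M.solenoidal}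
    {σ : M.Cell → Tensor d} (h : (M.stepForms hRe hWi hε₀ hε₁).IsSol I Δt u σ) :
    ∃ p : M.pressure, StepEq Re Wi ε Δt u₀ s I.b u.1 p.1 σ := by
  obtain ⟨p, hp⟩ := exists_pressure (momentumResidual Re Wi ε Δt u₀ u.1 σ) fun v hv => by
    have := h.1 ⟨v, hv⟩
    rw [hI.load_eq, hI.conv_eq] at this
    change Re / Δt * (M.massForm u v - M.massForm u₀ v) + Re * convForm u₀ u v
      + (1 - ε) * M.stiffForm u v + ε / Wi * ∑ K, ddot (σ K) (gradIntegral K v) = 0 at this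
    simp only [momentumResidual, LinearMap.add_apply, LinearMap.smul_apply, LinearMap.sub_apply,
      LinearMap.sum_apply, LinearMap.comp_apply, ddotL_apply, smul_eq_mul]
    linarith
  refine ⟨p, fun v hv q hq φ _ => ?_⟩
  have := sum_integral_bulk_eq hI Δt u.1 ⟨v, hv⟩ p ⟨q, hq⟩ σ φ
  refine Eq.trans ?_ this.symm
  have h1 : M.divForm u.1 ⟨q, hq⟩ = 0 := by rw [LinearMap.mem_ker.1 u.2]; rfl
  have h2 : ∀ K, ddot ((1 / Δt) • (volume.real (simplex K) • σ K - ∑ L, I.m K L • I.σ L)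
        - (gradIntegral K u.1 * σ K + σ K * (gradIntegral K u.1)ᵀ - ∑ L, I.b K L • (σ K - σ L)
          - (volume.real (simplex K) / Wi) • (σ K - 1))) (φ K) = 0 := fun K => by
    have e := congrArg (fun A => ddot A (φ K)) (h.2 K)
    refine Eq.trans e ?_
    simp [ddot]
  rw [hp, h1, Finset.sum_congr rfl fun K _ => h2 K]
  simp

end Step

end Mesh

end OldroydB

/-! ### Global flows of bounded Lipschitz fields -/

namespace OldroydB

section Flow

variable {E : Type*} [NormedAddCommGroup E] [NormedSpace ℝ E] {u : E → E} {C : NNReal}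

/-- `Φ` is the global flow of the vector field `u`. -/
structure IsFlow (u : E → E) (Φ : ℝ → E → E) : Prop where
  zero : ∀ x, Φ 0 x = x
  deriv : ∀ x t, HasDerivAt (fun s => Φ s x) (u (Φ t x)) t

/-- Picard–Lindelöf on `[-(N+1), N+1]` applies for every `N`, because bounded speed keeps
trajectories in a ball of radius `B * (N + 1)`. The solutions agree where they overlap and are
patched together. -/
theorem exists_isFlow [CompleteSpace E] (hu : LipschitzWith C u) {B : ℝ} (hB : ∀ x, ‖u x‖ ≤ B) :
    ∃ Φ, IsFlow u Φ := by
  have hB0 : 0 ≤ B := (norm_nonneg _).trans (hB 0)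
  have h : ∀ (N : ℕ) (x : E), ∃ α : ℝ → E, α 0 = x ∧
      ∀ t ∈ Set.Icc (-((N : ℝ) + 1)) (N + 1), HasDerivWithinAt α (u (α t))
          (Set.Icc (-((N : ℝ) + 1)) (N + 1)) t := by
    intro N x
    have h0 : (0 : ℝ) ∈ Set.Icc (-((N : ℝ) + 1)) (N + 1) := ⟨by linarith [N.cast_nonneg (α := ℝ)],
        by positivity⟩
    refine IsPicardLindelof.exists_eq_forall_mem_Icc_hasDerivWithinAt₀ (f := fun _ => u)
      (t₀ := ⟨0, h0⟩) (a := ⟨B * (N + 1), by positivity⟩) (L := ⟨B, hB0⟩) (K := C)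
      (.of_time_independent (fun y _ => hB y) hu.lipschitzOnWith ?_)
    simp only [sub_zero, zero_sub, neg_neg, max_self, NNReal.coe_zero]
    exact le_rfl
  choose α h0 hα using h
  have hd : ∀ (N : ℕ) x t, t ∈ Set.Ioo (-((N : ℝ) + 1)) (N + 1) → HasDerivAt (α N x)
      (u (α N x t)) t :=
    fun N x t ht => (hα N x t (Set.Ioo_subset_Icc_self ht)).hasDerivAt (Icc_mem_nhds ht.1 ht.2)
  have heq : ∀ N N' : ℕ, N ≤ N' → ∀ x, ∀ t ∈ Set.Ioo (-((N : ℝ) + 1)) (N + 1), α N x t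
      = α N' x t := by
    intro N N' hN x
    have hN' : (N : ℝ) ≤ N' := by exact_mod_cast hN
    refine ODE_solution_unique_of_mem_Ioo (v := fun _ => u) (s := fun _ => Set.univ) (K := C)
        (t₀ := 0)
      (fun t _ => hu.lipschitzOnWith) ⟨by linarith [N.cast_nonneg (α := ℝ)], by positivity⟩
      (fun t ht => ⟨hd N x t ht, trivial⟩)
      (fun t ht => ⟨hd N' x t ⟨by linarith [ht.1], by linarith [ht.2]⟩, trivial⟩) ?_
    rw [h0, h0]
  have hmem : ∀ t : ℝ, ∀ N : ℕ, |t| ≤ N → t ∈ Set.Ioo (-((N : ℝ) + 1)) (N + 1) := fun t N h =>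
    ⟨by linarith [neg_abs_le t], by linarith [le_abs_self t]⟩
  have hev : ∀ x t, (fun s => α ⌈|s|⌉₊ x s) =ᶠ[𝓝 t] α (⌈|t|⌉₊ + 1) x := fun x t => by
    filter_upwards [Metric.ball_mem_nhds t one_pos] with s hs
    rw [Metric.mem_ball, Real.dist_eq] at hs
    refine heq _ _ ?_ x s (hmem _ _ (Nat.le_ceil _))
    refine Nat.ceil_le.2 ?_
    push_cast
    have := abs_add_le (s - t) t
    rw [sub_add_cancel] at this
    linarith [Nat.le_ceil |t|]
  -- The index depends on `t`, but near `t` the function agrees with the single solution of index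
  -- `⌈|t|⌉₊ + 1`, which is differentiable there.
  refine ⟨fun t x => α ⌈|t|⌉₊ x t, fun x => ?_, fun x t => ?_⟩
  · simpa using h0 0 x
  · have h1 := hd (⌈|t|⌉₊ + 1) x t (hmem _ _ (by push_cast; linarith [Nat.le_ceil |t|]))
    have h2 := h1.congr_of_eventuallyEq (hev x t)
    rwa [← (hev x t).eq_of_nhds] at h2

namespace IsFlow

variable {Φ : ℝ → E → E}

theorem eq_of_hasDerivAt (h : IsFlow u Φ) (hu : LipschitzWith C u) {α : ℝ → E}
    (hα : ∀ t, HasDerivAt α (u (α t)) t) (t : ℝ) : α t = Φ t (α 0) :=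
  congrFun (ODE_solution_unique_univ (v := fun _ => u) (s := fun _ => Set.univ) (K := C) (t₀ := 0)
    (fun _ => hu.lipschitzOnWith) (fun t => ⟨hα t, trivial⟩) (fun t => ⟨h.deriv (α 0) t, trivial⟩)
    (h.zero _).symm) t

theorem add (h : IsFlow u Φ) (hu : LipschitzWith C u) (s t : ℝ) (x : E) :
    Φ (s + t) x = Φ s (Φ t x) := by
  have := h.eq_of_hasDerivAt hu (α := fun s => Φ (s + t) x)
    (fun r => (h.deriv x (r + t)).comp_add_const r t) s
  simpa using this

theorem neg_apply (h : IsFlow u Φ) (hu : LipschitzWith C u) (t : ℝ) (x : E) : Φ (-t) (Φ t x) = x :=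
    by
  rw [← h.add hu, neg_add_cancel, h.zero]

theorem apply_of_eq_zero (h : IsFlow u Φ) (hu : LipschitzWith C u) {x : E} (hx : u x = 0) (t : ℝ) :
    Φ t x = x :=
  (h.eq_of_hasDerivAt hu (α := fun _ => x) (fun r => by
    rw [hx]; exact hasDerivAt_const r x) t).symm

theorem neg (h : IsFlow u Φ) : IsFlow (-u) (fun t => Φ (-t)) where
  zero x := by rw [neg_zero, h.zero]
  deriv x t := by
    have := (h.deriv x (-t)).scomp t (hasDerivAt_neg t)
    rw [neg_one_smul] at this
    exact this

theorem dist_le_of_nonneg (h : IsFlow u Φ) (hu : LipschitzWith C u) {t : ℝ} (ht : 0 ≤ t) (x y : E) :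
    dist (Φ t x) (Φ t y) ≤ dist x y * Real.exp (C * t) := by
  have hc : ∀ x, Continuous fun s => Φ s x := fun x =>
    continuous_iff_continuousAt.2 fun s => (h.deriv x s).continuousAt
  have := dist_le_of_trajectories_ODE (v := fun _ => u) (K := C) (a := 0) (b := t) (fun _ => hu)
    (hc x).continuousOn (fun s _ => (h.deriv x s).hasDerivWithinAt) (hc y).continuousOn
    (fun s _ => (h.deriv y s).hasDerivWithinAt) (δ := dist x y) (by rw [h.zero, h.zero])
    t ⟨ht, le_rfl⟩
  rwa [sub_zero] at this

theorem exists_lipschitzWith (h : IsFlow u Φ) (hu : LipschitzWith C u) (t : ℝ) :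
    ∃ B, LipschitzWith B (Φ t) := by
  refine ⟨⟨Real.exp (C * |t|), (Real.exp_pos _).le⟩, LipschitzWith.of_dist_le_mul fun x y => ?_⟩
  rw [mul_comm]
  rcases le_total 0 t with ht | ht
  · change _ ≤ dist x y * Real.exp (C * |t|)
    rw [abs_of_nonneg ht]
    exact h.dist_le_of_nonneg hu ht x y
  · have := h.neg.dist_le_of_nonneg hu.neg (neg_nonneg.2 ht) x y
    change _ ≤ dist x y * Real.exp (C * |t|)
    rw [abs_of_nonpos ht]
    simpa only [neg_neg] using this

theorem lipschitzWith_time (h : IsFlow u Φ) {B : NNReal} (hB : ∀ x, ‖u x‖ ≤ B) (x : E) :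
    LipschitzWith B (fun t => Φ t x) := by
  refine lipschitzWith_of_nnnorm_deriv_le (fun t => (h.deriv x t).differentiableAt) fun t => ?_
  rw [(h.deriv x t).deriv]
  exact hB _

end IsFlow

end Flow

/-- Preimages of null sets under a map with a Lipschitz left inverse are null. -/
theorem volume_preimage_eq_zero {d : ℕ} {f g : Pt d → Pt d} {C : NNReal} (hg : LipschitzWith C g)
    (h : ∀ x, g (f x) = x) {s : Set (Pt d)} (hs : volume s = 0) : volume (f ⁻¹' s) = 0 := by
  let μ : Measure (Pt d) := Measure.hausdorffMeasure (Module.finrank ℝ (Pt d))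
  have h1 : μ s = 0 := Measure.absolutelyContinuous_isAddHaarMeasure μ volume hs
  have h2 := hg.hausdorffMeasure_image_le (d := Module.finrank ℝ (Pt d)) (Nat.cast_nonneg _) s
  have h3 : μ (g '' s) = 0 := by
    refine le_antisymm (h2.trans ?_) zero_le
    rw [show Measure.hausdorffMeasure (Module.finrank ℝ (Pt d) : ℝ) s = 0 from h1, mul_zero]
  refine measure_mono_null (fun x hx => ?_)
      (Measure.absolutelyContinuous_isAddHaarMeasure volume μ h3)
  exact ⟨f x, hx, h x⟩

end OldroydB

/-! ### Transport of cells by the flow and volume preservation -/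

namespace OldroydB

namespace Mesh

variable {d : ℕ} {M : Mesh d}

theorem exists_isFlow_velocity (u : M.velocity) : ∃ Φ, IsFlow u.1 Φ := by
  obtain ⟨C, hC⟩ := exists_lipschitzWith u.2
  obtain ⟨B, -, hB⟩ := exists_norm_le u.2
  exact exists_isFlow hC hB

/-- Points outside the domain are stationary, since the velocity vanishes there. A trajectory that
left the domain could not be traced back to its start. -/
theorem flow_mem_domain {u : M.velocity} {Φ : ℝ → Pt d → Pt d} (h : IsFlow u.1 Φ) (t : ℝ) {x : Pt d}
    (hx : x ∈ M.domain) : Φ t x ∈ M.domain := by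
  obtain ⟨C, hC⟩ := exists_lipschitzWith u.2
  by_contra hcon
  have h1 := h.apply_of_eq_zero hC (eq_zero_of_notMem_domain u.2 hcon) (-t)
  rw [h.neg_apply hC] at h1
  exact hcon (h1 ▸ hx)

theorem isBackwardFlow_of_isFlow {u : M.velocity} {Φ : ℝ → Pt d → Pt d} (h : IsFlow u.1 Φ)
    (s t : ℝ) : M.IsBackwardFlow u s t (fun r => Φ (r - t)) := fun x hx => by
  refine ⟨by simp [h.zero], fun τ _ => ⟨flow_mem_domain h _ hx, ?_⟩⟩
  exact ((h.deriv x (τ - t)).comp_sub_const τ t).hasDerivWithinAt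

/-- By uniqueness for ordinary differential equations, the existential quantifier over backward
flows in the scheme leaves no freedom on the domain. -/
theorem IsBackwardFlow.eq_flow {u : M.velocity} {Φ : ℝ → Pt d → Pt d} (h : IsFlow u.1 Φ)
    {s t : ℝ} (hst : s ≤ t) {X : ℝ → Pt d → Pt d} (hX : M.IsBackwardFlow u s t X) {x : Pt d}
    (hx : x ∈ M.domain) : X s x = Φ (s - t) x := by
  obtain ⟨C, hC⟩ := exists_lipschitzWith u.2
  have h1 := isBackwardFlow_of_isFlow h s t x hx
  have h2 := hX x hx
  refine ODE_solution_unique_of_mem_Icc_left (v := fun _ => u.1) (s := fun _ => Set.univ) (K := C)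
    (f := fun r => X r x) (g := fun r => Φ (r - t) x) (a := s) (b := t)
    (fun _ _ => hC.lipschitzOnWith)
    (fun r hr => (h2.2 r hr).2.continuousWithinAt)
    (fun r hr => (h2.2 r (Set.Ioc_subset_Icc_self hr)).2.mono_of_mem_nhdsWithin ?_)
    (fun _ _ => trivial)
    (fun r hr => (h1.2 r hr).2.continuousWithinAt)
    (fun r hr => (h1.2 r (Set.Ioc_subset_Icc_self hr)).2.mono_of_mem_nhdsWithin ?_)
    (fun _ _ => trivial) (h2.1.trans h1.1.symm) ⟨le_rfl, hst⟩
  all_goals exact Icc_mem_nhdsLE_of_mem hr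

/-- Along the flow of a divergence-free velocity, integrals over the mesh are conserved. -/
theorem setIntegral_comp_flow {u : M.velocity} (hu : u ∈ M.solenoidal) {Φ : ℝ → Pt d → Pt d}
    (h : IsFlow u.1 Φ) {f : Pt d → ℝ} {B : NNReal} (hf : LipschitzWith B f) (t : ℝ) :
    ∫ x in ⋃ K : M.Cell, simplex K, f (Φ t x) = ∫ x in ⋃ K : M.Cell, simplex K, f x := by
  obtain ⟨C, hC⟩ := exists_lipschitzWith u.2
  obtain ⟨N, hN0, hN⟩ := exists_norm_le u.2
  have hfin : IsFiniteMeasure (volume.restrict (⋃ K : M.Cell, simplex K)) :=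
    isFiniteMeasure_restrict.2 (isCompact_union M).measure_lt_top.ne
  have hd : ∀ t, HasDerivAt (fun t => ∫ x in ⋃ K : M.Cell, simplex K, f (Φ t x)) 0 t := by
    intro t
    obtain ⟨D, hD⟩ := h.exists_lipschitzWith hC t
    have hF : LipschitzWith (B * D) (fun x => f (Φ t x)) := hf.comp hD
    have hdiff : ∀ᵐ x ∂volume, DifferentiableAt ℝ (fun x => f (Φ t x)) x :=
      hF.ae_differentiableAt
    have hmeas : ∀ s, AEStronglyMeasurable (fun x => f (Φ s x))
        (volume.restrict (⋃ K : M.Cell, simplex K)) := fun s => by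
      obtain ⟨D, hD⟩ := h.exists_lipschitzWith hC s
      exact (hf.comp hD).continuous.aestronglyMeasurable
    have hN' : ∀ x, ‖u.1 x‖ ≤ (⟨N, hN0⟩ : NNReal) := hN
    -- Since `Φ (t + r) = Φ t ∘ Φ r`, the derivative at `r = 0` is that of `f ∘ Φ t` in the
    -- direction of `u`. It exists almost everywhere by Rademacher's theorem and integrates to zero
    -- by parts, as `u` is divergence-free.
    have key := hasDerivAt_integral_of_dominated_loc_of_lip
      (μ := volume.restrict (⋃ K : M.Cell, simplex K)) (F := fun r x => f (Φ (t + r) x))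
      (F' := fun x => fderiv ℝ (fun x => f (Φ t x)) x (u.1 x)) (x₀ := (0 : ℝ)) (s := Set.univ)
      (bound := fun _ => ((B * ⟨N, hN0⟩ : NNReal) : ℝ)) Filter.univ_mem
      (.of_forall fun r => hmeas _) ?_ ?_ (.of_forall fun x => ?_) (integrable_const _) ?_
    · have h1 : ∫ x in ⋃ K : M.Cell, simplex K, fderiv ℝ (fun x => f (Φ t x)) x (u.1 x) = 0 := by
        rw [setIntegral_eq_integral_of_forall_compl_eq_zero fun x hx => by
          rw [eq_zero_of_notMem_union u.2 hx, map_zero],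
          integral_fderiv_apply_velocity u.2 hF, neg_eq_zero]
        refine Finset.sum_eq_zero fun K _ => ?_
        rw [setIntegral_simplex_congr (g := fun _ => (0 : ℝ)) fun x hx => by
          rw [divergence_eq_zero_of_mem_solenoidal hu K x hx, mul_zero], integral_zero]
      have h2 := key.2
      rw [h1] at h2
      have h3 := HasDerivAt.comp_sub_const (f := fun r => ∫ x in ⋃ K : M.Cell, simplex K,
          f (Φ (t + r) x))
        (f' := 0) t t (by rwa [sub_self])
      simpa using h3
    · simp only [add_zero]
      exact (hF.continuous.continuousOn.integrableOn_compact (isCompact_union M))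
    · refine (Measurable.aestronglyMeasurable ?_)
      have h1 : Measurable (fderiv ℝ (fun x => f (Φ t x))) := measurable_fderiv ℝ _
      have h2 : Measurable fun x => (fderiv ℝ (fun x => f (Φ t x)) x, u.1 x) :=
        h1.prodMk u.2.1.measurable
      exact (isBoundedBilinearMap_apply (𝕜 := ℝ)).continuous.measurable.comp h2
    · have h1 := hf.comp (h.lipschitzWith_time hN' x)
      have h2 : LipschitzWith (B * ⟨N, hN0⟩ * 1) (fun r => f (Φ (t + r) x)) :=
        h1.comp (LipschitzWith.of_dist_le_mul fun r r' => by simp)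
      rw [mul_one] at h2
      rw [Real.nnabs_coe]
      exact h2.lipschitzOnWith
    · refine ae_restrict_of_ae (hdiff.mono fun x hx => ?_)
      have h1 := hx.hasFDerivAt
      have h2 := h.deriv x 0
      rw [h.zero] at h2
      have h3 : HasFDerivAt (fun x => f (Φ t x)) (fderiv ℝ (fun x => f (Φ t x)) x) (Φ 0 x) := by
        rw [h.zero]; exact h1
      have h4 := h3.comp_hasDerivAt (0 : ℝ) h2
      refine h4.congr_of_eventuallyEq (.of_forall fun r => ?_)
      simp only [Function.comp, h.add hC]
  have := is_const_of_deriv_eq_zero (fun t => (hd t).differentiableAt) (fun t => (hd t).deriv) t 0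
  simpa only [h.zero] using this

/-- The volume of the part of the cell `K` that the map `Y` sends into the cell `L`. -/
noncomputable def transfer (Y : Pt d → Pt d) (K L : M.Cell) : ℝ :=
  volume.real (simplex K ∩ Y ⁻¹' interior (simplex L))

theorem transfer_nonneg (Y : Pt d → Pt d) (K L : M.Cell) : 0 ≤ transfer Y K L := measureReal_nonneg

theorem volume_union_diff_interior :
    volume ((⋃ K : M.Cell, simplex K) \ ⋃ K : M.Cell, interior (simplex K)) = 0 := by
  refine measure_mono_null (t := ⋃ K : M.Cell, simplex K \ interior (simplex K)) (fun x hx => ?_)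
    (measure_iUnion_null fun K => (ae_eq_set.1 (interior_ae_eq_simplex K)).2)
  obtain ⟨K, hK⟩ := Set.mem_iUnion.1 hx.1
  exact Set.mem_iUnion.2 ⟨K, hK, fun h => hx.2 (Set.mem_iUnion.2 ⟨K, h⟩)⟩

theorem pairwise_disjoint_preimage (Y : Pt d → Pt d) (s : Set (Pt d)) :
    Pairwise (Function.onFun Disjoint fun L : M.Cell => s ∩ Y ⁻¹' interior (simplex L)) :=
  fun _ _ hLL' => ((disjoint_interior hLL').preimage Y).mono
    Set.inter_subset_right Set.inter_subset_right

section

variable {u : M.velocity} {Φ : ℝ → Pt d → Pt d} (h : IsFlow u.1 Φ) (t : ℝ)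
include h

theorem continuous_flow : Continuous (Φ t) := by
  obtain ⟨C, hC⟩ := exists_lipschitzWith u.2
  obtain ⟨D, hD⟩ := h.exists_lipschitzWith hC t
  exact hD.continuous

theorem measurableSet_transfer (K L : M.Cell) :
    MeasurableSet (simplex K ∩ Φ t ⁻¹' interior (simplex L)) :=
  (isCompact_simplex K).measurableSet.inter
    ((continuous_flow h t).measurable isOpen_interior.measurableSet)

/-- The flow keeps the cell inside the domain, which the open cells cover up to a null set; the
preimage of that set is null because the flow has a Lipschitz inverse. -/
theorem sum_transfer (K : M.Cell) : ∑ L, transfer (Φ t) K L = volume.real (simplex K) := by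
  obtain ⟨C, hC⟩ := exists_lipschitzWith u.2
  obtain ⟨D, hD⟩ := h.exists_lipschitzWith hC (-t)
  have h1 : volume (Φ t ⁻¹' ((⋃ K : M.Cell, simplex K) \ ⋃ K : M.Cell, interior (simplex K))) = 0 :=
    volume_preimage_eq_zero hD (h.neg_apply hC t) volume_union_diff_interior
  have h2 : (⋃ L : M.Cell, simplex K ∩ Φ t ⁻¹' interior (simplex L)) =ᵐ[volume] simplex K := by
    refine Filter.EventuallyEq.trans ?_ (interior_ae_eq_simplex K)
    rw [ae_eq_set]
    constructor
    · refine measure_mono_null (fun x hx => ?_) (ae_eq_set.1 (interior_ae_eq_simplex K)).2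
      obtain ⟨L, hL⟩ := Set.mem_iUnion.1 hx.1
      exact ⟨hL.1, hx.2⟩
    · refine measure_mono_null (fun x hx => ?_) h1
      refine ⟨domain_subset (flow_mem_domain h t (interior_simplex_subset_domain K hx.1)),
          fun hcon => ?_⟩
      obtain ⟨L, hL⟩ := Set.mem_iUnion.1 hcon
      exact hx.2 (Set.mem_iUnion.2 ⟨L, interior_subset hx.1, hL⟩)
  have hfin : ∀ L : M.Cell, volume (simplex K ∩ Φ t ⁻¹' interior (simplex L)) ≠ ⊤ := fun L =>
    measure_ne_top_of_subset Set.inter_subset_left (isCompact_simplex K).measure_lt_top.ne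
  rw [← measureReal_congr h2, measureReal_def, measure_iUnion (pairwise_disjoint_preimage _ _)
    (measurableSet_transfer h t K), tsum_fintype, ENNReal.toReal_sum fun L _ => hfin L]
  rfl

/-- Volume preservation for a closed cell: its indicator is a limit of Lipschitz thickened
indicators, whose integrals the flow conserves. -/
theorem sum_transfer_le (hu : u ∈ M.solenoidal) (L : M.Cell) :
    ∑ K, transfer (Φ t) K L ≤ volume.real (simplex L) := by
  set U := ⋃ K : M.Cell, simplex K
  have hfin : IsFiniteMeasure (volume.restrict U) :=
    isFiniteMeasure_restrict.2 (isCompact_union M).measure_lt_top.ne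
  have hc := continuous_flow h t
  have hLc := (isCompact_simplex L).isClosed
  have hδ : ∀ n : ℕ, (0 : ℝ) < 1 / (n + 1) := fun n => Nat.one_div_pos_of_nat
  have h1 := tendsto_integral_thickenedIndicator_of_isClosed (volume.restrict U) hLc hδ
    tendsto_one_div_add_atTop_nhds_zero_nat
  have h2 := tendsto_integral_thickenedIndicator_of_isClosed ((volume.restrict U).map (Φ t)) hLc hδ
    tendsto_one_div_add_atTop_nhds_zero_nat
  have h3 : ((volume.restrict U).map (Φ t)).real (simplex L)
      = (volume.restrict U).real (simplex L) := by
    refine tendsto_nhds_unique h2 (h1.congr fun n => ?_)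
    rw [integral_map hc.measurable.aemeasurable]
    · exact (setIntegral_comp_flow hu h (f := fun x => (thickenedIndicator (hδ n)
        (simplex L) x : ℝ))
        (lipschitzWith_thickenedIndicator (hδ n) (simplex L)) t).symm
    · exact (NNReal.continuous_coe.comp (thickenedIndicator (hδ n)
        (simplex L)).continuous).aestronglyMeasurable
  rw [measureReal_def, measureReal_def, Measure.map_apply hc.measurable hLc.measurableSet,
    Measure.restrict_apply (hc.measurable hLc.measurableSet),
    Measure.restrict_apply hLc.measurableSet,
    Set.inter_eq_left.2 (Set.subset_iUnion (fun K : M.Cell => simplex K) L)] at h3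
  change _ ≤ (volume (simplex L)).toReal
  rw [← h3]
  have h4 : ∀ K : M.Cell, transfer (Φ t) K L =
      volume.real (interior (simplex K) ∩ Φ t ⁻¹' interior (simplex L)) := fun K =>
    measureReal_congr ((interior_ae_eq_simplex K).symm.inter Filter.EventuallyEq.rfl)
  have hU : volume U ≠ ⊤ := (isCompact_union M).measure_lt_top.ne
  rw [Finset.sum_congr rfl fun K _ => h4 K, ← measureReal_biUnion_finset (h := fun K _ =>
      measure_ne_top_of_subset
      (Set.inter_subset_left.trans (interior_subset.trans
        (Set.subset_iUnion (fun K : M.Cell => simplex K) K))) hU)]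
  · refine ENNReal.toReal_mono (measure_ne_top_of_subset Set.inter_subset_right hU)
      (measure_mono fun x hx => ?_)
    simp only [Set.mem_iUnion] at hx
    obtain ⟨K, -, hx⟩ := hx
    exact ⟨interior_subset (s := simplex L) hx.2, Set.mem_iUnion.2 ⟨K, interior_subset hx.1⟩⟩
  · exact fun K _ K' _ hKK' =>
      (disjoint_interior hKK').mono Set.inter_subset_left Set.inter_subset_left
  · exact fun K _ =>
      isOpen_interior.measurableSet.inter (hc.measurable isOpen_interior.measurableSet)

theorem integral_toField_flow (σ : M.Cell → Tensor d) (K : M.Cell) (i j : Fin d) :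
    IntegrableOn (fun x => toField σ (Φ t x) i j) (simplex K) ∧
      ∫ x in simplex K, toField σ (Φ t x) i j = ∑ L, transfer (Φ t) K L * σ L i j := by
  have e : ∀ x, toField σ (Φ t x) i j =
      ∑ L : M.Cell, (Φ t ⁻¹' interior (simplex L)).indicator (fun _ => σ L i j) x := fun x => by
    rw [toField, Matrix.sum_apply]
    refine Finset.sum_congr rfl fun L _ => ?_
    by_cases hx : Φ t x ∈ interior (simplex L)
    · rw [Set.indicator_of_mem hx,
        Set.indicator_of_mem (show x ∈ Φ t ⁻¹' interior (simplex L) from hx)]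
    · rw [Set.indicator_of_notMem hx,
        Set.indicator_of_notMem (show x ∉ Φ t ⁻¹' interior (simplex L) from hx)]
      rfl
  have hm : ∀ L : M.Cell, MeasurableSet (Φ t ⁻¹' interior (simplex L)) := fun L =>
    (continuous_flow h t).measurable isOpen_interior.measurableSet
  have hfin : IsFiniteMeasure (volume.restrict (simplex K)) :=
    isFiniteMeasure_restrict.2 (isCompact_simplex K).measure_lt_top.ne
  have hi : ∀ L : M.Cell, IntegrableOn ((Φ t ⁻¹' interior (simplex L)).indicator (fun _ => σ L i j))
      (simplex K) := fun L => (integrable_const _).indicator (hm L)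
  simp only [e]
  refine ⟨integrable_finsetSum _ fun L _ => hi L, ?_⟩
  rw [integral_finsetSum _ fun L _ => hi L]
  refine Finset.sum_congr rfl fun L _ => ?_
  rw [setIntegral_indicator (hm L), setIntegral_const, smul_eq_mul]
  rfl

end

end Mesh

end OldroydB

/-! ### The divergence theorem on a simplex -/

namespace OldroydB

section Cone

variable {d : ℕ} {ι : Type*} (b : AffineBasis ι ℝ (Pt d)) (a : ι)

/-- The gradient of a barycentric coordinate. -/
noncomputable def coordGrad : Pt d :=
  (InnerProductSpace.toDual ℝ (Pt d)).symm (LinearMap.toContinuousLinearMap (b.coord a).linear)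

theorem inner_coordGrad (y : Pt d) : inner ℝ (coordGrad b a) y = (b.coord a).linear y := by
  rw [coordGrad, InnerProductSpace.toDual_symm_apply]
  rfl

theorem coord_vadd (x y : Pt d) :
    b.coord a (x + y) = b.coord a x + inner ℝ (coordGrad b a) y := by
  rw [inner_coordGrad, add_comm x y]
  have := (b.coord a).map_vadd x y
  simp only [vadd_eq_add] at this
  rw [this, add_comm]

theorem inner_coordGrad_sub (x y : Pt d) :
    inner ℝ (coordGrad b a) (x - y) = b.coord a x - b.coord a y := by
  have := coord_vadd b a y (x - y)
  rw [add_sub_cancel] at this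
  linarith

theorem coordGrad_ne_zero [Nontrivial ι] : coordGrad b a ≠ 0 := fun h => by
  obtain ⟨i, hi⟩ := exists_ne a
  have := inner_coordGrad_sub b a (b i) (b a)
  rw [h, inner_zero_left, b.coord_apply_eq, b.coord_apply_ne hi.symm] at this
  norm_num at this

/-- The closed simplex spanned by an affine basis. -/
def solid : Set (Pt d) := {x | ∀ i, 0 ≤ b.coord i x}

/-- The closed facet opposite to a vertex. -/
def facet : Set (Pt d) := {x | x ∈ solid b ∧ b.coord a x = 0}

theorem continuous_coord (i : ι) : Continuous (b.coord i) :=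
  continuous_barycentric_coord b i

theorem isClosed_solid : IsClosed (solid b) := by
  rw [solid, Set.ofPred_forall]
  exact isClosed_iInter fun i => isClosed_le continuous_const (continuous_coord b i)

theorem isClosed_facet : IsClosed (facet b a) :=
  (isClosed_solid b).inter (isClosed_eq (continuous_coord b a) continuous_const)

theorem coord_homothety (i : ι) (s : ℝ) (x : Pt d) :
    b.coord i (b a + s • (x - b a)) = b.coord i (b a) + s * (b.coord i x - b.coord i (b a)) := by
  rw [coord_vadd, inner_smul_right, inner_coordGrad_sub]

/-- A slice of the solid simplex parallel to a facet is a homothetic image of the facet. -/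
theorem solid_inter_slice {s : ℝ} (hs : s ∈ Set.Ioo (0 : ℝ) 1) (t : Set (Pt d)) :
    t ∩ solid b ∩ {x | b.coord a x = 1 - s} =
      AffineMap.homothety (b a) s '' (facet b a ∩ {y | b a + s • (y - b a) ∈ t}) := by
  have hs0 := hs.1.ne'
  have e : ∀ y, AffineMap.homothety (b a) s y = b a + s • (y - b a) := fun y => by
    rw [AffineMap.homothety_apply, vsub_eq_sub, vadd_eq_add, add_comm]
  ext x
  constructor
  · rintro ⟨⟨hxt, hx⟩, hxa⟩
    have hb : b a + s • (b a + s⁻¹ • (x - b a) - b a) = x := by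
      rw [add_sub_cancel_left, smul_inv_smul₀ hs0, add_sub_cancel]
    have hxa' : b.coord a x = 1 - s := hxa
    refine ⟨b a + s⁻¹ • (x - b a), ⟨⟨fun i => ?_, ?_⟩, ?_⟩, by rw [e, hb]⟩
    · rw [coord_homothety]
      by_cases hi : i = a
      · subst hi
        rw [b.coord_apply_eq, hxa']
        have : 1 + s⁻¹ * (1 - s - 1) = 0 := by field_simp; ring
        exact this.ge
      · rw [b.coord_apply_ne hi, sub_zero, zero_add]
        exact mul_nonneg (inv_nonneg.2 hs.1.le) (hx i)
    · rw [coord_homothety, b.coord_apply_eq, hxa']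
      field_simp
      ring
    · rw [Set.mem_ofPred_eq, hb]
      exact hxt
  · rintro ⟨y, ⟨⟨hy, hya⟩, hyt⟩, rfl⟩
    rw [e]
    refine ⟨⟨hyt, fun i => ?_⟩, ?_⟩
    · rw [coord_homothety]
      by_cases hi : i = a
      · subst hi
        rw [b.coord_apply_eq, hya]
        linarith [hs.2]
      · rw [b.coord_apply_ne hi, sub_zero, zero_add]
        exact mul_nonneg hs.1.le (hy i)
    · rw [Set.mem_ofPred_eq, coord_homothety, b.coord_apply_eq, hya]
      ring

variable [Fintype ι]

theorem isCompact_solid : IsCompact (solid b) := by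
  have : solid b = convexHull ℝ (Set.range b) := (AffineBasis.convexHull_eq_nonneg_coord b).symm
  rw [this]
  exact (Set.finite_range b).isCompact_convexHull (𝕜 := ℝ)

theorem sum_coordGrad : ∑ a, coordGrad b a = 0 := by
  refine ext_inner_right ℝ fun y => ?_
  rw [sum_inner, inner_zero_left]
  have h : ∀ a, inner ℝ (coordGrad b a) y = b.coord a (0 + y) - b.coord a 0 := fun a => by
    rw [coord_vadd, add_sub_cancel_left]
  rw [Finset.sum_congr rfl fun a _ => h a, Finset.sum_sub_distrib, b.sum_coord_apply_eq_one,
    b.sum_coord_apply_eq_one, sub_self]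

theorem sum_inner_coordGrad_smul (y : Pt d) : ∑ a, inner ℝ (coordGrad b a) y • b a = y := by
  have h : ∀ a, inner ℝ (coordGrad b a) y = b.coord a (0 + y) - b.coord a 0 := fun a => by
    rw [coord_vadd, add_sub_cancel_left]
  simp only [h, sub_smul, Finset.sum_sub_distrib, b.linear_combination_coord_eq_self]
  simp

/-- The volume of a part of a simplex by integration over the slices parallel to a facet. -/
theorem volume_inter_solid [Nontrivial ι] {t : Set (Pt d)} (ht : MeasurableSet t) :
    volume (t ∩ solid b) = ENNReal.ofReal ‖coordGrad b a‖⁻¹ *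
      ∫⁻ s in Set.Ioo (0 : ℝ) 1, ENNReal.ofReal (s ^ (d - 1)) *
        Measure.euclideanHausdorffMeasure (d - 1) (facet b a ∩ {y | b a + s • (y - b a) ∈ t}) := by
  set g := coordGrad b a with hg
  have hg0 : g ≠ 0 := coordGrad_ne_zero b a
  have hgn : ‖g‖ ≠ 0 := norm_ne_zero_iff.2 hg0
  -- The vector normal to the facet whose length is the height of the simplex, so that slice `s` is
  -- the level set `1 - s` of the coordinate of `a`. The slices are homothetic to the facet, hence
  -- the density `s ^ (d - 1)`.
  set v : Pt d := -(‖g‖ ^ 2)⁻¹ • g with hv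
  have hv0 : v ≠ 0 := smul_ne_zero (neg_ne_zero.2 (inv_ne_zero (pow_ne_zero 2 hgn))) hg0
  have hvn : ‖v‖ = ‖g‖⁻¹ := by
    rw [hv, norm_smul, norm_neg, norm_inv, norm_pow, norm_norm]
    field_simp
  have hslice : ∀ s : ℝ, (AffineSubspace.mk' (s • v +ᵥ b a) (ℝ ∙ v)ᗮ : Set (Pt d)) =
      {x | b.coord a x = 1 - s} := fun s => by
    ext x
    rw [SetLike.mem_coe, AffineSubspace.mem_mk', Submodule.mem_orthogonal_singleton_iff_inner_right,
      vsub_eq_sub, vadd_eq_add, add_comm, Set.mem_ofPred_eq, ← sub_sub, inner_sub_right,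
      real_inner_smul_right, real_inner_self_eq_norm_sq, hvn, hv, real_inner_smul_left,
      inner_coordGrad_sub, b.coord_apply_eq]
    constructor
    · intro h
      field_simp at h
      linarith
    · intro h
      rw [h]
      field_simp
      ring
  have hfr : Module.finrank ℝ (Pt d) = d := finrank_euclideanSpace_fin
  have h1 := EuclideanGeometry.euclideanHausdorffMeasure_eq_lintegral (b a) hv0
    (ht.inter (isClosed_solid b).measurableSet)
  rw [InnerProductSpace.euclideanHausdorffMeasure_eq_volume, hfr] at h1
  rw [h1, ← ofReal_norm, hvn]
  congr 1
  have hout : ∀ s : ℝ, s ∉ Set.Icc (0 : ℝ) 1 →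
      t ∩ solid b ∩ (AffineSubspace.mk' (s • v +ᵥ b a) (ℝ ∙ v)ᗮ : Set (Pt d)) = ∅ := fun s hs => by
    rw [hslice, Set.eq_empty_iff_forall_notMem]
    rintro x ⟨⟨-, hx⟩, hxa⟩
    rw [Set.mem_ofPred_eq] at hxa
    have h2 := hx a
    have h3 : ∑ i, b.coord i x = 1 := b.sum_coord_apply_eq_one x
    have h4 := Finset.single_le_sum (fun i _ => hx i) (Finset.mem_univ a)
    exact hs ⟨by linarith, by linarith⟩
  rw [← setLIntegral_eq_of_support_subset (s := Set.Icc (0 : ℝ) 1) (fun s hs => by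
    by_contra hcon
    refine hs ?_
    change Measure.euclideanHausdorffMeasure (d - 1) _ = _
    rw [hout s hcon, measure_empty]), ← setLIntegral_congr Ioo_ae_eq_Icc]
  refine setLIntegral_congr_fun measurableSet_Ioo fun s hs => ?_
  rw [hslice, solid_inter_slice b a hs, euclideanHausdorffMeasure_homothety_image _ _ hs.1.ne',
    ENNReal.smul_def, smul_eq_mul]
  congr 1
  rw [ENNReal.ofReal, ENNReal.coe_inj]
  ext
  simp [abs_of_pos hs.1, Real.coe_toNNReal _ (pow_nonneg hs.1.le _)]

/-- A facet of infinite measure would, by the slice formula, give the compact simplex infinite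
volume. -/
theorem euclideanHausdorffMeasure_facet_lt_top [Nontrivial ι] :
    Measure.euclideanHausdorffMeasure (d - 1) (facet b a) < ⊤ := by
  have h := volume_inter_solid b a MeasurableSet.univ
  simp only [Set.univ_inter, Set.mem_univ, Set.ofPred_true, Set.inter_univ] at h
  by_contra hcon
  rw [not_lt, top_le_iff] at hcon
  rw [hcon] at h
  have h1 : ∫⁻ s in Set.Ioo (0 : ℝ) 1, ENNReal.ofReal (s ^ (d - 1)) * ⊤ = ⊤ := by
    rw [setLIntegral_congr_fun (g := fun _ => ⊤) measurableSet_Ioo fun s hs =>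
      ENNReal.mul_top (ENNReal.ofReal_pos.2 (pow_pos hs.1 _)).ne']
    simp
  rw [h1, ENNReal.mul_top (ENNReal.ofReal_pos.2 (inv_pos.2
    (norm_pos_iff.2 (coordGrad_ne_zero b a)))).ne'] at h
  exact (isCompact_solid b).measure_lt_top.ne h

/-- The surface measure on a facet. -/
noncomputable def facetMeasure : Measure (Pt d) :=
  (Measure.euclideanHausdorffMeasure (d - 1)).restrict (facet b a)

instance [Nontrivial ι] : IsFiniteMeasure (facetMeasure b a) :=
  isFiniteMeasure_restrict.2 (euclideanHausdorffMeasure_facet_lt_top b a).ne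

/-- The radial part of the volume in polar coordinates. -/
noncomputable def radialMeasure (d : ℕ) : Measure ℝ :=
  (volume.restrict (Set.Ioo (0 : ℝ) 1)).withDensity fun s =>
      ((Real.toNNReal (s ^ (d - 1)) : NNReal) : ENNReal)

instance : SFinite (radialMeasure d) := by
  unfold radialMeasure
  infer_instance

/-- Cone coordinates with apex `b a`: the slice formula read as an identity of measures, so that
Fubini's theorem applies. -/
theorem volume_restrict_solid [Nontrivial ι] :
    volume.restrict (solid b) = ENNReal.ofReal ‖coordGrad b a‖⁻¹ •
      ((facetMeasure b a).prod (radialMeasure d)).map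
        fun z : Pt d × ℝ => b a + z.2 • (z.1 - b a) := by
  have hψ : Measurable fun z : Pt d × ℝ => b a + z.2 • (z.1 - b a) := by fun_prop
  refine Measure.ext fun t ht => ?_
  rw [Measure.restrict_apply ht, volume_inter_solid b a ht, Measure.smul_apply,
    Measure.map_apply hψ ht, Measure.prod_apply_symm (hψ ht), smul_eq_mul, radialMeasure,
    lintegral_withDensity_eq_lintegral_mul₀' (by fun_prop)
      ((measurable_measure_prodMk_right (hψ ht)).aemeasurable)]
  congr 2
  ext s
  rw [Pi.mul_apply, facetMeasure, Measure.restrict_apply, Set.inter_comm]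
  · rfl
  · exact (by fun_prop : Measurable fun y : Pt d => b a + s • (y - b a)) ht

theorem integral_solid [Nontrivial ι] {f : Pt d → ℝ} (hf : Continuous f) :
    ∫ x in solid b, f x = ‖coordGrad b a‖⁻¹ *
      ∫ y, (∫ s in Set.Ioo (0 : ℝ) 1, s ^ (d - 1) * f (b a + s • (y - b a))) ∂(facetMeasure b a) :=
          by
  have hψ : Measurable fun z : Pt d × ℝ => b a + z.2 • (z.1 - b a) := by fun_prop
  have hr : (0 : ℝ) < ‖coordGrad b a‖⁻¹ := inv_pos.2 (norm_pos_iff.2 (coordGrad_ne_zero b a))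
  have hi : IntegrableOn f (solid b) := hf.continuousOn.integrableOn_compact (isCompact_solid b)
  rw [IntegrableOn, volume_restrict_solid b a, integrable_smul_measure
    (ENNReal.ofReal_pos.2 hr).ne' ENNReal.ofReal_ne_top,
    integrable_map_measure hf.aestronglyMeasurable hψ.aemeasurable] at hi
  rw [volume_restrict_solid b a, integral_smul_measure, ENNReal.toReal_ofReal hr.le, smul_eq_mul,
    integral_map hψ.aemeasurable hf.aestronglyMeasurable]
  refine congrArg _ ((integral_prod _ hi).trans ?_)
  refine integral_congr_ae (.of_forall fun y => ?_)
  change ∫ s, f (b a + s • (y - b a)) ∂(radialMeasure d) = _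
  rw [radialMeasure, integral_withDensity_eq_integral_smul (by fun_prop)]
  refine setIntegral_congr_fun measurableSet_Ioo fun s hs => ?_
  change (Real.toNNReal (s ^ (d - 1))) • f (b a + s • (y - b a)) = _
  rw [NNReal.smul_def, Real.coe_toNNReal _ (pow_nonneg hs.1.le _), smul_eq_mul]

/-- The divergence theorem on a simplex for radial fields with centre a vertex. -/
theorem integral_radial_divergence [Nontrivial ι] [NeZero d] {c : Pt d → ℝ} (hc : ContDiff ℝ 1 c) :
    ∫ x in solid b, (d * c x + fderiv ℝ c x (x - b a)) =
      ‖coordGrad b a‖⁻¹ * ∫ y, c y ∂(facetMeasure b a) := by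
  have hfc : Continuous (fderiv ℝ c) := hc.continuous_fderiv one_ne_zero
  have hcont : Continuous fun x => d * c x + fderiv ℝ c x (x - b a) :=
    (continuous_const.mul hc.continuous).add (hfc.clm_apply (by fun_prop))
  rw [integral_solid b a hcont]
  congr 1
  refine integral_congr_ae (.of_forall fun y => ?_)
  change ∫ s in Set.Ioo (0 : ℝ) 1, s ^ (d - 1) * (d * c (b a + s • (y - b a))
    + fderiv ℝ c (b a + s • (y - b a)) (b a + s • (y - b a) - b a)) = c y
  -- On each ray from the apex the weighted divergence is the derivative of `s ^ d * c`, so only the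
  -- value on the facet survives.
  have hd : ∀ s : ℝ, HasDerivAt (fun s : ℝ => s ^ d * c (b a + s • (y - b a)))
      (s ^ (d - 1) * (d * c (b a + s • (y - b a))
    + fderiv ℝ c (b a + s • (y - b a)) (b a + s • (y - b a) - b a))) s := fun s => by
    have h1 : HasDerivAt (fun s : ℝ => b a + s • (y - b a)) (y - b a) s := by
      simpa using ((hasDerivAt_id s).smul_const (y - b a)).const_add (b a)
    have h2 := ((hc.differentiable one_ne_zero _).hasFDerivAt.comp_hasDerivAt s h1)
    refine ((hasDerivAt_pow d s).mul h2).congr_deriv ?_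
    rw [add_sub_cancel_left, map_smul, smul_eq_mul]
    simp only [Function.comp]
    rw [← pow_sub_one_mul (NeZero.ne d) s]
    ring
  have hcs : Continuous fun s : ℝ => b a + s • (y - b a) := by fun_prop
  have hint := intervalIntegral.integral_eq_sub_of_hasDerivAt (a := 0) (b := 1) (fun s _ => hd s)
    (((continuous_pow (d - 1)).mul (hcont.comp hcs)).intervalIntegrable 0 1)
  rw [intervalIntegral.integral_of_le zero_le_one, integral_Ioc_eq_integral_Ioo] at hint
  rw [hint]
  simp [zero_pow (NeZero.ne d)]

/-- The divergence theorem on a simplex. -/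
theorem integral_divergence_solid [Nontrivial ι] [NeZero d] {u : Pt d →
    Pt d} (hu : ContDiff ℝ 1 u) :
    ∫ x in solid b, divergence u x =
      -∑ a, ∫ y, inner ℝ (u y) (‖coordGrad b a‖⁻¹ • coordGrad b a) ∂(facetMeasure b a) := by
  have hc : ∀ a, ContDiff ℝ 1 fun x => inner ℝ (coordGrad b a) (u x) := fun a =>
    contDiff_const.inner ℝ hu
  have hfd : ∀ a x y, fderiv ℝ (fun x => inner ℝ (coordGrad b a) (u x)) x y =
      inner ℝ (coordGrad b a) (fderiv ℝ u x y) := fun a x y => by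
    have h := ((innerSL ℝ (coordGrad b a)).hasFDerivAt (x := u x)).comp x
      (hu.differentiable one_ne_zero x).hasFDerivAt
    exact congrArg (fun ℓ => ℓ y) h.fderiv
  -- The barycentric identities give `u = -∑ a, ⟪∇λ_a, u⟫ (x - b a)`, a sum of fields radial from
  -- the vertices. The one with centre `b a` contributes only on the facet opposite to `a`.
  have hdiv : ∀ x, divergence u x = -∑ a, (d * inner ℝ (coordGrad b a) (u x)
      + fderiv ℝ (fun x => inner ℝ (coordGrad b a) (u x)) x (x - b a)) := fun x => by
    simp only [hfd, map_sub, inner_sub_right]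
    rw [Finset.sum_add_distrib, Finset.sum_sub_distrib, ← Finset.mul_sum, ← sum_inner, ← sum_inner,
      sum_coordGrad, inner_zero_left, inner_zero_left, mul_zero, zero_sub, zero_add, neg_neg]
    rw [divergence, Matrix.trace]
    simp only [Matrix.diag_apply, grad, Matrix.of_apply]
    have h1 : ∀ a, inner ℝ (coordGrad b a) (fderiv ℝ u x (b a)) =
        ∑ i, coordGrad b a i * fderiv ℝ u x (b a) i := fun a => by
      rw [PiLp.inner_apply]
      simp [mul_comm]
    have h2 : ∀ i, fderiv ℝ u x (EuclideanSpace.single i 1) =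
        ∑ a, coordGrad b a i • fderiv ℝ u x (b a) := fun i => by
      conv_lhs => rw [← sum_inner_coordGrad_smul b (EuclideanSpace.single i 1)]
      rw [map_sum]
      refine Finset.sum_congr rfl fun a _ => ?_
      rw [map_smul, EuclideanSpace.inner_single_right]
      simp
    rw [Finset.sum_congr rfl fun a _ => h1 a, Finset.sum_comm]
    refine Finset.sum_congr rfl fun i _ => ?_
    rw [h2]
    simp
  have hcont : ∀ a, IntegrableOn (fun x => d * inner ℝ (coordGrad b a) (u x)
      + fderiv ℝ (fun x => inner ℝ (coordGrad b a) (u x)) x (x - b a)) (solid b) := fun a =>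
    ((continuous_const.mul (hc a).continuous).add
      (((hc a).continuous_fderiv one_ne_zero).clm_apply (by fun_prop))).continuousOn.integrableOn_compact
        (isCompact_solid b)
  simp only [hdiv]
  rw [integral_neg, integral_finsetSum _ fun a _ => hcont a]
  congr 1
  refine Finset.sum_congr rfl fun a _ => ?_
  rw [integral_radial_divergence b a (hc a), ← integral_const_mul]
  refine integral_congr_ae (.of_forall fun y => ?_)
  simp only [real_inner_smul_right, real_inner_comm]

end Cone

end OldroydB

/-! ### Internal and boundary facets of a conformal mesh -/

namespace OldroydB

namespace Mesh

variable {d : ℕ} {M : Mesh d}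

theorem simplex_eq_solid (K : M.Cell) : simplex K = solid (cellBasis K) := simplex_eq K

instance [NeZero d] (K : M.Cell) : Nontrivial K.1 := by
  rw [← Fintype.one_lt_card_iff_nontrivial, Fintype.card_coe, M.card_eq K.1 K.2]
  have := NeZero.pos d
  omega

theorem coord_eq_zero_of_mem_convexHull (K : M.Cell) {v : K.1} {s : Set (Pt d)}
    (hs : s ⊆ K.1) (hv : (v : Pt d) ∉ s) {x : Pt d} (hx : x ∈ convexHull ℝ s) :
    (cellBasis K).coord v x = 0 := by
  have hc : Convex ℝ {x | (cellBasis K).coord v x = 0} :=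
    (convex_singleton (0 : ℝ)).affine_preimage ((cellBasis K).coord v)
  refine convexHull_min (fun w hw => ?_) hc hx
  have hne : v ≠ ⟨w, hs hw⟩ := fun h => hv (by rw [h]; exact hw)
  have := (cellBasis K).coord_apply_ne hne
  rwa [cellBasis_apply] at this

/-- By conformity the point lies in the hull of the common vertices, and only those can carry
positive coordinates. -/
theorem mem_of_coord_pos {K L : M.Cell} {x : Pt d} (hK : x ∈ simplex K) (hL : x ∈ simplex L)
    {v : K.1} (hv : 0 < (cellBasis K).coord v x) : (v : Pt d) ∈ L.1 := by
  by_contra hcon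
  have hx : x ∈ convexHull ℝ ((K.1 : Set (Pt d)) ∩ L.1) := by
    rw [← M.conformal K.1 K.2 L.1 L.2]
    exact ⟨hK, hL⟩
  exact hv.ne' (coord_eq_zero_of_mem_convexHull K Set.inter_subset_left (fun h => hcon h.2) hx)

theorem eq_of_subset {K L : M.Cell} (h : K.1 ⊆ L.1) : K = L :=
  Subtype.ext (Finset.eq_of_subset_of_card_le h
    ((M.card_eq L.1 L.2).trans (M.card_eq K.1 K.2).symm).le)

/-- The vertex `a` of `K` is the only one that is not a vertex of `L`. -/
def Opposite (K L : M.Cell) (a : K.1) : Prop := ∀ v : K.1, (v : Pt d) ∈ L.1 ↔ v ≠ a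

theorem Opposite.unique {K L : M.Cell} {a a' : K.1} (h : Opposite K L a) (h' : Opposite K L a') :
    a = a' := by
  by_contra hne
  exact ((h a).not.2 (not_not.2 rfl)) ((h' a).2 hne)

theorem opposite_of_forall_ne {K L : M.Cell} (hKL : K ≠ L) {a : K.1}
    (h : ∀ v : K.1, v ≠ a → (v : Pt d) ∈ L.1) : Opposite K L a := fun v => by
  refine ⟨fun hv hva => hKL (eq_of_subset fun w hw => ?_), h v⟩
  by_cases hwa : (⟨w, hw⟩ : K.1) = a
  · rw [hva, ← hwa] at hv
    exact hv
  · exact h ⟨w, hw⟩ hwa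

theorem mem_commonVertices {K L : M.Cell} {v : Pt d} :
    v ∈ commonVertices K L ↔ v ∈ K.1 ∧ v ∈ L.1 := by
  classical
  rw [commonVertices, Finset.mem_inter]

theorem commonVertices_comm (K L : M.Cell) : commonVertices K L = commonVertices L K := by
  ext v
  rw [mem_commonVertices, mem_commonVertices, and_comm]

theorem Adjacent.symm {K L : M.Cell} (h : Adjacent K L) : Adjacent L K := by
  rw [Adjacent, commonVertices_comm]
  exact h

theorem face_comm (K L : M.Cell) : face K L = face L K := by
  rw [face, face, commonVertices_comm]

theorem adjacent_iff_exists_opposite (K L : M.Cell) : Adjacent K L ↔ ∃ a, Opposite K L a := by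
  classical
  have h1 : (K.1.filter fun v => v ∈ L.1) = commonVertices K L := by
    ext v
    rw [Finset.mem_filter, mem_commonVertices]
  have h2 := Finset.card_filter_add_card_filter_not (s := K.1) (fun v => v ∈ L.1)
  rw [h1, M.card_eq K.1 K.2] at h2
  have h3 : Adjacent K L ↔ (K.1.filter fun v => v ∉ L.1).card = 1 := by
    rw [Adjacent]
    omega
  rw [h3, Finset.card_eq_one]
  constructor
  · rintro ⟨a, ha⟩
    have ha' : a ∈ K.1.filter fun v => v ∉ L.1 := ha ▸ Finset.mem_singleton_self a
    refine ⟨⟨a, (Finset.mem_filter.1 ha').1⟩, fun v => ?_⟩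
    have := Finset.ext_iff.1 ha v
    rw [Finset.mem_filter, Finset.mem_singleton] at this
    rw [Ne, Subtype.ext_iff]
    have hv := v.2
    tauto
  · rintro ⟨a, ha⟩
    refine ⟨a, ?_⟩
    ext v
    rw [Finset.mem_filter, Finset.mem_singleton]
    constructor
    · rintro ⟨hv, hvL⟩
      by_contra hne
      exact hvL ((ha ⟨v, hv⟩).2 fun h => hne (congrArg Subtype.val h))
    · rintro rfl
      exact ⟨a.2, (ha a).not.2 (not_not.2 rfl)⟩

/-- A facet is spanned by the vertices other than the opposite one. -/
theorem facet_subset_convexHull (K : M.Cell) (a : K.1) {s : Set (Pt d)}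
    (hs : ∀ v : K.1, v ≠ a → (v : Pt d) ∈ s) : facet (cellBasis K) a ⊆ convexHull ℝ s := by
  classical
  rintro x ⟨hx, hxa⟩
  have h1 := (cellBasis K).linear_combination_coord_eq_self x
  have h2 := (cellBasis K).sum_coord_apply_eq_one x
  rw [← Finset.add_sum_erase _ _ (Finset.mem_univ a), hxa, zero_smul, zero_add] at h1
  rw [← Finset.add_sum_erase _ _ (Finset.mem_univ a), hxa, zero_add] at h2
  rw [← h1]
  exact (convex_convexHull ℝ s).sum_mem (fun i _ => hx i) h2 fun i hi =>
    subset_convexHull ℝ s (hs i (Finset.ne_of_mem_erase hi))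

theorem facet_subset_simplex {K L : M.Cell} {a : K.1} (h : Opposite K L a) :
    facet (cellBasis K) a ⊆ simplex L :=
  facet_subset_convexHull K a fun v hv => (h v).2 hv

theorem face_eq_facet {K L : M.Cell} {a : K.1} (h : Opposite K L a) :
    face K L = facet (cellBasis K) a := by
  refine Set.Subset.antisymm (fun x hx => ⟨?_, ?_⟩)
    (facet_subset_convexHull K a fun v hv => mem_commonVertices.2 ⟨v.2, (h v).2 hv⟩)
  · rw [← simplex_eq_solid]
    exact convexHull_mono (fun v hv => (mem_commonVertices.1 hv).1) hx
  · exact coord_eq_zero_of_mem_convexHull K (fun v hv => (mem_commonVertices.1 hv).1)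
      (fun hv => (h a).not.2 (not_not.2 rfl) (mem_commonVertices.1 hv).2) hx

/-- Project an interior point of the cell from the vertex `a` onto the opposite facet. -/
theorem exists_relint_facet [NeZero d] (K : M.Cell) (a : K.1) :
    ∃ m ∈ facet (cellBasis K) a, ∀ v, v ≠ a → 0 < (cellBasis K).coord v m := by
  obtain ⟨p, hp⟩ := interior_simplex_nonempty K
  rw [interior_simplex] at hp
  have hp' : ∀ v, 0 < (cellBasis K).coord v p := hp
  obtain ⟨w, hw⟩ := exists_ne a
  have h1 : (cellBasis K).coord a p < 1 := by
    rw [← (cellBasis K).sum_coord_apply_eq_one p]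
    exact Finset.single_lt_sum hw (Finset.mem_univ a) (Finset.mem_univ w) (hp' w)
      fun i _ _ => (hp' i).le
  have h2 : 0 < (1 - (cellBasis K).coord a p)⁻¹ := inv_pos.2 (by linarith)
  have ha : (cellBasis K).coord a (cellBasis K a + (1 - (cellBasis K).coord a p)⁻¹ • (p - cellBasis K a)) = 0 := by
    rw [coord_homothety, (cellBasis K).coord_apply_eq]
    have : (1 - (cellBasis K).coord a p) ≠ 0 := by linarith
    field_simp
    ring
  have hv : ∀ v, v ≠ a → 0 < (cellBasis K).coord v
      (cellBasis K a + (1 - (cellBasis K).coord a p)⁻¹ • (p - cellBasis K a)) := fun v hv => by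
    rw [coord_homothety, (cellBasis K).coord_apply_ne hv, sub_zero, zero_add]
    exact mul_pos h2 (hp' v)
  refine ⟨_, ⟨fun i => ?_, ha⟩, hv⟩
  by_cases hi : i = a
  · rw [hi, ha]
  · exact (hv i hi).le

theorem coord_segment (K : M.Cell) (v : K.1) (x y : Pt d) (t : ℝ) :
    (cellBasis K).coord v (x + t • (y - x)) =
      (1 - t) * (cellBasis K).coord v x + t * (cellBasis K).coord v y := by
  rw [coord_vadd, inner_smul_right, inner_coordGrad_sub]
  ring

/-- Two cells with a common facet lie on opposite sides of it. -/
theorem coord_opposite_neg [NeZero d] {K L : M.Cell} {a : K.1} {b : L.1} (ha : Opposite K L a)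
    (hb : Opposite L K b) : (cellBasis K).coord a b < 0 := by
  by_contra hcon
  rw [not_lt] at hcon
  obtain ⟨m, hm, hpos⟩ := exists_relint_facet K a
  have hmL : m ∈ simplex L := facet_subset_simplex ha hm
  -- If `b` were on the side of `K`, a short move from the relative interior of the facet towards
  -- `b` would stay in both cells and have a positive coordinate at `b`. This would make `b` a
  -- vertex of `K`.
  have hev : ∀ᶠ t in 𝓝[>] (0 : ℝ), ∀ v, 0 ≤ (cellBasis K).coord v (m + t • ((b : Pt d) - m)) := by
    rw [Filter.eventually_all]
    intro v
    by_cases hv : v = a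
    · subst hv
      filter_upwards [self_mem_nhdsWithin] with t ht
      rw [coord_segment, hm.2, mul_zero, zero_add]
      exact mul_nonneg (le_of_lt ht) hcon
    · have hc : Continuous fun t : ℝ => (cellBasis K).coord v (m + t • ((b : Pt d) - m)) :=
        (continuous_coord _ v).comp (by fun_prop)
      have h0 : 0 < (cellBasis K).coord v (m + (0 : ℝ) • ((b : Pt d) - m)) := by
        rw [zero_smul, add_zero]
        exact hpos v hv
      filter_upwards [nhdsWithin_le_nhds (hc.continuousAt.eventually (lt_mem_nhds h0))] with t ht
      exact le_of_lt ht
  obtain ⟨t, ht, htI⟩ := (hev.and (Ioc_mem_nhdsGT (zero_lt_one' ℝ))).exists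
  have hzK : m + t • ((b : Pt d) - m) ∈ simplex K := by
    rw [simplex_eq_solid]
    exact ht
  have hzL : m + t • ((b : Pt d) - m) ∈ simplex L :=
    (convex_simplex L).add_smul_sub_mem hmL (subset_convexHull ℝ _ b.2) ⟨htI.1.le, htI.2⟩
  have hbpos : 0 < (cellBasis L).coord b (m + t • ((b : Pt d) - m)) := by
    have h1 : (cellBasis L).coord b (b : Pt d) = 1 := (cellBasis L).coord_apply_eq b
    have h2 : 0 ≤ (cellBasis L).coord b m := by
      rw [simplex_eq_solid] at hmL
      exact hmL b
    rw [coord_segment, h1, mul_one]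
    have := mul_nonneg (sub_nonneg.2 htI.2) h2
    linarith [htI.1]
  exact (hb b).not.2 (not_not.2 rfl) (mem_of_coord_pos hzL hzK hbpos)

theorem Opposite.exists_symm {K L : M.Cell} {a : K.1} (h : Opposite K L a) :
    ∃ b, Opposite L K b :=
  (adjacent_iff_exists_opposite L K).1 ((adjacent_iff_exists_opposite K L).2 ⟨a, h⟩).symm

theorem affineMap_apply_eq_sum (K : M.Cell) (f : Pt d →ᵃ[ℝ] ℝ) (x : Pt d) :
    f x = ∑ v, (cellBasis K).coord v x * f v := by
  have h1 := (cellBasis K).affineCombination_coord_eq_self x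
  have h2 := (cellBasis K).sum_coord_apply_eq_one x
  conv_lhs => rw [← h1, Finset.map_affineCombination _ _ _ h2]
  rw [Finset.affineCombination_eq_linear_combination _ _ _ h2]
  rfl

/-- At most one further cell contains a given facet. -/
theorem Opposite.cell_unique [NeZero d] {K L L' : M.Cell} {a : K.1} (h : Opposite K L a)
    (h' : Opposite K L' a) : L = L' := by
  by_contra hne
  obtain ⟨b, hb⟩ := h.exists_symm
  obtain ⟨b', hb'⟩ := h'.exists_symm
  -- Two different neighbours across the same facet are neighbours of each other, so the coordinate
  -- of `b` is negative at `b'`. Expanded in the coordinates of `K` it is a product of two negative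
  -- numbers.
  have h1 : Opposite L L' b := opposite_of_forall_ne hne fun v hv =>
    (h' ⟨v, (hb v).2 hv⟩).2 ((h ⟨v, (hb v).2 hv⟩).1 v.2)
  have h2 : Opposite L' L b' := opposite_of_forall_ne (Ne.symm hne) fun v hv =>
    (h ⟨v, (hb' v).2 hv⟩).2 ((h' ⟨v, (hb' v).2 hv⟩).1 v.2)
  have h3 := coord_opposite_neg h1 h2
  have h4 := coord_opposite_neg h' hb'
  have h5 := coord_opposite_neg hb h
  rw [affineMap_apply_eq_sum K, Finset.sum_eq_single a (fun v _ hv => ?_)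
    (fun hcon => absurd (Finset.mem_univ a) hcon)] at h3
  · exact absurd (mul_pos_of_neg_of_neg h4 h5) h3.not_gt
  · have hvL : (v : Pt d) ∈ L.1 := (h v).2 hv
    have hne : b ≠ ⟨v, hvL⟩ := fun hbv =>
      (hb b).not.2 (not_not.2 rfl) (by rw [hbv]; exact v.2)
    have := (cellBasis L).coord_apply_ne hne
    rw [cellBasis_apply] at this
    rw [show (cellBasis L).coord b (v : Pt d) = 0 from this, mul_zero]

/-- The unit normal to an internal face in terms of a barycentric coordinate. -/
theorem normal_eq [NeZero d] {K L : M.Cell} {a : K.1} (h : Opposite K L a) :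
    normal K L = -(‖coordGrad (cellBasis K) a‖⁻¹ • coordGrad (cellBasis K) a) := by
  classical
  obtain ⟨b, hb⟩ := h.exists_symm
  set g := coordGrad (cellBasis K) a with hg
  have hgn : 0 < ‖g‖ := norm_pos_iff.2 (coordGrad_ne_zero _ a)
  have hspan : vectorSpan ℝ (commonVertices K L : Set (Pt d)) = (ℝ ∙ g)ᗮ := by
    apply le_antisymm
    · rw [vectorSpan_def, Submodule.span_le]
      rintro _ ⟨v, hv, w, hw, rfl⟩
      have hz : ∀ v ∈ commonVertices K L, (cellBasis K).coord a v = 0 := fun v hv =>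
        coord_eq_zero_of_mem_convexHull K (s := (commonVertices K L : Set (Pt d)))
          (fun v hv => (mem_commonVertices.1 hv).1)
          (fun hv => (h a).not.2 (not_not.2 rfl) (mem_commonVertices.1 hv).2)
          (subset_convexHull ℝ _ hv)
      rw [SetLike.mem_coe, Submodule.mem_orthogonal_singleton_iff_inner_right]
      change inner ℝ g (v - w) = 0
      rw [hg, inner_coordGrad_sub, hz v hv, hz w hw, sub_zero]
    · intro y hy
      rw [Submodule.mem_orthogonal_singleton_iff_inner_right] at hy
      obtain ⟨w, hw⟩ := exists_ne a
      have h1 : y = ∑ v, inner ℝ (coordGrad (cellBasis K) v) y • ((v : Pt d) - w) := by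
        simp only [smul_sub]
        rw [Finset.sum_sub_distrib, ← Finset.sum_smul, ← sum_inner, sum_coordGrad, inner_zero_left,
          zero_smul, sub_zero]
        exact (sum_inner_coordGrad_smul (cellBasis K) y).symm
      rw [h1]
      refine Submodule.sum_mem _ fun v _ => ?_
      by_cases hv : v = a
      · rw [hv, ← hg, hy, zero_smul]
        exact Submodule.zero_mem _
      · exact Submodule.smul_mem _ _ (vsub_mem_vectorSpan ℝ
          (mem_commonVertices.2 ⟨v.2, (h v).2 hv⟩) (mem_commonVertices.2 ⟨w.2, (h w).2 hw⟩))
  have hsum : ∑ b ∈ L.1, b - ∑ a ∈ K.1, a = (b : Pt d) - a := by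
    have e : L.1.erase b = K.1.erase a := by
      ext v
      rw [Finset.mem_erase, Finset.mem_erase]
      constructor
      · rintro ⟨hvb, hv⟩
        have hvK := (hb ⟨v, hv⟩).2 fun e => hvb (congrArg Subtype.val e)
        exact ⟨fun e => (h ⟨v, hvK⟩).1 hv (Subtype.ext e), hvK⟩
      · rintro ⟨hva, hv⟩
        have hvL := (h ⟨v, hv⟩).2 fun e => hva (congrArg Subtype.val e)
        exact ⟨fun e => (hb ⟨v, hvL⟩).1 hv (Subtype.ext e), hvL⟩
    rw [← Finset.add_sum_erase _ _ b.2, ← Finset.add_sum_erase _ _ a.2, e, add_sub_add_right_eq_sub]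
  have hproj : (vectorSpan ℝ (commonVertices K L : Set (Pt d)))ᗮ = ℝ ∙ g := by
    rw [hspan, Submodule.orthogonal_orthogonal]
  have hw : (vectorSpan ℝ (commonVertices K L : Set (Pt d)))ᗮ.starProjection
      (∑ b ∈ L.1, b - ∑ a ∈ K.1, a) = (((cellBasis K).coord a b - 1) / ‖g‖ ^ 2) • g := by
    have h1 := Submodule.starProjection_singleton (𝕜 := ℝ) (v := g) ((b : Pt d) - a)
    have h2 : (cellBasis K).coord a (a : Pt d) = 1 := (cellBasis K).coord_apply_eq a
    rw [hg, inner_coordGrad_sub, h2, ← hg] at h1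
    rw [hsum]
    simp only [hproj]
    exact h1
  -- The vertex `b` lies beyond the facet, so the projection is a negative multiple of `g`; this
  -- fixes the sign of the normal.
  have hneg := coord_opposite_neg h hb
  have hκ : ((cellBasis K).coord a b - 1) / ‖g‖ ^ 2 < 0 :=
    div_neg_of_neg_of_pos (by linarith) (by positivity)
  rw [normal]
  simp only [hw]
  rw [norm_smul, Real.norm_of_nonpos hκ.le, smul_smul, ← neg_smul]
  congr 1
  generalize ((cellBasis K).coord a b - 1) / ‖g‖ ^ 2 = κ at hκ
  have := hκ.ne
  field_simp

/-- A discrete velocity vanishes on the facets that belong to one cell only. -/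
theorem eq_zero_of_not_opposite [NeZero d] (u : M.velocity) {K : M.Cell} {a : K.1}
    (h : ∀ L, ¬ Opposite K L a) {x : Pt d} (hx : x ∈ facet (cellBasis K) a) : u.1 x = 0 := by
  have hlim : Filter.Tendsto (fun n : ℕ => 1 / ((n : ℝ) + 1)) Filter.atTop (𝓝 0) :=
    tendsto_one_div_add_atTop_nhds_zero_nat
  have hpath : ∀ x y : Pt d, Filter.Tendsto (fun n : ℕ => x + (1 / ((n : ℝ) + 1)) • y)
      Filter.atTop (𝓝 x) := fun x y => by
    simpa using (hlim.smul_const y).const_add x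
  -- In the relative interior: if `x` were in the domain, points just beyond the facet would lie in
  -- some cell `L`, frequently along the sequence. `L` is not `K`, and it contains all vertices of
  -- the facet, so it would be opposite to `a`.
  have hrel : ∀ x ∈ facet (cellBasis K) a, (∀ v, v ≠ a → 0 < (cellBasis K).coord v x) →
      u.1 x = 0 := fun x hx hpos => by
    refine eq_zero_of_notMem_domain u.2 fun hdom => ?_
    have hpa := hpath x (x - (a : Pt d))
    have hev := hpa.eventually (isOpen_interior.mem_nhds hdom)
    obtain ⟨L, hL⟩ : ∃ L : M.Cell, ∃ᶠ n : ℕ in Filter.atTop,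
        x + (1 / ((n : ℝ) + 1)) • (x - (a : Pt d)) ∈ simplex L := by
      by_contra hcon
      push Not at hcon
      obtain ⟨n, hn1, hn2⟩ := (hev.and (Filter.eventually_all.2 hcon)).exists
      obtain ⟨L, hL⟩ := Set.mem_iUnion.1 (domain_subset hn1)
      exact hn2 L hL
    have hxL : x ∈ simplex L := (isCompact_simplex L).isClosed.mem_of_frequently_of_tendsto hL hpa
    have hxK : x ∈ simplex K := by rw [simplex_eq_solid]; exact hx.1
    refine h L (opposite_of_forall_ne (fun hKL => ?_) fun v hv =>
        mem_of_coord_pos hxK hxL (hpos v hv))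
    subst hKL
    obtain ⟨n, hn⟩ := hL.exists
    rw [simplex_eq_solid] at hn
    have h1 := hn a
    have h2 : (cellBasis K).coord a (a : Pt d) = 1 := (cellBasis K).coord_apply_eq a
    have h3 : (0 : ℝ) < 1 / ((n : ℝ) + 1) := Nat.one_div_pos_of_nat
    rw [coord_vadd, inner_smul_right, inner_coordGrad_sub, hx.2, h2] at h1
    linarith
  -- An arbitrary point of the facet is a limit of relatively interior ones.
  obtain ⟨m, hm, hmpos⟩ := exists_relint_facet K a
  have hzero : ∀ n : ℕ, u.1 (x + (1 / ((n : ℝ) + 1)) • (m - x)) = 0 := fun n => by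
    have h3 : (0 : ℝ) < 1 / ((n : ℝ) + 1) := Nat.one_div_pos_of_nat
    have h4 : 1 / ((n : ℝ) + 1) ≤ 1 := by
      rw [div_le_one (by positivity)]
      linarith [n.cast_nonneg (α := ℝ)]
    have hp : ∀ v, v ≠ a → 0 < (cellBasis K).coord v (x + (1 / ((n : ℝ) + 1)) • (m - x)) :=
      fun v hv => by
        rw [coord_segment]
        exact add_pos_of_nonneg_of_pos (mul_nonneg (sub_nonneg.2 h4) (hx.1 v))
          (mul_pos h3 (hmpos v hv))
    have h0 : (cellBasis K).coord a (x + (1 / ((n : ℝ) + 1)) • (m - x)) = 0 := by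
      rw [coord_segment, hx.2, hm.2, mul_zero, mul_zero, add_zero]
    refine hrel _ ⟨fun v => ?_, h0⟩ hp
    by_cases hv : v = a
    · rw [hv, h0]
    · exact (hp v hv).le
  have h5 := (u.2.1.tendsto x).comp (hpath x (m - x))
  refine tendsto_nhds_unique h5 ?_
  simp only [Function.comp_def, hzero]
  exact tendsto_const_nhds

end Mesh

end OldroydB

/-! ### Upwind fluxes of the discontinuous Galerkin scheme -/

namespace OldroydB

namespace Mesh

variable {d : ℕ} {M : Mesh d}

theorem Opposite.adjacent {K L : M.Cell} {a : K.1} (h : Opposite K L a) : Adjacent K L :=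
  (adjacent_iff_exists_opposite K L).2 ⟨a, h⟩

theorem normal_comm (K L : M.Cell) : normal L K = -normal K L := by
  have hw : (∑ b ∈ K.1, b - ∑ a ∈ L.1, a : Pt d) = -(∑ b ∈ L.1, b - ∑ a ∈ K.1, a) :=
      (neg_sub _ _).symm
  rw [normal, normal]
  simp only [commonVertices_comm L K, hw, map_neg, norm_neg, smul_neg]

theorem norm_normal_le (K L : M.Cell) : ‖normal K L‖ ≤ 1 := by
  rw [normal]
  simp only [norm_smul, norm_inv, norm_norm]
  exact inv_mul_le_one

/-- The surface measure on a face. -/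
noncomputable def faceMeasure (K L : M.Cell) : Measure (Pt d) :=
  (Measure.euclideanHausdorffMeasure (d - 1)).restrict (face K L)

theorem faceMeasure_comm (K L : M.Cell) : faceMeasure K L = faceMeasure L K := by
  rw [faceMeasure, face_comm, faceMeasure]

theorem faceMeasure_eq {K L : M.Cell} {a : K.1} (h : Opposite K L a) :
    faceMeasure K L = facetMeasure (cellBasis K) a := by
  rw [faceMeasure, face_eq_facet h, facetMeasure]

theorem isFiniteMeasure_faceMeasure [NeZero d] {K L : M.Cell} (h : Adjacent K L) :
    IsFiniteMeasure (faceMeasure K L) := by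
  obtain ⟨a, ha⟩ := (adjacent_iff_exists_opposite K L).1 h
  rw [faceMeasure_eq ha]
  infer_instance

/-- The normal velocity at a face, oriented from `K` to `L`. -/
noncomputable def normalFlux (u : M.velocity) (K L : M.Cell) (x : Pt d) : ℝ :=
  inner ℝ (u.1 x) (normal K L)

theorem abs_normalFlux_le {u : M.velocity} {N : ℝ} (hN : ∀ x, ‖u.1 x‖ ≤ N) (K L : M.Cell)
    (x : Pt d) :
    |normalFlux u K L x| ≤ N :=
  (abs_real_inner_le_norm _ _).trans ((mul_le_of_le_one_right (norm_nonneg _)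
    (norm_normal_le K L)).trans (hN x))

theorem continuous_normalFlux (u : M.velocity) (K L : M.Cell) : Continuous (normalFlux u K L) :=
  u.2.1.inner continuous_const

theorem integrable_normalFlux_comp [NeZero d] (u : M.velocity) {K L : M.Cell} (h : Adjacent K L)
    {f : ℝ → ℝ} (hf : Continuous f) :
    Integrable (fun x => f (normalFlux u K L x)) (faceMeasure K L) := by
  obtain ⟨N, hN0, hN⟩ := exists_norm_le u.2
  have := isFiniteMeasure_faceMeasure h
  obtain ⟨C, hC⟩ := (isCompact_Icc (a := -N) (b := N)).exists_bound_of_continuousOn hf.continuousOn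
  exact Integrable.of_bound (hf.comp (continuous_normalFlux u K L)).aestronglyMeasurable C
    (.of_forall fun x => hC _ (abs_le.1 (abs_normalFlux_le hN K L x)))

open Classical in
/-- The flow rate from the cell `L` into the cell `K`. -/
noncomputable def inflow (u : M.velocity) (K L : M.Cell) : ℝ :=
  if Adjacent K L then ∫ x, max 0 (-normalFlux u K L x) ∂(faceMeasure K L) else 0

theorem inflow_nonneg (u : M.velocity) (K L : M.Cell) : 0 ≤ inflow u K L := by
  rw [inflow]
  split_ifs
  · exact integral_nonneg fun x => le_max_left _ _
  · exact le_rfl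

/-- This bound lets the dissipation of the previous step control `Δt * b ^ 2`. -/
theorem exists_inflow_le [NeZero d] :
    ∃ C, 0 ≤ C ∧ ∀ (u : M.velocity) (K L : M.Cell), inflow u K L ≤ C * √(M.stiffForm u u) := by
  obtain ⟨C, hC0, hC⟩ := exists_norm_le_sqrt_stiffForm (M := M)
  let A : ℝ := ∑ K : M.Cell, ∑ L : M.Cell, (faceMeasure K L).real Set.univ
  have hA : ∀ K L : M.Cell, (faceMeasure K L).real Set.univ ≤ A := fun K L =>
    (Finset.single_le_sum (f := fun L : M.Cell => (faceMeasure K L).real Set.univ)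
      (fun L _ => measureReal_nonneg) (Finset.mem_univ L)).trans
    (Finset.single_le_sum (f := fun K : M.Cell => ∑ L : M.Cell, (faceMeasure K L).real Set.univ)
      (fun K _ => Finset.sum_nonneg fun L _ => measureReal_nonneg) (Finset.mem_univ K))
  have hA0 : 0 ≤ A := Finset.sum_nonneg fun K _ => Finset.sum_nonneg fun L _ => measureReal_nonneg
  refine ⟨C * A, mul_nonneg hC0 hA0, fun u K L => ?_⟩
  have hs : 0 ≤ C * √(M.stiffForm u u) := mul_nonneg hC0 (Real.sqrt_nonneg _)
  rw [inflow]
  split_ifs with h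
  · have := isFiniteMeasure_faceMeasure h
    calc ∫ x, max 0 (-normalFlux u K L x) ∂(faceMeasure K L)
        ≤ ∫ _, C * √(M.stiffForm u u) ∂(faceMeasure K L) := by
          refine integral_mono (integrable_normalFlux_comp u h (f := fun r => max 0 (-r))
              (by fun_prop))
            (integrable_const _) fun x => max_le hs ?_
          exact (neg_le_abs _).trans (abs_normalFlux_le (hC u) K L x)
      _ = (faceMeasure K L).real Set.univ * (C * √(M.stiffForm u u)) := by
          rw [integral_const, smul_eq_mul]
      _ ≤ A * (C * √(M.stiffForm u u)) := mul_le_mul_of_nonneg_right (hA K L) hs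
      _ = C * A * √(M.stiffForm u u) := by ring
  · positivity

theorem inflow_symm [NeZero d] (u : M.velocity) {K L : M.Cell} (h : Adjacent K L) :
    inflow u L K = ∫ x, max 0 (normalFlux u K L x) ∂(faceMeasure K L) := by
  rw [inflow, if_pos h.symm, faceMeasure_comm]
  simp only [normalFlux, normal_comm K L, inner_neg_right, neg_neg]

theorem faceIntegral_eq [NeZero d] (u : M.velocity) (σ φ : M.Cell → Tensor d) {K L : M.Cell}
    (h : Adjacent K L) :
    faceIntegral u.1 σ φ K L =
      inflow u L K * ddot (σ L - σ K) (φ L) + inflow u K L * ddot (σ K - σ L) (φ K) := by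
  have e : ∀ x, |inner ℝ (u.1 x) (normal K L)| * ddot (jump u.1 K L σ x) (downstream u.1 K L φ x) =
      max 0 (normalFlux u K L x) * ddot (σ L - σ K) (φ L)
        + max 0 (-normalFlux u K L x) * ddot (σ K - σ L) (φ K) := fun x => by
    simp only [jump, downstream, upstream, normalFlux]
    split_ifs with hx
    · rw [abs_of_pos hx, max_eq_right hx.le, max_eq_left (neg_nonpos.2 hx.le), zero_mul, add_zero]
    · rw [not_lt] at hx
      rw [abs_of_nonpos hx, max_eq_left hx, max_eq_right (neg_nonneg.2 hx), zero_mul, zero_add]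
  rw [inflow_symm u h, inflow, if_pos h, faceIntegral]
  simp only [e]
  rw [← integral_mul_const, ← integral_mul_const, ← integral_add]
  · rfl
  · exact (integrable_normalFlux_comp u h (f := fun r => max 0 r) (by fun_prop)).mul_const _
  · exact (integrable_normalFlux_comp u h (f := fun r => max 0 (-r)) (by fun_prop)).mul_const _

/-- Each face integral is the sum of two inflow terms, one for each direction of the flow. The sum
over ordered pairs meets both twice, which cancels the factor `1 / 2`. -/
theorem upwindForm_eq [NeZero d] (u : M.velocity) (σ φ : M.Cell → Tensor d) :
    M.upwindForm u.1 σ φ = ∑ K, ∑ L, inflow u K L * ddot (σ K - σ L) (φ K) := by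
  classical
  have e : ∀ K L : M.Cell, (if Adjacent K L then faceIntegral u.1 σ φ K L else 0) =
      inflow u L K * ddot (σ L - σ K) (φ L) + inflow u K L * ddot (σ K - σ L) (φ K) := fun K L => by
    split_ifs with h
    · exact faceIntegral_eq u σ φ h
    · rw [inflow, inflow, if_neg h, if_neg fun h' => h h'.symm, zero_mul, zero_mul, add_zero]
  rw [upwindForm]
  simp only [e, Finset.sum_add_distrib]
  rw [Finset.sum_comm]
  ring

/-- The net inflow into a cell in terms of the divergence. -/
theorem sum_inflow_sub [NeZero d] (u : M.velocity) (K : M.Cell) :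
    ∑ L, inflow u L K - ∑ L, inflow u K L = ∫ x in simplex K, divergence u.1 x := by
  classical
  let J : M.Cell → ℝ := fun L => ∫ x, normalFlux u K L x ∂(faceMeasure K L)
  -- Outflow minus inflow through a face is the signed flux; it is attached to the one vertex of `K`
  -- opposite to that face.
  have h1 : ∀ L, inflow u L K - inflow u K L = ∑ a : K.1, if Opposite K L a then J L else 0 :=
      fun L => by
    by_cases h : Adjacent K L
    · obtain ⟨a, ha⟩ := (adjacent_iff_exists_opposite K L).1 h
      rw [Finset.sum_eq_single a (fun a' _ ha' => if_neg fun h' => ha' (h'.unique ha))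
        fun hcon => absurd (Finset.mem_univ a) hcon, if_pos ha, inflow_symm u h, inflow, if_pos h,
        ← integral_sub (integrable_normalFlux_comp u h (f := fun r => max 0 r) (by fun_prop))
          (integrable_normalFlux_comp u h (f := fun r => max 0 (-r)) (by fun_prop))]
      refine integral_congr_ae (.of_forall fun x => ?_)
      change max 0 (normalFlux u K L x) - max 0 (-normalFlux u K L x) = normalFlux u K L x
      rcases le_total 0 (normalFlux u K L x) with hx | hx
      · rw [max_eq_right hx, max_eq_left (neg_nonpos.2 hx), sub_zero]
      · rw [max_eq_left hx, max_eq_right (neg_nonneg.2 hx), zero_sub, neg_neg]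
    · rw [Finset.sum_eq_zero fun a _ => if_neg fun h' => h h'.adjacent, inflow, inflow, if_neg h,
        if_neg fun h' => h h'.symm, sub_zero]
  obtain ⟨P, -, hP⟩ := exists_eqOn_polyField u.2 K
  have hdiv : ∫ x in simplex K, divergence u.1 x = ∫ x in simplex K, divergence (polyField P) x :=
    setIntegral_simplex_congr fun x hx => by
      simp only [divergence, grad, (eventuallyEq_polyField hP hx).fderiv_eq]
  rw [← Finset.sum_sub_distrib, Finset.sum_congr rfl fun L _ => h1 L, Finset.sum_comm, hdiv,
    simplex_eq_solid, integral_divergence_solid _ (contDiff_polyField P), ← Finset.sum_neg_distrib]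
  refine Finset.sum_congr rfl fun a _ => ?_
  have h2 : ∫ y, inner ℝ (polyField P y)
      (‖coordGrad (cellBasis K) a‖⁻¹ • coordGrad (cellBasis K) a) ∂(facetMeasure (cellBasis K) a) =
      ∫ y, inner ℝ (u.1 y)
      (‖coordGrad (cellBasis K) a‖⁻¹ • coordGrad (cellBasis K) a) ∂(facetMeasure (cellBasis K) a) := by
    refine setIntegral_congr_fun (isClosed_facet _ _).measurableSet fun y hy => ?_
    have : y ∈ simplex K := by rw [simplex_eq_solid]; exact hy.1
    simp only [hP this]
  rw [h2]
  -- A facet either belongs to exactly one neighbour and contributes its flux, or lies on the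
  -- boundary, where the velocity vanishes.
  by_cases h : ∃ L, Opposite K L a
  · obtain ⟨L, hL⟩ := h
    rw [Finset.sum_eq_single L (fun L' _ hL' => if_neg fun h' => hL' (h'.cell_unique hL))
      fun hcon => absurd (Finset.mem_univ L) hcon, if_pos hL]
    change ∫ x, normalFlux u K L x ∂(faceMeasure K L) = _
    rw [faceMeasure_eq hL, ← integral_neg]
    simp only [normalFlux, normal_eq hL, inner_neg_right]
  · push Not at h
    rw [Finset.sum_eq_zero fun L _ => if_neg (h L), eq_comm, neg_eq_zero]
    refine integral_eq_zero_of_ae ?_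
    refine (ae_restrict_iff' (isClosed_facet _ _).measurableSet).2 (.of_forall fun y hy => ?_)
    simp only [eq_zero_of_not_opposite u h hy, inner_zero_left, Pi.zero_apply]

end Mesh

end OldroydB

/-! ### Iteration of the schemes -/

namespace OldroydB

theorem exists_seq_of_forall_exists {α : Type*} {P : ℕ → α → Prop} {R : ℕ → α → α → Prop} {x₀ : α}
    (h₀ : P 0 x₀) (h : ∀ n x, P n x → ∃ y, P (n + 1) y ∧ R n x y) :
    ∃ f : ℕ → α, f 0 = x₀ ∧ ∀ n, R n (f n) (f (n + 1)) := by
  choose g hg using h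
  let F : ∀ n : ℕ, {x // P n x} := fun n =>
    Nat.rec ⟨x₀, h₀⟩ (fun n x => ⟨g n x.1 x.2, (hg n x.1 x.2).1⟩) n
  exact ⟨fun n => (F n).1, rfl, fun n => (hg n (F n).1 (F n).2).2⟩

namespace Mesh

variable {d : ℕ} {M : Mesh d}

/-- A step relation in which the stresses are transported by the transfer matrix `m` and the
upwind weights `b`. -/
structure IsTransport (Re Wi ε Δt : ℝ)
    (step : (Pt d → Pt d) → (M.Cell → Tensor d) →
      (Pt d → Pt d) → (M.Cell → Pt d → ℝ) → (M.Cell → Tensor d) → Prop)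
    (u₀ : M.velocity) (C : ℝ) (m b : M.Cell → M.Cell → ℝ) : Prop where
  m_nonneg : ∀ K L, 0 ≤ m K L
  m_sum : ∀ K, ∑ L, m K L = volume.real (simplex K)
  m_sum_le : u₀ ∈ M.solenoidal → ∀ L, ∑ K, m K L ≤ volume.real (simplex L)
  b_nonneg : ∀ K L, 0 ≤ b K L
  b_le : ∀ K L, b K L ≤ C * √(M.stiffForm u₀ u₀)
  b_imbalance : ∀ K, ∑ L, b L K - ∑ L, b K L ≤ |∫ x in simplex K, divergence u₀.1 x|
  realize : ∀ σ₀ : M.Cell → Tensor d, ∃ s : M.Cell → Pt d → Tensor d,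
    (∀ K i j, IntegrableOn (fun x => s K x i j) (simplex K)) ∧
    (∀ K, (Matrix.of fun i j => ∫ x in simplex K, s K x i j) = ∑ L, m K L • σ₀ L) ∧
    ∀ u p σ, step u₀ σ₀ u p σ ↔ u ∈ M.velocitySpace ∧ p ∈ M.pressureSpace ∧ σ ∈ M.stressSpace ∧
      StepEq Re Wi ε Δt u₀ s b u p σ

section

variable [NeZero d] {Re Wi ε Δt : ℝ} (hRe : 0 ≤ Re) (hWi : 0 < Wi) (hε₀ : 0 < ε) (hε₁ : ε < 1)
  {step : (Pt d → Pt d) → (M.Cell → Tensor d) →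
      (Pt d → Pt d) → (M.Cell → Pt d → ℝ) → (M.Cell → Tensor d) → Prop}
  {u₀ : M.velocity} {C : ℝ} {m b : M.Cell → M.Cell → ℝ}

/-- The data of a time step. -/
noncomputable def IsTransport.stepInput (h : IsTransport Re Wi ε Δt step u₀ C m b)
    {σ₀ : M.Cell → Tensor d} (hσ₀ : IsSPD σ₀) {κ β : ℝ} (hκ : 0 ≤ κ)
    (hκ' : ∀ u, -(κ * M.massForm u u) ≤ convForm u₀ u u)
    (hβ' : ∀ K : M.Cell, |∫ x in simplex K, divergence u₀.1 x| ≤ β * volume.real (simplex K)) :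
    StepInput (M.stepForms hRe hWi hε₀ hε₁) where
  load := (M.massForm u₀).domRestrict M.solenoidal
  E := M.massForm u₀ u₀
  load_le := fun v => by
    have := massForm_le u₀ v.1
    change M.massForm u₀ v.1 ≤ (M.massForm v.1 v.1 + M.massForm u₀ u₀) / 2
    linarith
  conv := (convForm u₀).domRestrict₁₂ M.solenoidal M.solenoidal
  κ := κ
  κ_nonneg := hκ
  conv_ge := fun v => hκ' v.1
  m := m
  m_nonneg := h.m_nonneg
  m_sum := h.m_sum
  b := b
  b_nonneg := h.b_nonneg
  β := β
  b_imbalance := fun K => (h.b_imbalance K).trans (hβ' K)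
  σ := σ₀
  σ_posDef := hσ₀

/-- Unique solvability of a step relation from that of the finite-dimensional problem. -/
theorem IsTransport.exists_unique (h : IsTransport Re Wi ε Δt step u₀ C m b)
    {σ₀ : M.Cell → Tensor d} {I : StepInput (M.stepForms hRe hWi hε₀ hε₁)}
    (hI : ∀ v, I.load v = M.massForm u₀ v.1) (hI' : ∀ u v, I.conv u v = convForm u₀ u.1 v.1)
    (hm : I.m = m) (hb : I.b = b) (hσ : I.σ = σ₀)
    (hsol : ∃ u σ, (∀ K, (σ K).PosDef) ∧ (M.stepForms hRe hWi hε₀ hε₁).IsSol I Δt u σ ∧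
        ∀ u' σ', (∀ K, (σ' K).PosDef) → (M.stepForms hRe hWi hε₀ hε₁).IsSol I Δt u' σ' →
          u' = u ∧ σ' = σ) :
    ∃ (u : M.solenoidal) (σ : M.Cell → Tensor d), IsSPD σ ∧
      (M.stepForms hRe hWi hε₀ hε₁).IsSol I Δt u σ ∧ (∃ p, step u₀ σ₀ u.1 p σ) ∧
      ∀ u' p' σ', IsSPD σ' → step u₀ σ₀ u' p' σ' → u' = u.1 ∧ σ' = σ := by
  obtain ⟨s, hs, hs', hstep⟩ := h.realize σ₀
  have hR : Realizes I u₀ s := ⟨hI, hI', hs, by rw [hm, hσ]; exact hs'⟩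
  obtain ⟨u, σ, hpd, hu, huniq⟩ := hsol
  refine ⟨u, σ, hpd, hu, ?_, fun u' p' σ' hpd' hst => ?_⟩
  · obtain ⟨p, hp⟩ := exists_pressure_stepEq hR hu
    exact ⟨p.1, (hstep _ _ _).2 ⟨u.1.2, p.2, fun K => (hpd K).1, hb ▸ hp⟩⟩
  · obtain ⟨hu', hp', hσ', heq⟩ := (hstep _ _ _).1 hst
    rw [← hb] at heq
    obtain ⟨hu'', hsol'⟩ := StepEq.mem_solenoidal_and_isSol hR (u := ⟨u', hu'⟩) (p := ⟨p', hp'⟩)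
      hσ' heq
    obtain ⟨e1, e2⟩ := huniq _ _ hpd' hsol'
    exact ⟨congrArg (fun w : M.solenoidal => (w.1 : Pt d → Pt d)) e1, e2⟩

end

/-- The discrete free energy of a state. -/
noncomputable def energy (Re Wi ε : ℝ) (u : M.velocity) (σ : M.Cell → Tensor d) : ℝ :=
  Re / 2 * M.massForm u u + ε / (2 * Wi) * ∑ K, volume.real (simplex K) * freeEnergy (σ K)

theorem exists_freeEnergy_le_energy {Re Wi ε : ℝ} (hRe : 0 ≤ Re) (hWi : 0 < Wi) (hε₀ : 0 < ε)
    (F : ℝ) : ∃ B : ℝ, ∀ (u : M.velocity) (σ : M.Cell → Tensor d), IsSPD σ →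
      energy Re Wi ε u σ ≤ F → Re * M.massForm u u ≤ 2 * F ∧ ∀ K, freeEnergy (σ K) ≤ B := by
  let B : M.Cell → ℝ := fun K => F / (ε / (2 * Wi) * volume.real (simplex K))
  have hc : 0 < ε / (2 * Wi) := by positivity
  refine ⟨∑ K, |B K|, fun u σ hσ h => ?_⟩
  have h1 : 0 ≤ Re / 2 * M.massForm u u := mul_nonneg (by positivity) (massForm_nonneg u)
  have hterm : ∀ K : M.Cell, 0 ≤ volume.real (simplex K) * freeEnergy (σ K) := fun K =>
    mul_nonneg (volume_simplex_pos K).le (freeEnergy_nonneg (hσ K))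
  have h2 : 0 ≤ ε / (2 * Wi) * ∑ K, volume.real (simplex K) * freeEnergy (σ K) :=
    mul_nonneg hc.le (Finset.sum_nonneg fun K _ => hterm K)
  rw [energy] at h
  refine ⟨by linarith, fun K => ?_⟩
  have h3 := mul_le_mul_of_nonneg_left
    (Finset.single_le_sum (fun K _ => hterm K) (Finset.mem_univ K)) hc.le
  have h4 : freeEnergy (σ K) ≤ B K := by
    rw [le_div_iff₀ (mul_pos hc (volume_simplex_pos K))]
    linarith
  exact h4.trans ((le_abs_self _).trans
    (Finset.single_le_sum (f := fun K => |B K|) (fun K _ => abs_nonneg _) (Finset.mem_univ K)))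

set_option maxHeartbeats 400000 in
/-- A scheme with transport of the stresses is uniquely solvable at all iterations. -/
theorem exists_uniquelySolvable [NeZero d] {Re Wi ε : ℝ} (hRe : 0 ≤ Re) (hWi : 0 < Wi)
    (hε₀ : 0 < ε) (hε₁ : ε < 1)
    {step : ℝ → ℕ → (Pt d → Pt d) → (M.Cell → Tensor d) →
      (Pt d → Pt d) → (M.Cell → Pt d → ℝ) → (M.Cell → Tensor d) → Prop} {C : ℝ}
    (h : ∀ (Δt : ℝ) (n : ℕ) (u₀ : M.velocity), 0 < Δt →
      ∃ m b, IsTransport Re Wi ε Δt (step Δt n) u₀ C m b)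
    (u₀ : M.velocity) {σ₀ : M.Cell → Tensor d} (hσ₀ : IsSPD σ₀) :
    ∃ c₁ : ℝ, 0 < c₁ ∧ ∀ Δt : ℝ, 0 < Δt → Δt < c₁ → M.UniquelySolvable (step Δt) u₀ σ₀ := by
  let S := M.stepForms hRe hWi hε₀ hε₁
  have := finiteDimensional_velocity (M := M)
  obtain ⟨κ, hκ0, hκ⟩ := exists_conv_lower u₀
  let β : ℝ := ∑ K : M.Cell, |∫ x in simplex K, divergence u₀.1 x| / volume.real (simplex K)
  have hβ0 : 0 ≤ β := Finset.sum_nonneg fun K _ => by positivity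
  have hβ : ∀ K : M.Cell, |∫ x in simplex K, divergence u₀.1 x| ≤ β * volume.real (simplex K) :=
    fun K => by
      rw [← div_le_iff₀ (volume_simplex_pos K)]
      exact Finset.single_le_sum
        (f := fun K : M.Cell => |∫ x in simplex K, divergence u₀.1 x| / volume.real (simplex K))
        (fun K _ => by positivity) (Finset.mem_univ K)
  let V : ℝ := ∑ K : M.Cell, volume.real (simplex K)
  -- Twice the bound for the right-hand side of the first energy estimate. The factor pays for an
  -- initial velocity that is not divergence-free; the crude bound `m K L ≤ vol K` replaces volume
  -- preservation.
  let F : ℝ := Re * M.massForm u₀ u₀ + ε / Wi * (V * ∑ L, freeEnergy (σ₀ L))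
  have hψ : ∀ L, 0 ≤ freeEnergy (σ₀ L) := fun L => freeEnergy_nonneg (hσ₀ L)
  obtain ⟨B, hB⟩ := exists_freeEnergy_le_energy (M := M) hRe hWi hε₀ F
  -- These three bounds cover the first step as well as all later ones, so the threshold `c` is
  -- chosen once.
  let e : ℝ := Re * M.massForm u₀ u₀ + 2 * |F|
  let B' : ℝ := (∑ L, freeEnergy (σ₀ L)) + |B|
  let W : ℝ := C ^ 2 * (M.stiffForm u₀ u₀ + |F| / (1 - ε))
  have hε₁' : 0 < 1 - ε := sub_pos.2 hε₁
  have hstiff : ∀ u : M.velocity, 0 ≤ M.stiffForm u u := fun u => by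
    by_cases hu : u = 0
    · simp [hu]
    · exact (stiffForm_pos u hu).le
  obtain ⟨c, hc0, hc⟩ := S.exists_unique_isSol e B' W
  refine ⟨min (min c 1) (1 / (4 * κ + 2 * β + 1)), by positivity, fun Δt hΔt hlt => ?_⟩
  have hlt1 : Δt < c := hlt.trans_le ((min_le_left _ _).trans (min_le_left _ _))
  have hlt2 : Δt < 1 := hlt.trans_le ((min_le_left _ _).trans (min_le_right _ _))
  have hlt3 : Δt * (4 * κ + 2 * β + 1) < 1 := by
    have := hlt.trans_le (min_le_right _ _)
    rwa [lt_div_iff₀ (by positivity)] at this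
  have hκΔ : 4 * κ * Δt ≤ 1 := by nlinarith
  have hβΔ : 2 * β * Δt ≤ 1 := by nlinarith
  -- The invariant: the state is either the initial one, or solenoidal with energy and last
  -- dissipation at most `F`.
  let P : ℕ → M.velocity × (M.Cell → Tensor d) → Prop := fun n x => IsSPD x.2 ∧
    ((n = 0 ∧ x = (u₀, σ₀)) ∨ (x.1 ∈ M.solenoidal ∧ energy Re Wi ε x.1 x.2 ≤ F ∧
      Δt * ((1 - ε) * M.stiffForm x.1 x.1) ≤ F))
  let R : ℕ → M.velocity × (M.Cell → Tensor d) → M.velocity × (M.Cell → Tensor d) → Prop :=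
    fun n x y => IsSPD y.2 ∧ (∃ p, step Δt n x.1 x.2 y.1 p y.2) ∧
      ∀ u p σ, IsSPD σ → step Δt n x.1 x.2 u p σ → u = y.1.1 ∧ σ = y.2
  obtain ⟨f, hf0, hf⟩ : ∃ f : ℕ → M.velocity × (M.Cell → Tensor d), f 0 = (u₀, σ₀) ∧
      ∀ n, R n (f n) (f (n + 1)) := by
    refine exists_seq_of_forall_exists (P := P) ⟨hσ₀, Or.inl ⟨rfl, rfl⟩⟩ ?_
    rintro n ⟨w, τ⟩ ⟨hτ, hcase⟩
    change IsSPD τ at hτ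
    obtain ⟨m, b, hT⟩ := h Δt n w hΔt
    have hbW : ∀ G, M.stiffForm w w * Δt ≤ G → ∀ K L, Δt * b K L ^ 2 ≤ C ^ 2 * G :=
      fun G hG K L => by
        have h1 : b K L ^ 2 ≤ (C * √(M.stiffForm w w)) ^ 2 :=
          pow_le_pow_left₀ (hT.b_nonneg K L) (hT.b_le K L) 2
        rw [mul_pow, Real.sq_sqrt (hstiff w)] at h1
        have h2 := mul_le_mul_of_nonneg_left h1 hΔt.le
        have h3 := mul_le_mul_of_nonneg_left hG (sq_nonneg C)
        linarith
    rcases hcase with ⟨-, hx⟩ | ⟨hw, hE, hst⟩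
    · obtain ⟨rfl, rfl⟩ := Prod.mk.inj hx
      let I := hT.stepInput hRe hWi hε₀ hε₁ hτ hκ0 hκ hβ
      obtain ⟨u, σ, hσ, hsol, hex, huniq⟩ := hT.exists_unique hRe hWi hε₀ hε₁ (I := I) (fun _ =>
          rfl)
        (fun _ _ => rfl) rfl rfl rfl (hc I Δt hΔt hlt1 (le_add_of_nonneg_right (by positivity))
          (fun L => (Finset.single_le_sum (fun L _ => hψ L) (Finset.mem_univ L)).trans
            (le_add_of_nonneg_right (abs_nonneg B)))
          (hbW _ (by
            have h1 := mul_le_mul_of_nonneg_left hlt2.le (hstiff w)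
            have h2 : 0 ≤ |F| / (1 - ε) := by positivity
            linarith)) hκΔ hβΔ)
      refine ⟨(u.1, σ), ⟨hσ, Or.inr ?_⟩, hσ, hex, huniq⟩
      have hen := hsol.energy_le hΔt hσ
      change (1 - 2 * κ * Δt) * (Re / 2 * M.massForm u.1 u.1) + (1 - β * Δt) * (ε / (2 * Wi) *
        ∑ K, volume.real (simplex K) * freeEnergy (σ K)) + Δt * ((1 - ε) * M.stiffForm u.1 u.1) ≤
        Re / 2 * M.massForm w w + ε / (2 * Wi) * ∑ K, ∑ L, m K L * freeEnergy (τ L) at hen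
      have h1 : ∑ K, ∑ L, m K L * freeEnergy (τ L) ≤ V * ∑ L, freeEnergy (τ L) := by
        rw [Finset.sum_mul]
        refine Finset.sum_le_sum fun K _ => ?_
        rw [Finset.mul_sum]
        refine Finset.sum_le_sum fun L _ => mul_le_mul_of_nonneg_right ?_ (hψ L)
        rw [← hT.m_sum K]
        exact Finset.single_le_sum (fun L _ => hT.m_nonneg K L) (Finset.mem_univ L)
      have hc' : 0 ≤ ε / (2 * Wi) := by positivity
      have h2 := mul_le_mul_of_nonneg_left h1 hc'
      have h3 : ε / Wi = 2 * (ε / (2 * Wi)) := by field_simp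
      have hFdef : F = Re * M.massForm w w + ε / Wi * (V * ∑ L, freeEnergy (τ L)) := rfl
      rw [h3] at hFdef
      have hX : 0 ≤ Re / 2 * M.massForm u.1 u.1 := mul_nonneg (by positivity) (massForm_nonneg _)
      have hY : 0 ≤ ε / (2 * Wi) * ∑ K, volume.real (simplex K) * freeEnergy (σ K) :=
        mul_nonneg hc' (Finset.sum_nonneg fun K _ =>
          mul_nonneg (volume_simplex_pos K).le (freeEnergy_nonneg (hσ K)))
      have hZ : 0 ≤ Δt * ((1 - ε) * M.stiffForm u.1 u.1) :=
        mul_nonneg hΔt.le (mul_nonneg hε₁'.le (hstiff _))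
      have hA1 := mul_le_mul_of_nonneg_right hκΔ hX
      have hA2 := mul_le_mul_of_nonneg_right hβΔ hY
      refine ⟨u.2, ?_, ?_⟩
      · rw [energy]
        linarith
      · linarith
    · obtain ⟨hRE, hFE⟩ := hB w τ hτ hE
      have hκ' : ∀ u, -((0 : ℝ) * M.massForm u u) ≤ convForm w u u := fun u => by
        rw [zero_mul, neg_zero, convForm_self_of_solenoidal hw u]
      have hdiv : ∀ K : M.Cell, |∫ x in simplex K, divergence w.1 x|
          ≤ 0 * volume.real (simplex K) :=
        fun K => by
          rw [setIntegral_simplex_congr (divergence_eq_zero_of_mem_solenoidal hw K), integral_zero,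
            abs_zero, zero_mul]
      let I := hT.stepInput hRe hWi hε₀ hε₁ hτ le_rfl hκ' hdiv
      have hE0 : 0 ≤ Re * M.massForm u₀ u₀ := mul_nonneg hRe (massForm_nonneg _)
      obtain ⟨u, σ, hσ, hsol, hex, huniq⟩ := hT.exists_unique hRe hWi hε₀ hε₁ (I := I) (fun _ =>
          rfl)
        (fun _ _ => rfl) rfl rfl rfl (hc I Δt hΔt hlt1
          (hRE.trans (by
            have := le_abs_self F
            change 2 * F ≤ Re * M.massForm u₀ u₀ + 2 * |F|
            linarith))
          (fun L => ((hFE L).trans (le_abs_self B)).trans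
            (le_add_of_nonneg_left (Finset.sum_nonneg fun L _ => hψ L)))
          (hbW _ (by
            -- The dissipation of the previous step bounds the upwind weights of this one.
            have h1 : M.stiffForm w w * Δt ≤ |F| / (1 - ε) := by
              rw [le_div_iff₀ hε₁']
              have := le_abs_self F
              linarith
            have h2 := hstiff u₀
            linarith))
          (by change 4 * (0 : ℝ) * Δt ≤ 1; simp) (by change 2 * (0 : ℝ) * Δt ≤ 1; simp))
      refine ⟨(u.1, σ), ⟨hσ, Or.inr ?_⟩, hσ, hex, huniq⟩
      have hen := hsol.energy_le hΔt hσ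
      change (1 - 2 * 0 * Δt) * (Re / 2 * M.massForm u.1 u.1) + (1 - 0 * Δt) * (ε / (2 * Wi) *
        ∑ K, volume.real (simplex K) * freeEnergy (σ K)) + Δt * ((1 - ε) * M.stiffForm u.1 u.1) ≤
        Re / 2 * M.massForm w w + ε / (2 * Wi) * ∑ K, ∑ L, m K L * freeEnergy (τ L) at hen
      -- Volume preservation: the transport does not increase the elastic energy, so the bound `F`
      -- persists unchanged.
      have h1 : ∑ K, ∑ L, m K L * freeEnergy (τ L) ≤
          ∑ L, volume.real (simplex L) * freeEnergy (τ L) := by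
        rw [Finset.sum_comm]
        refine Finset.sum_le_sum fun L _ => ?_
        rw [← Finset.sum_mul]
        exact mul_le_mul_of_nonneg_right (hT.m_sum_le hw L) (freeEnergy_nonneg (hτ L))
      have hc' : 0 ≤ ε / (2 * Wi) := by positivity
      have h2 := mul_le_mul_of_nonneg_left h1 hc'
      have hX : 0 ≤ Re / 2 * M.massForm u.1 u.1 := mul_nonneg (by positivity) (massForm_nonneg _)
      have hY : 0 ≤ ε / (2 * Wi) * ∑ K, volume.real (simplex K) * freeEnergy (σ K) :=
        mul_nonneg hc' (Finset.sum_nonneg fun K _ =>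
          mul_nonneg (volume_simplex_pos K).le (freeEnergy_nonneg (hσ K)))
      have hZ : 0 ≤ Δt * ((1 - ε) * M.stiffForm u.1 u.1) :=
        mul_nonneg hΔt.le (mul_nonneg hε₁'.le (hstiff _))
      rw [energy] at hE
      refine ⟨u.2, ?_, ?_⟩
      · rw [energy]
        linarith
      · linarith
  refine ⟨fun n => (f n).1, fun n => (f n).2, by simp only [hf0], by simp only [hf0], fun n => ?_⟩
  exact hf n

/-- The transport data of the characteristic scheme. -/
theorem exists_isTransport_characteristic {Re Wi ε Δt : ℝ} (hΔt : 0 < Δt) (n : ℕ)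
    (u₀ : M.velocity) :
    ∃ m b, IsTransport Re Wi ε Δt (M.IsCharacteristicStep Re Wi ε Δt n) u₀ 0 m b := by
  obtain ⟨Φ, hΦ⟩ := exists_isFlow_velocity u₀
  -- Trajectories are followed backwards over one step; there are no upwind terms, so `b` and its
  -- constant are zero.
  refine ⟨transfer (Φ (-Δt)), fun _ _ => 0, fun K L => transfer_nonneg _ K L, sum_transfer hΦ _,
    fun hu => sum_transfer_le hΦ _ hu, fun _ _ => le_rfl, fun _ _ => by rw [zero_mul],
    fun K => by simp, fun σ₀ => ⟨fun _ x => toField σ₀ (Φ (-Δt) x),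
      fun K i j => (integral_toField_flow hΦ _ σ₀ K i j).1, fun K => ?_, fun u p σ => ?_⟩⟩
  · ext i j
    rw [Matrix.of_apply, (integral_toField_flow hΦ _ σ₀ K i j).2, Matrix.sum_apply]
    rfl
  · have hle : (n : ℝ) * Δt ≤ (n + 1) * Δt := by linarith
    have ht : (n : ℝ) * Δt - (n + 1) * Δt = -Δt := by ring
    have hcongr : ∀ X, M.IsBackwardFlow u₀ (n * Δt) ((n + 1) * Δt) X →
        ∀ (v : Pt d → Pt d) (q : M.Cell → Pt d → ℝ) (φ : M.Cell → Tensor d),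
        ∑ K : M.Cell, ∫ x in simplex K, (bulkIntegrand Re Wi ε Δt u₀ u v (p K) (q K) (σ K) (φ K) x
          + ddot ((1 / Δt) • (σ K - toField σ₀ (X (n * Δt) x))) (φ K)) =
        ∑ K : M.Cell, ∫ x in simplex K, (bulkIntegrand Re Wi ε Δt u₀ u v (p K) (q K) (σ K) (φ K) x
          + ddot ((1 / Δt) • (σ K - toField σ₀ (Φ (-Δt) x))) (φ K)) := fun X hX v q φ =>
      Finset.sum_congr rfl fun K _ => setIntegral_simplex_congr fun x hx => by
        rw [hX.eq_flow hΦ hle (interior_simplex_subset_domain K hx), ht]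
    constructor
    · rintro ⟨hu, hp, hσ, X, hX, heq⟩
      refine ⟨hu, hp, hσ, fun v hv q hq φ hφ => ?_⟩
      rw [← hcongr X hX]
      simpa using heq v hv q hq φ hφ
    · rintro ⟨hu, hp, hσ, heq⟩
      have hX := isBackwardFlow_of_isFlow hΦ (n * Δt) ((n + 1) * Δt)
      refine ⟨hu, hp, hσ, _, hX, fun v hv q hq φ hφ => ?_⟩
      rw [hcongr _ hX]
      simpa using heq v hv q hq φ hφ

/-- The transport data of the discontinuous Galerkin scheme. -/
theorem exists_isTransport_DG [NeZero d] : ∃ C, ∀ {Re Wi ε Δt : ℝ} (u₀ : M.velocity),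
    ∃ m b, IsTransport Re Wi ε Δt (M.IsDGStep Re Wi ε Δt) u₀ C m b := by
  classical
  obtain ⟨C, -, hC⟩ := exists_inflow_le (M := M)
  refine ⟨C, fun {Re Wi ε Δt} u₀ =>
    -- The old stress stays in its cell, so the transfer matrix is diagonal, and the flow rates act
    -- as upwind weights.
    ⟨fun K L => if K = L then volume.real (simplex K) else 0, inflow u₀, fun K L => ?_,
      fun K => by simp, fun _ L => by simp, inflow_nonneg u₀, hC u₀,
      fun K => (sum_inflow_sub u₀ K).le.trans (le_abs_self _), fun σ₀ => ⟨fun K _ => σ₀ K,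
        fun K i j => ?_, fun K => ?_, fun u p σ => ?_⟩⟩⟩
  · split_ifs
    · exact measureReal_nonneg
    · exact le_rfl
  · have : IsFiniteMeasure (volume.restrict (simplex K)) :=
      isFiniteMeasure_restrict.2 (isCompact_simplex K).measure_lt_top.ne
    exact integrable_const _
  · simp only [ite_smul, zero_smul, Finset.sum_ite_eq, Finset.mem_univ, if_true, setIntegral_const]
    rfl
  · simp only [IsDGStep, StepEq, upwindForm_eq]

end Mesh

end OldroydB

end

theorem mainTheorem8 (d : ℕ) (hd : d = 2 ∨ d = 3) (M : OldroydB.Mesh d)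
    (Re Wi ε : ℝ) (hRe : 0 ≤ Re) (hWi : 0 < Wi) (hε₀ : 0 < ε) (hε₁ : ε < 1)
    (u₀ : OldroydB.Pt d → OldroydB.Pt d) (hu₀ : u₀ ∈ M.velocitySpace)
    (σ₀ : M.Cell → OldroydB.Tensor d) (hσ₀ : σ₀ ∈ M.stressSpace)
    (hσ₀_spd : OldroydB.Mesh.IsSPD σ₀) :
    (∃ c₁ : ℝ, 0 < c₁ ∧ ∀ Δt : ℝ, 0 < Δt → Δt < c₁ →
      M.UniquelySolvable (fun n => M.IsCharacteristicStep Re Wi ε Δt n) u₀ σ₀) ∧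
    (∃ c₁ : ℝ, 0 < c₁ ∧ ∀ Δt : ℝ, 0 < Δt → Δt < c₁ →
      M.UniquelySolvable (fun _ => M.IsDGStep Re Wi ε Δt) u₀ σ₀) := by
  have : NeZero d := ⟨by omega⟩
  obtain ⟨C, hC⟩ := OldroydB.Mesh.exists_isTransport_DG (M := M)
  exact ⟨OldroydB.Mesh.exists_uniquelySolvable hRe hWi hε₀ hε₁
      (fun _ n u hΔt => OldroydB.Mesh.exists_isTransport_characteristic hΔt n u) ⟨u₀, hu₀⟩ hσ₀_spd,
    OldroydB.Mesh.exists_uniquelySolvable hRe hWi hε₀ hε₁ (fun _ _ u _ => hC u) ⟨u₀, hu₀⟩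
      hσ₀_spd⟩
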